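/- **Setting.** Let $B(0,r)$ be the open Euclidean ball of radius $r$ in $\mathbb R^d$. Let $\xi$ be a random variable with values in a measurable space $\Xi$, and let $f(\cdot;\xi):\mathbb R^d\to\mathbb R$, $\xi\in\Xi$, be $C^3$ functions whose gradients are measurable in $\xi$ and give unbiased estimates of the gradient of a differentiable function $f:\mathbb R^d\to\mathbb R$, i.e. $\mathbb E_\xi[\nabla f(x;\xi)]=\nabla f(x)$ for all $x$. Assume that $f$ has a local minimum at $0$ and that there are $\gamma,b,R_1>0$ such that each $f(\cdot;\xi)$ is $\gamma$-strongly convex on $B(0,R_1)$, $\sup_\xi\|\nabla f(0;\xi)\|\le b$, and $R_1>R_0:=\frac{16b}{3\gamma}$. Let $R\in(R_0,R_1]$, let $f(\cdot;\xi)\in C^7(B(0,R))$ with $C^7(B(0,R))$ norms bounded uniformly in $\xi$ (for finite $\Xi$: with finite $C^7$ norms), and let $\varphi\in C^6(B(0,R))$ with finite $C^6(B(0,R))$ norm. Let $L\ge\sup_\xi\sup_{x\in B(0,R)}\|\nabla^2 f(x;\xi)\|$ (spectral norm), and put $$\eta_0:=\frac{2R(\gamma R-b)}{(b+LR)^2}>0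 .$$ For $\eta>0$ and $x\in B(0,R)$ let $X_0=x$, $X_{n+1}=X_n-\eta\nabla f(X_n;\xi_n)$ with $\xi_0,\xi_1,\dots$ i.i.d. copies of $\xi$, and write $\mathbb E_x$ for the expectation. With $\Sigma=\mathbb E_\xi[(\nabla f(\cdot;\xi)-\nabla f)\otimes(\nabla f(\cdot;\xi)-\nabla f)]$ let $$\mathcal L_1=-\nabla f\cdot\nabla,\qquad \mathcal L_2=-\tfrac14\nabla\|\nabla f\|^2\cdot\nabla+\tfrac12\mathrm{Tr}(\Sigma\nabla^2),$$ and let $u_0,u_1$ be the classical solutions on $B(0,R)\times[0,\infty)$ ($C^1$ jointly in $(x,t)$, $u_0$ also $C^2$ in $x$) of $$\partial_tu_0=\mathcal L_1u_0,\ u_0(\cdot,0)=\varphi,\qquad \partial_tu_1=\mathcal L_1u_1+\mathcal L_2u_0,\ u_1(\cdot,0)=0 .$$ **Theorem.** Such $u_0,u_1$ exist, and there is a constant $C=C(\varphi,f,R)>0$, where the dependence on $f$ is on the family $f(\cdot;\xi)$, the law of $\xi$ and the associated constants $\gamma,b,L,R_1$, such that for all such $u_0,u_1$, all $0<\eta\le\eta_0$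 and all $n\ge0$, the random variable $\varphi(X_n)$ is integrable for every $x\in B(0,R)$ and, with $u^1=u_0+\eta u_1$, $$\sup_{x\in B(0,R)}\left|\mathbb E_x[\varphi(X_n)]-u^1(x,n\eta)\right|\le C\,\eta^2 .$$ -/

import Mathlib

open MeasureTheory ProbabilityTheory Metric Set
open scoped InnerProductSpace

namespace SGD

noncomputable section

/-- Euclidean space `ℝ^d`. -/
abbrev E (d : ℕ) : Type := EuclideanSpace ℝ (Fin d)

/-- The standing assumption on the random functions `F ξ = f(·; ξ)`, where `ξ` has law `μ`, on the
objective function `f`, and on the constants `γ` (strong convexity), `b` (bound of the random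
gradients at the minimum `0`) and `R₁` (radius of the ball of strong convexity). -/
structure Assumption {d : ℕ} {Ξ : Type*} [MeasurableSpace Ξ] (μ : Measure Ξ)
    (F : Ξ → E d → ℝ) (f : E d → ℝ) (γ b R₁ : ℝ) : Prop where
  gamma_pos : 0 < γ
  b_pos : 0 < b
  radius_pos : 0 < R₁
  /-- `0` is a local minimum of `f`. -/
  isLocalMin : IsLocalMin f 0
  /-- The random functions are `C³` on the whole space. -/
  contDiff : ∀ ξ, ContDiff ℝ 3 (F ξ)
  measurable_gradient : ∀ x, Measurable fun ξ => gradient (F ξ) x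
  integrable_gradient : ∀ x, Integrable (fun ξ => gradient (F ξ) x) μ
  /-- Unbiasedness: `f` is differentiable, and `∇f(x) = 𝔼 ∇f(x; ξ)` for all `x`. -/
  unbiased : ∀ x, HasGradientAt f (∫ ξ, gradient (F ξ) x ∂μ) x
  /-- Each random function is `γ`-strongly convex on `B(0, R₁)`. -/
  strongConvex : ∀ ξ, StrongConvexOn (ball (0 : E d) R₁) γ (F ξ)
  gradient_zero_le : ∀ ξ, ‖gradient (F ξ) 0‖ ≤ b
  radius_gt : 16 * b / (3 * γ) < R₁

/-- `g ∈ C^k(B(0, R))` for every member `g = G i` of a family, with `C^k(B(0, R))` norms bounded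
uniformly over the family. For a finite family of functions this says that each member has a
finite `C^k(B(0, R))` norm. -/
def IsCkBall {d : ℕ} {I : Type*} (k : ℕ) (R : ℝ) (G : I → E d → ℝ) : Prop :=
  (∀ i, ContDiffOn ℝ k (G i) (ball 0 R)) ∧
    ∃ M : ℝ, ∀ i, ∀ j ≤ k, ∀ x ∈ ball (0 : E d) R, ‖iteratedFDeriv ℝ j (G i) x‖ ≤ M

/-- The covariance matrix `Σ(x) = 𝔼[(∇f(x;ξ) - ∇f(x)) ⊗ (∇f(x;ξ) - ∇f(x))]`. -/
def covMatrix {d : ℕ} {Ξ : Type*} [MeasurableSpace Ξ] (μ : Measure Ξ)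
    (F : Ξ → E d → ℝ) (f : E d → ℝ) (x : E d) : Matrix (Fin d) (Fin d) ℝ :=
  Matrix.of fun i j =>
    ∫ ξ, (gradient (F ξ) x - gradient f x) i * (gradient (F ξ) x - gradient f x) j ∂μ

/-- The Hessian matrix `∇²v(x)`. -/
def hessMatrix {d : ℕ} (v : E d → ℝ) (x : E d) : Matrix (Fin d) (Fin d) ℝ :=
  Matrix.of fun i j =>
    iteratedFDeriv ℝ 2 v x ![EuclideanSpace.single i (1 : ℝ), EuclideanSpace.single j (1 : ℝ)]

/-- `𝓛₁ v = -∇f · ∇v`. -/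
def L1 {d : ℕ} (f : E d → ℝ) (v : E d → ℝ) (x : E d) : ℝ :=
  -⟪gradient f x, gradient v x⟫_ℝ

/-- `𝓛₂ v = -(1/4) ∇‖∇f‖² · ∇v + (1/2) Tr(Σ ∇²v)`. -/
def L2 {d : ℕ} {Ξ : Type*} [MeasurableSpace Ξ] (μ : Measure Ξ)
    (F : Ξ → E d → ℝ) (f : E d → ℝ) (v : E d → ℝ) (x : E d) : ℝ :=
  -(1 / 4) * ⟪gradient (fun y => ‖gradient f y‖ ^ 2) x, gradient v x⟫_ℝ
    + (1 / 2) * (covMatrix μ F f x * hessMatrix v x).trace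

/-- `u` is a classical (jointly `C¹`) solution on `B(0, R) × [0, ∞)` of the transport equation
`∂ₜ u = 𝓛₁ u + g` with initial value `u(·, 0) = φ`. -/
structure IsTransportSolution {d : ℕ} (f : E d → ℝ) (R : ℝ) (g : E d → ℝ → ℝ) (φ : E d → ℝ)
    (u : E d → ℝ → ℝ) : Prop where
  contDiffOn : ContDiffOn ℝ 1 (fun p : E d × ℝ => u p.1 p.2) (ball 0 R ×ˢ Ici 0)
  initial : ∀ x ∈ ball (0 : E d) R, u x 0 = φ x
  equation : ∀ x ∈ ball (0 : E d) R, ∀ t, 0 ≤ t →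
    HasDerivWithinAt (fun s => u x s) (L1 f (fun y => u y t) x + g x t) (Ici 0) t

/-- `u₀`, `u₁` are the first two coefficients of the formal expansion on `B(0, R) × [0, ∞)`:
`∂ₜ u₀ = 𝓛₁ u₀`, `u₀(·, 0) = φ` and `∂ₜ u₁ = 𝓛₁ u₁ + 𝓛₂ u₀`, `u₁(·, 0) = 0`; here `u₀` is
`C²` in space, so that `𝓛₂ u₀` makes sense. -/
structure IsExpansion {d : ℕ} {Ξ : Type*} [MeasurableSpace Ξ] (μ : Measure Ξ)
    (F : Ξ → E d → ℝ) (f : E d → ℝ) (R : ℝ) (φ : E d → ℝ) (u₀ u₁ : E d → ℝ → ℝ) : Prop where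
  solution_zero : IsTransportSolution f R (fun _ _ => 0) φ u₀
  contDiffOn_space : ∀ t, 0 ≤ t → ContDiffOn ℝ 2 (fun x => u₀ x t) (ball 0 R)
  solution_one : IsTransportSolution f R (fun x t => L2 μ F f (fun y => u₀ y t) x) (fun _ => 0) u₁

/-- The iterates of stochastic gradient descent with constant step size `η`, started at `x` and
driven by the sequence `ξ`: `X₀ = x`, `Xₙ₊₁ = Xₙ - η ∇f(Xₙ; ξₙ)`. -/
def iterate {d : ℕ} {Ξ Ω : Type*} (F : Ξ → E d → ℝ) (η : ℝ) (ξ : ℕ → Ω → Ξ) (x : E d) :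
    ℕ → Ω → E d
  | 0, _ => x
  | n + 1, ω => iterate F η ξ x n ω - η • gradient (F (ξ n ω)) (iterate F η ξ x n ω)

/-- The step size threshold; `L` bounds the Hessians of the random functions on `B(0, R)`. -/
def eta0 (γ b L R : ℝ) : ℝ := 2 * R * (γ * R - b) / (b + L * R) ^ 2

end

end SGD

open Filter Topology

/-! Write `V = ∇f`, let `Φ` be the semiflow of `-V`, and put `c = γ/4`. By characteristics `u₀(·,t)
= φ ∘ Φ_t`, and by Duhamel's principle `u₁(·,t) = ∫₀ᵗ (𝓛₂ u₀(·,s)) ∘ Φ_{t-s} ds`. Classical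
solutions are determined along characteristics (`SolvesTransport.unique`), so only this pair has to
be estimated.

Local error. Averaging `v` over one gradient step gives `v + η 𝓛₁v + (η²/2) 𝔼[D²v(∇f(·;ξ), ∇f(·;ξ))]
+ O(η³)`, while transporting `v` for time `η` gives `v + η 𝓛₁v + (η²/2) 𝓛₁²v + O(η³)`. The operator
`𝓛₂` is exactly half the difference of the two second order coefficients (`secondOrderOp_eq`), so
the source of `u₁` cancels the `η²` defect of `u₀`. Hence one averaged step takes `u¹(·,t)` to
`u¹(·,t+η)` up to `O(η³)` (`ExpansionBounds.norm_local_error_le`).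

Decay. A bound uniform in `n` needs local errors that are summable in time. The values of `u₀` need
not decay, but its spatial derivatives do, like `e^{-ct}`, and those of `u₁` do like `t e^{-ct}`.
This is `IsDissipative.exists_derivBound_comp_flow`. Strong monotonicity makes the Euler map `x -
hV(x)` a contraction with factor `1 - hγ/2`, and its derivatives of order at least two are `O(h)`.
If order `j` is measured against `lam^j` with `lam` large, composition with this map shrinks the
derivatives of all orders at once by `1 - hγ/4`. Taking `n` steps of size `t/n` and letting `n → ∞`
gives the decay, since derivative bounds pass to pointwise limits at the cost of one order
(`CkBound.of_tendsto`). The flow itself never has to be differentiated in its initial point.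

Summation. Below the threshold `η₀` the iterates stay in the ball (`norm_sub_smul_lt`). The Markov
property telescopes the global error into local ones (`abs_integral_iterate_sub_le`), and `∑ η³
e^{-cjη}(1 + jη) = O(η²)` uniformly in `n`. -/

/-- `g` is `C^k` on `U`, with all derivatives of order at most `k` bounded by `M` on `U`. -/
def CkBound {E F : Type} [NormedAddCommGroup E] [NormedSpace ℝ E] [NormedAddCommGroup F]
    [NormedSpace ℝ F] (U : Set E) (k : ℕ) (M : ℝ) (g : E → F) : Prop :=
  ContDiffOn ℝ k g U ∧ ∀ j ≤ k, ∀ x ∈ U, ‖iteratedFDeriv ℝ j g x‖ ≤ M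

/-- `g` is differentiable on `U`, and its derivatives of orders `1, …, k + 1` exist and are
bounded by `M` on `U`. -/
def DerivBound {E F : Type} [NormedAddCommGroup E] [NormedSpace ℝ E] [NormedAddCommGroup F]
    [NormedSpace ℝ F] (U : Set E) (k : ℕ) (M : ℝ) (g : E → F) : Prop :=
  DifferentiableOn ℝ g U ∧ CkBound U k M (fderiv ℝ g)

/-! ### Calculus of functions with uniform derivative bounds -/

section CkBound

variable {E F G H : Type} [NormedAddCommGroup E] [NormedSpace ℝ E] [NormedAddCommGroup F]
  [NormedSpace ℝ F] [NormedAddCommGroup G] [NormedSpace ℝ G] [NormedAddCommGroup H]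
  [NormedSpace ℝ H] {U : Set E} {k : ℕ} {M : ℝ}

theorem iteratedFDeriv_congr_of_isOpen (hU : IsOpen U) {g g' : E → F} (h : EqOn g g' U) (j : ℕ)
    {x : E} (hx : x ∈ U) : iteratedFDeriv ℝ j g x = iteratedFDeriv ℝ j g' x :=
  (Filter.EventuallyEq.iteratedFDeriv ℝ (h.eventuallyEq_of_mem (hU.mem_nhds hx)) j).eq_of_nhds

theorem fderiv_congr_of_isOpen (hU : IsOpen U) {g g' : E → F} (h : EqOn g g' U) :
    EqOn (fderiv ℝ g) (fderiv ℝ g') U := fun _ hx =>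
  (h.eventuallyEq_of_mem (hU.mem_nhds hx)).fderiv_eq

namespace CkBound

theorem congr (hU : IsOpen U) {g g' : E → F} (hg : CkBound U k M g) (h : EqOn g' g U) :
    CkBound U k M g' :=
  ⟨hg.1.congr h, fun j hj x hx => by
    rw [iteratedFDeriv_congr_of_isOpen hU h j hx]; exact hg.2 j hj x hx⟩

theorem mono {g : E → F} {k' : ℕ} {M' : ℝ} (hg : CkBound U k M g) (hk : k' ≤ k) (hM : M ≤ M') :
    CkBound U k' M' g :=
  ⟨hg.1.of_le (by exact_mod_cast hk), fun j hj x hx => (hg.2 j (hj.trans hk) x hx).trans hM⟩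

theorem norm_le {g : E → F} (hg : CkBound U k M g) {x : E} (hx : x ∈ U) : ‖g x‖ ≤ M := by
  simpa using hg.2 0 (Nat.zero_le _) x hx

theorem continuousOn {g : E → F} (hg : CkBound U k M g) : ContinuousOn g U := hg.1.continuousOn

theorem zero_iff {g : E → F} : CkBound U 0 M g ↔ ContinuousOn g U ∧ ∀ x ∈ U, ‖g x‖ ≤ M := by
  constructor
  · exact fun h => ⟨h.continuousOn, fun x hx => h.norm_le hx⟩
  · rintro ⟨h1, h2⟩
    refine ⟨by simpa using h1, fun j hj x hx => ?_⟩
    obtain rfl : j = 0 := by omega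
    simpa using h2 x hx

theorem succ_iff (hU : IsOpen U) {g : E → F} :
    CkBound U (k + 1) M g ↔
      DifferentiableOn ℝ g U ∧ (∀ x ∈ U, ‖g x‖ ≤ M) ∧ CkBound U k M (fderiv ℝ g) := by
  have key : ContDiffOn ℝ ((k + 1 : ℕ) : WithTop ℕ∞) g U ↔
      DifferentiableOn ℝ g U ∧ ContDiffOn ℝ k (fderiv ℝ g) U := by
    have := contDiffOn_succ_iff_fderiv_of_isOpen (𝕜 := ℝ) (f := g) (n := (k : WithTop ℕ∞)) hU
    push_cast
    rw [this]
    simp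
  constructor
  · intro h
    refine ⟨(key.1 h.1).1, fun x hx => h.norm_le hx, (key.1 h.1).2, fun j hj x hx => ?_⟩
    rw [norm_iteratedFDeriv_fderiv]
    exact h.2 _ (by omega) x hx
  · rintro ⟨h1, h2, h3⟩
    refine ⟨key.2 ⟨h1, h3.1⟩, fun j hj x hx => ?_⟩
    rcases j with _ | j
    · simpa using h2 x hx
    · rw [← norm_iteratedFDeriv_fderiv]
      exact h3.2 j (by omega) x hx

theorem derivBound (hU : IsOpen U) {g : E → F} (h : CkBound U (k + 1) M g) : DerivBound U k M g :=
  ⟨((succ_iff hU).1 h).1, ((succ_iff hU).1 h).2.2⟩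

theorem clm_comp (A : F →L[ℝ] G) (hU : IsOpen U) {g : E → F} (hg : CkBound U k M g) :
    CkBound U k (‖A‖ * M) (fun x => A (g x)) := by
  refine ⟨A.contDiff.comp_contDiffOn hg.1, fun j hj x hx => ?_⟩
  have := A.norm_iteratedFDeriv_comp_left (f := g) (x := x) (n := j)
    (hg.1.contDiffAt (hU.mem_nhds hx)) (by exact_mod_cast hj)
  exact this.trans (mul_le_mul_of_nonneg_left (hg.2 j hj x hx) (norm_nonneg _))

theorem neg {g : E → F} (hg : CkBound U k M g) : CkBound U k M (fun x => -g x) := by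
  refine ⟨hg.1.neg, fun j hj x hx => ?_⟩
  have : iteratedFDeriv ℝ j (fun x => -g x) x = -iteratedFDeriv ℝ j g x := by
    exact iteratedFDeriv_neg_apply
  rw [this, norm_neg]; exact hg.2 j hj x hx

theorem add (hU : IsOpen U) {N : ℝ} {g g' : E → F} (hg : CkBound U k M g)
    (hg' : CkBound U k N g') : CkBound U k (M + N) (fun x => g x + g' x) := by
  refine ⟨hg.1.add hg'.1, fun j hj x hx => ?_⟩
  have h1 := (hg.1.contDiffAt (hU.mem_nhds hx)).of_le
    (show (j : WithTop ℕ∞) ≤ k by exact_mod_cast hj)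
  have h2 := (hg'.1.contDiffAt (hU.mem_nhds hx)).of_le
    (show (j : WithTop ℕ∞) ≤ k by exact_mod_cast hj)
  have : iteratedFDeriv ℝ j (fun x => g x + g' x) x
      = iteratedFDeriv ℝ j g x + iteratedFDeriv ℝ j g' x := iteratedFDeriv_add_apply h1 h2
  rw [this]
  exact (norm_add_le _ _).trans (add_le_add (hg.2 j hj x hx) (hg'.2 j hj x hx))

theorem sub (hU : IsOpen U) {N : ℝ} {g g' : E → F} (hg : CkBound U k M g)
    (hg' : CkBound U k N g') : CkBound U k (M + N) (fun x => g x - g' x) := by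
  simpa [sub_eq_add_neg] using hg.add hU hg'.neg

theorem bilin (B : F →L[ℝ] G →L[ℝ] H) (hU : IsOpen U) {N : ℝ} {f : E → F} {g : E → G}
    (hf : CkBound U k M f) (hg : CkBound U k N g) :
    CkBound U k (‖B‖ * (2 ^ k * M * N)) (fun x => B (f x) (g x)) := by
  refine ⟨B.isBoundedBilinearMap.contDiff.comp_contDiffOn (hf.1.prodMk hg.1),
    fun j hj x hx => ?_⟩
  have := B.norm_iteratedFDerivWithin_le_of_bilinear (n := j) (N := k) hf.1 hg.1
    hU.uniqueDiffOn hx (by exact_mod_cast hj)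
  rw [iteratedFDerivWithin_of_isOpen _ hU hx] at this
  refine this.trans (mul_le_mul_of_nonneg_left ?_ (by positivity))
  have hM : 0 ≤ M := (norm_nonneg _).trans (hf.norm_le hx)
  have hN : 0 ≤ N := (norm_nonneg _).trans (hg.norm_le hx)
  calc _ ≤ ∑ i ∈ Finset.range (j + 1), (j.choose i : ℝ) * (M * N) := by
        refine Finset.sum_le_sum fun i hi => ?_
        have hi' : i ≤ j := by simpa [Nat.lt_succ_iff] using hi
        rw [iteratedFDerivWithin_of_isOpen _ hU hx, iteratedFDerivWithin_of_isOpen _ hU hx,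
          mul_assoc]
        have h1 := hf.2 i (hi'.trans hj) x hx
        have h2 := hg.2 (j - i) ((Nat.sub_le _ _).trans hj) x hx
        gcongr
    _ = 2 ^ j * (M * N) := by
        rw [← Finset.sum_mul]
        congr 1
        exact_mod_cast Nat.sum_range_choose j
    _ ≤ 2 ^ k * M * N := by
        rw [mul_assoc]
        gcongr
        norm_num

end CkBound

namespace DerivBound

theorem congr (hU : IsOpen U) {g g' : E → F} (hg : DerivBound U k M g) (h : EqOn g' g U) :
    DerivBound U k M g' :=
  ⟨hg.1.congr h, hg.2.congr hU (fderiv_congr_of_isOpen hU h)⟩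

theorem mono {g : E → F} {k' : ℕ} {M' : ℝ} (hg : DerivBound U k M g) (hk : k' ≤ k)
    (hM : M ≤ M') : DerivBound U k' M' g := ⟨hg.1, hg.2.mono hk hM⟩

theorem contDiffOn (hU : IsOpen U) {g : E → F} (hg : DerivBound U k M g) :
    ContDiffOn ℝ (k + 1 : ℕ) g U := by
  have := contDiffOn_succ_iff_fderiv_of_isOpen (𝕜 := ℝ) (f := g) (n := (k : WithTop ℕ∞)) hU
  push_cast
  rw [this]
  exact ⟨hg.1, by simp, hg.2.1⟩

theorem ckBound (hU : IsOpen U) {g : E → F} (hg : DerivBound U k M g)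
    (h : ∀ x ∈ U, ‖g x‖ ≤ M) : CkBound U (k + 1) M g := (CkBound.succ_iff hU).2 ⟨hg.1, h, hg.2⟩

/-- The first order Taylor estimate. -/
theorem norm_sub_sub_le {g : E → F} (hU : IsOpen U) (hg : DerivBound U 1 M g) {s : Set E}
    (hs : Convex ℝ s) (hsU : s ⊆ U) {x y : E} (hx : x ∈ s) (hy : y ∈ s) :
    ‖g y - g x - fderiv ℝ g x (y - x)‖ ≤ M * ‖y - x‖ ^ 2 := by
  have hM : 0 ≤ M := (norm_nonneg _).trans (hg.2.norm_le (hsU hx))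
  have h2 := ((CkBound.succ_iff hU).1 hg.2)
  have hseg : segment ℝ x y ⊆ s := hs.segment_subset hx hy
  have key : ∀ z ∈ segment ℝ x y, ‖fderiv ℝ g z - fderiv ℝ g x‖ ≤ M * ‖y - x‖ := by
    intro z hz
    have := hs.norm_image_sub_le_of_norm_fderiv_le (𝕜 := ℝ) (f := fderiv ℝ g) (C := M)
      (fun w hw => (h2.1 w (hsU hw)).differentiableAt (hU.mem_nhds (hsU hw)))
      (fun w hw => h2.2.2.norm_le (hsU hw)) hx (hseg hz)
    refine this.trans (mul_le_mul_of_nonneg_left ?_ hM)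
    obtain ⟨a, b, ha, hb, hab, rfl⟩ := hz
    have : a • x + b • y - x = b • (y - x) := by
      obtain rfl : a = 1 - b := by linarith
      module
    rw [this, norm_smul, Real.norm_of_nonneg hb]
    nlinarith [norm_nonneg (y - x)]
  have := (convex_segment x y).norm_image_sub_le_of_norm_fderiv_le' (𝕜 := ℝ) (f := g)
    (C := M * ‖y - x‖) (φ := fderiv ℝ g x)
    (fun w hw => (hg.1 w (hsU (hseg hw))).differentiableAt (hU.mem_nhds (hsU (hseg hw))))
    key (left_mem_segment ℝ x y) (right_mem_segment ℝ x y)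
  rw [pow_two, ← mul_assoc]
  exact this

end DerivBound

/-! ### Pointwise limits -/

theorem ContinuousLinearMap.eq_sum_smulRight_finBasis [FiniteDimensional ℝ E] (A : E →L[ℝ] F) :
    A = ∑ i, (LinearMap.toContinuousLinearMap ((Module.finBasis ℝ E).coord i)).smulRight
      (A (Module.finBasis ℝ E i)) := by
  ext x
  conv_lhs => rw [← (Module.finBasis ℝ E).sum_repr x, map_sum]
  simp

/-- A Cauchy criterion made for derivatives: the approximants `g` will be difference quotients at a
fixed scale, which converge because the functions do. -/
theorem exists_tendsto_of_uniformly_close {F : Type*} [NormedAddCommGroup F] [CompleteSpace F]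
    {ι : Type*} {l : Filter ι} [l.NeBot]
    {f : ι → F} (h : ∀ ε > 0, ∃ (g : ι → F) (a : F), Tendsto g l (𝓝 a) ∧
      ∀ᶠ i in l, ‖f i - g i‖ ≤ ε) : ∃ a, Tendsto f l (𝓝 a) := by
  rw [← cauchy_map_iff_exists_tendsto, Metric.cauchy_iff]
  refine ⟨inferInstance, fun ε hε => ?_⟩
  obtain ⟨g, a, hg, hfg⟩ := h (ε / 5) (by positivity)
  have h1 : ∀ᶠ i in l, ‖f i - a‖ < 2 * ε / 5 := by
    filter_upwards [hfg, (tendsto_iff_norm_sub_tendsto_zero.1 hg).eventually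
      (gt_mem_nhds (show 0 < ε / 5 by positivity))] with i hi hi'
    calc ‖f i - a‖ = ‖(f i - g i) + (g i - a)‖ := by congr 1; abel
      _ ≤ ‖f i - g i‖ + ‖g i - a‖ := norm_add_le _ _
      _ < 2 * ε / 5 := by linarith
  refine ⟨f '' {i | ‖f i - a‖ < 2 * ε / 5}, image_mem_map h1, ?_⟩
  rintro _ ⟨i, hi, rfl⟩ _ ⟨j, hj, rfl⟩
  rw [dist_eq_norm]
  simp only [mem_ofPred_eq] at hi hj
  calc ‖f i - f j‖ = ‖(f i - a) - (f j - a)‖ := by congr 1; abel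
    _ ≤ ‖f i - a‖ + ‖f j - a‖ := norm_sub_le _ _
    _ < ε := by linarith

theorem hasFDerivAt_of_quadratic_bound {g : E → F} {A : E →L[ℝ] F} {x : E}
    (h : ∀ᶠ y in 𝓝 x, ‖g y - g x - A (y - x)‖ ≤ M * ‖y - x‖ ^ 2) : HasFDerivAt g A x := by
  rw [hasFDerivAt_iff_isLittleO]
  have h1 : (fun y => g y - g x - A (y - x)) =O[𝓝 x] fun y => ‖y - x‖ ^ 2 := by
    refine Asymptotics.IsBigO.of_bound M ?_
    filter_upwards [h] with y hy
    simpa using hy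
  refine h1.trans_isLittleO ?_
  have h2 : (fun y => ‖y - x‖ ^ 2) =o[𝓝 x] fun y => ‖y - x‖ ^ 1 := by
    have : Tendsto (fun y => ‖y - x‖) (𝓝 x) (𝓝 0) := by
      have : Continuous fun y => ‖y - x‖ := by fun_prop
      simpa using this.tendsto x
    exact (Asymptotics.isLittleO_pow_pow (by norm_num : 1 < 2)).comp_tendsto this
  simpa using h2

/-- The derivatives of a pointwise convergent family with bounded second derivatives converge to
the derivative of the limit. -/
theorem DerivBound.tendsto_fderiv [FiniteDimensional ℝ E] [CompleteSpace F] (hU : IsOpen U)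
    {ι : Type*} {l : Filter ι} [l.NeBot] {f : ι → E → F} {g : E → F}
    (hf : ∀ᶠ i in l, DerivBound U 1 M (f i))
    (hlim : ∀ x ∈ U, Tendsto (fun i => f i x) l (𝓝 (g x))) :
    DifferentiableOn ℝ g U ∧
      ∀ x ∈ U, Tendsto (fun i => fderiv ℝ (f i) x) l (𝓝 (fderiv ℝ g x)) := by
  suffices H : ∀ x ∈ U, ∃ A : E →L[ℝ] F, HasFDerivAt g A x ∧
      Tendsto (fun i => fderiv ℝ (f i) x) l (𝓝 A) by
    refine ⟨fun x hx => ?_, fun x hx => ?_⟩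
    · obtain ⟨A, hA, -⟩ := H x hx
      exact hA.differentiableAt.differentiableWithinAt
    · obtain ⟨A, hA, hA'⟩ := H x hx
      rwa [hA.fderiv]
  intro x hx
  obtain ⟨r, hr, hrU⟩ := Metric.isOpen_iff.1 hU x hx
  have hM : 0 ≤ M := by
    obtain ⟨i, hi⟩ := hf.exists
    exact (norm_nonneg _).trans (hi.2.norm_le hx)
  have hquad : ∀ᶠ i in l, ∀ y ∈ ball x r,
      ‖f i y - f i x - fderiv ℝ (f i) x (y - x)‖ ≤ M * ‖y - x‖ ^ 2 := by
    filter_upwards [hf] with i hi y hy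
    exact hi.norm_sub_sub_le hU (convex_ball x r) hrU (mem_ball_self hr) hy
  have hpt : ∀ e : E, ∃ a, Tendsto (fun i => fderiv ℝ (f i) x e) l (𝓝 a) := by
    intro e
    apply exists_tendsto_of_uniformly_close
    intro ε hε
    -- The scale `δ` keeps `x + δe` inside the ball, and the difference quotient at this scale
    -- misses the derivative by at most `δM‖e‖² ≤ ε`, uniformly in `i`.
    obtain ⟨δ, hδ, hδ1, hδ2⟩ : ∃ δ > 0, δ * ‖e‖ < r ∧ δ * (M * ‖e‖ ^ 2) ≤ ε := by
      refine ⟨min (r / (‖e‖ + 1)) (ε / (M * ‖e‖ ^ 2 + 1)), by positivity, ?_, ?_⟩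
      · calc _ ≤ r / (‖e‖ + 1) * ‖e‖ := by gcongr; exact min_le_left _ _
          _ < r := by
            rw [div_mul_eq_mul_div, div_lt_iff₀ (by positivity)]
            nlinarith
      · calc _ ≤ ε / (M * ‖e‖ ^ 2 + 1) * (M * ‖e‖ ^ 2) := by gcongr; exact min_le_right _ _
          _ ≤ ε := by
            rw [div_mul_eq_mul_div, div_le_iff₀ (by positivity)]
            nlinarith
    have hy : x + δ • e ∈ ball x r := by
      simp [norm_smul, abs_of_pos hδ, hδ1]
    refine ⟨fun i => δ⁻¹ • (f i (x + δ • e) - f i x), δ⁻¹ • (g (x + δ • e) - g x),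
      ((hlim _ (hrU hy)).sub (hlim _ hx)).const_smul _, ?_⟩
    filter_upwards [hquad] with i hi
    have := hi _ hy
    simp only [add_sub_cancel_left, map_smul, norm_smul, Real.norm_of_nonneg hδ.le] at this
    have e1 : fderiv ℝ (f i) x e - δ⁻¹ • (f i (x + δ • e) - f i x)
        = -(δ⁻¹ • (f i (x + δ • e) - f i x - δ • fderiv ℝ (f i) x e)) := by
      rw [smul_sub δ⁻¹ (f i (x + δ • e) - f i x), smul_smul, inv_mul_cancel₀ hδ.ne', one_smul]
      abel
    rw [e1, norm_neg, norm_smul, Real.norm_of_nonneg (by positivity)]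
    calc _ ≤ δ⁻¹ * (M * (δ * ‖e‖) ^ 2) := by gcongr
      _ = δ * (M * ‖e‖ ^ 2) := by field_simp
      _ ≤ ε := hδ2
  choose a ha using hpt
  -- Convergence in each direction yields convergence in operator norm because the dimension is
  -- finite: only the values on a basis matter.
  set A : E →L[ℝ] F := ∑ i, (LinearMap.toContinuousLinearMap
    ((Module.finBasis ℝ E).coord i)).smulRight (a (Module.finBasis ℝ E i)) with hAdef
  have hA : Tendsto (fun i => fderiv ℝ (f i) x) l (𝓝 A) := by
    have h0 : (fun i => fderiv ℝ (f i) x) = fun i => ∑ j, (LinearMap.toContinuousLinearMap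
        ((Module.finBasis ℝ E).coord j)).smulRight (fderiv ℝ (f i) x (Module.finBasis ℝ E j)) :=
      funext fun i => ContinuousLinearMap.eq_sum_smulRight_finBasis _
    rw [h0, hAdef]
    refine tendsto_finsetSum _ fun j _ => ?_
    exact ((ContinuousLinearMap.smulRightL ℝ E F _).continuous.tendsto _).comp (ha _)
  refine ⟨A, hasFDerivAt_of_quadratic_bound (M := M) ?_, hA⟩
  filter_upwards [ball_mem_nhds x hr] with y hy
  refine le_of_tendsto (f := fun i => ‖f i y - f i x - fderiv ℝ (f i) x (y - x)‖) (x := l)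
    ((((hlim y (hrU hy)).sub (hlim x hx)).sub ?_).norm) ?_
  · exact ((ContinuousLinearMap.apply ℝ F (y - x)).continuous.tendsto A).comp hA
  · filter_upwards [hquad] with i hi using hi y hy

/-- Pointwise limits of families bounded in `C^{k+1}` are bounded in `C^k`. -/
theorem CkBound.of_tendsto [FiniteDimensional ℝ E] [CompleteSpace F] (hU : IsOpen U)
    {ι : Type*} {l : Filter ι} [l.NeBot] {f : ι → E → F} {g : E → F}
    (hf : ∀ᶠ i in l, CkBound U (k + 1) M (f i))
    (hlim : ∀ x ∈ U, Tendsto (fun i => f i x) l (𝓝 (g x))) : CkBound U k M g := by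
  have hbd : ∀ x ∈ U, ‖g x‖ ≤ M := fun x hx =>
    le_of_tendsto (hlim x hx).norm (hf.mono fun i hi => hi.norm_le hx)
  induction k generalizing F with
  | zero =>
    refine CkBound.zero_iff.2 ⟨fun x hx => ?_, hbd⟩
    obtain ⟨r, hr, hrU⟩ := Metric.isOpen_iff.1 hU x hx
    have hM : 0 ≤ M := (norm_nonneg _).trans (hbd x hx)
    have hlip : ∀ y ∈ ball x r, ‖g y - g x‖ ≤ M * ‖y - x‖ := by
      intro y hy
      refine le_of_tendsto ((hlim y (hrU hy)).sub (hlim x hx)).norm ?_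
      filter_upwards [hf] with i hi
      have := (CkBound.succ_iff hU).1 hi
      exact (convex_ball x r).norm_image_sub_le_of_norm_fderiv_le (𝕜 := ℝ)
        (fun w hw => (this.1 w (hrU hw)).differentiableAt (hU.mem_nhds (hrU hw)))
        (fun w hw => this.2.2.norm_le (hrU hw)) (mem_ball_self hr) hy
    refine ContinuousAt.continuousWithinAt ?_
    rw [ContinuousAt, tendsto_iff_norm_sub_tendsto_zero]
    refine squeeze_zero' (Eventually.of_forall fun _ => norm_nonneg _)
      (g := fun y => M * ‖y - x‖) ?_ ?_
    · filter_upwards [ball_mem_nhds x hr] with y hy using hlip y hy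
    · have : Continuous fun y => M * ‖y - x‖ := by fun_prop
      simpa using this.tendsto x
  | succ k ih =>
    have hf' : ∀ᶠ i in l, CkBound U (k + 1) M (fderiv ℝ (f i)) := by
      filter_upwards [hf] with i hi using ((CkBound.succ_iff hU).1 hi).2.2
    have h1 : ∀ᶠ i in l, DerivBound U 1 M (f i) := by
      filter_upwards [hf] with i hi
      exact (hi.derivBound hU).mono (by omega) le_rfl
    obtain ⟨hd, hd'⟩ := DerivBound.tendsto_fderiv hU h1 hlim
    exact (CkBound.succ_iff hU).2 ⟨hd, hbd, ih hf' hd' fun x hx =>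
      le_of_tendsto (hd' x hx).norm (hf'.mono fun i hi => hi.norm_le hx)⟩

theorem DerivBound.of_tendsto [FiniteDimensional ℝ E] [CompleteSpace F] (hU : IsOpen U)
    {ι : Type*} {l : Filter ι} [l.NeBot] {f : ι → E → F} {g : E → F}
    (hf : ∀ᶠ i in l, DerivBound U (k + 1) M (f i))
    (hlim : ∀ x ∈ U, Tendsto (fun i => f i x) l (𝓝 (g x))) : DerivBound U k M g := by
  obtain ⟨hd, hd'⟩ := DerivBound.tendsto_fderiv hU
    (hf.mono fun i hi => hi.mono (by omega) le_rfl) hlim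
  exact ⟨hd, CkBound.of_tendsto hU (hf.mono fun i hi => hi.2) hd'⟩

/-! ### Parametric integrals -/

/-- Differentiation under the integral by domination. Measurability in `θ` is assumed for the values
only; the derivative inherits it as a limit of difference quotients, so the lemma can be iterated.
-/
theorem hasFDerivAt_integral_of_ckBound [FiniteDimensional ℝ E] [CompleteSpace F]
    (hU : IsOpen U) {Θ : Type*} [MeasurableSpace Θ] {ν : Measure Θ} [IsFiniteMeasure ν]
    {f : Θ → E → F} (hf : ∀ θ, CkBound U 1 M (f θ))
    (hm : ∀ x ∈ U, AEStronglyMeasurable (fun θ => f θ x) ν) {x : E} (hx : x ∈ U) :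
    AEStronglyMeasurable (fun θ => fderiv ℝ (f θ) x) ν ∧
    HasFDerivAt (fun x => ∫ θ, f θ x ∂ν) (∫ θ, fderiv ℝ (f θ) x ∂ν) x := by
  have hd : ∀ θ, ∀ y ∈ U, HasFDerivAt (f θ) (fderiv ℝ (f θ) y) y := fun θ y hy =>
    ((((CkBound.succ_iff hU).1 (hf θ)).1 y hy).differentiableAt (hU.mem_nhds hy)).hasFDerivAt
  have hb : ∀ θ, ∀ y ∈ U, ‖fderiv ℝ (f θ) y‖ ≤ M := fun θ y hy =>
    ((CkBound.succ_iff hU).1 (hf θ)).2.2.norm_le hy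
  have hmeas : AEStronglyMeasurable (fun θ => fderiv ℝ (f θ) x) ν := by
    have h0 : (fun θ => fderiv ℝ (f θ) x) = fun θ => ∑ j, (LinearMap.toContinuousLinearMap
        ((Module.finBasis ℝ E).coord j)).smulRight (fderiv ℝ (f θ) x (Module.finBasis ℝ E j)) :=
      funext fun i => ContinuousLinearMap.eq_sum_smulRight_finBasis _
    rw [h0]
    refine Finset.aestronglyMeasurable_fun_sum _ fun j _ => ?_
    refine (ContinuousLinearMap.smulRightL ℝ E F _).continuous.comp_aestronglyMeasurable ?_
    set e := Module.finBasis ℝ E j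
    have hev : ∀ᶠ t : ℝ in 𝓝[≠] 0, x + t • e ∈ U := by
      have : ContinuousAt (fun t : ℝ => x + t • e) 0 := by fun_prop
      exact nhdsWithin_le_nhds (this.eventually (hU.mem_nhds (by simpa using hx)))
    obtain ⟨s, hs⟩ := exists_seq_tendsto (𝓝[≠] (0 : ℝ))
    obtain ⟨N, hN⟩ := eventually_atTop.1 (hs.eventually hev)
    have hs' : Tendsto (fun n => s (n + N)) atTop (𝓝[≠] 0) := (tendsto_add_atTop_iff_nat N).2 hs
    refine aestronglyMeasurable_of_tendsto_ae (u := atTop)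
      (f := fun n θ => (s (n + N))⁻¹ • (f θ (x + s (n + N) • e) - f θ x)) ?_ ?_
    · intro n
      exact ((hm _ (hN _ (by omega))).sub (hm x hx)).const_smul _
    · refine ae_of_all _ fun θ => ?_
      have h3 : HasLineDerivAt ℝ (f θ) (fderiv ℝ (f θ) x e) x e := (hd θ x hx).hasLineDerivAt e
      exact h3.tendsto_slope_zero.comp hs'
  refine ⟨hmeas, ?_⟩
  refine hasFDerivAt_integral_of_dominated_of_fderiv_le (s := U) (hU.mem_nhds hx)
    (bound := fun _ => M)
    (F' := fun x θ => fderiv ℝ (f θ) x) ?_ ?_ hmeas ?_ ?_ ?_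
  · filter_upwards [hU.mem_nhds hx] with y hy using hm y hy
  · exact Integrable.of_bound (hm x hx) M (ae_of_all _ fun θ => (hf θ).norm_le hx)
  · exact ae_of_all _ fun θ y hy => hb θ y hy
  · exact integrable_const M
  · exact ae_of_all _ fun θ y hy => hd θ y hy

theorem CkBound.integral [FiniteDimensional ℝ E] [CompleteSpace F]
    (hU : IsOpen U) {Θ : Type*} [MeasurableSpace Θ] {ν : Measure Θ} [IsFiniteMeasure ν]
    {f : Θ → E → F} (hf : ∀ θ, CkBound U k M (f θ))
    (hm : ∀ x ∈ U, AEStronglyMeasurable (fun θ => f θ x) ν) :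
    CkBound U k (M * ν.real univ) (fun x => ∫ θ, f θ x ∂ν) := by
  have hbd : ∀ x ∈ U, ‖∫ θ, f θ x ∂ν‖ ≤ M * ν.real univ := fun x hx =>
    norm_integral_le_of_norm_le_const (ae_of_all _ fun θ => (hf θ).norm_le hx)
  induction k generalizing F with
  | zero =>
    refine CkBound.zero_iff.2 ⟨?_, hbd⟩
    exact continuousOn_of_dominated (bound := fun _ => M) hm
      (fun x hx => ae_of_all _ fun θ => (hf θ).norm_le hx) (integrable_const M)
      (ae_of_all _ fun θ => (hf θ).continuousOn)
  | succ k ih =>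
    have h1 : ∀ x ∈ U, _ := fun x hx => hasFDerivAt_integral_of_ckBound hU
      (fun θ => (hf θ).mono (by omega) le_rfl) hm hx
    have hf' : ∀ θ, CkBound U k M (fderiv ℝ (f θ)) := fun θ =>
      ((CkBound.succ_iff hU).1 (hf θ)).2.2
    refine (CkBound.succ_iff hU).2 ⟨fun x hx =>
      (h1 x hx).2.differentiableAt.differentiableWithinAt, hbd, ?_⟩
    refine (ih hf' (fun x hx => (h1 x hx).1) fun x hx => ?_).congr hU
      fun x hx => (h1 x hx).2.fderiv
    exact norm_integral_le_of_norm_le_const (ae_of_all _ fun θ => (hf' θ).norm_le hx)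

/-- The bound `N` on the values serves integrability alone and does not enter the conclusion, so the
decay of the derivatives survives integration. -/
theorem DerivBound.integral [FiniteDimensional ℝ E] [CompleteSpace F]
    (hU : IsOpen U) {Θ : Type*} [MeasurableSpace Θ] {ν : Measure Θ} [IsFiniteMeasure ν]
    {N : ℝ} {f : Θ → E → F} (hf : ∀ θ, DerivBound U k M (f θ)) (hN : ∀ θ, ∀ x ∈ U, ‖f θ x‖ ≤ N)
    (hm : ∀ x ∈ U, AEStronglyMeasurable (fun θ => f θ x) ν) :
    DerivBound U k (M * ν.real univ) (fun x => ∫ θ, f θ x ∂ν) := by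
  have h0 : ∀ θ, CkBound U 1 (max M N) (f θ) := fun θ =>
    ((hf θ).mono (Nat.zero_le k) (le_max_left M N)).ckBound hU
      fun x hx => (hN θ x hx).trans (le_max_right _ _)
  have h1 : ∀ x ∈ U, _ := fun x hx => hasFDerivAt_integral_of_ckBound hU h0 hm hx
  exact ⟨fun x hx => (h1 x hx).2.differentiableAt.differentiableWithinAt,
    (CkBound.integral hU (fun θ => (hf θ).2) fun x hx => (h1 x hx).1).congr hU
      fun x hx => (h1 x hx).2.fderiv⟩

end CkBound

/-! ### Composition with a near-identity contraction -/

section Composition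

variable {E F G : Type} [NormedAddCommGroup E] [NormedSpace ℝ E] [NormedAddCommGroup F]
  [NormedSpace ℝ F] {U : Set E} {k : ℕ} {M : ℝ}

/-- Composition with a map `g` that is a near-identity contraction: in the weighted norm with
weights `lam ^ j`, the derivatives of `v ∘ g` contract by the factor `q + h K' / lam`, where `q`
bounds the derivative of `g` and `h K` its higher derivatives. -/
theorem exists_norm_iteratedFDeriv_comp_le {K : ℝ} (hK : 0 ≤ K) (k : ℕ) :
    ∃ K' : ℝ, 0 ≤ K' ∧ ∀ (F : Type) [NormedAddCommGroup F] [NormedSpace ℝ F] {U : Set E}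
      {g : E → E} {q h lam B : ℝ} {v : E → F}, IsOpen U → MapsTo g U U → ContDiffOn ℝ k g U →
      0 ≤ q → q ≤ 1 → 0 ≤ h → h ≤ 1 → 1 ≤ lam → (∀ x ∈ U, ‖fderiv ℝ g x‖ ≤ q) →
      (∀ j, 1 ≤ j → j < k → ∀ x ∈ U, ‖iteratedFDeriv ℝ j (fderiv ℝ g) x‖ ≤ h * K) →
      ContDiffOn ℝ k v U →
      (∀ j, 1 ≤ j → j ≤ k → ∀ x ∈ U, ‖iteratedFDeriv ℝ j v x‖ ≤ B * lam ^ j) →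
      ∀ j, 1 ≤ j → j ≤ k → ∀ x ∈ U,
        ‖iteratedFDeriv ℝ j (v ∘ g) x‖ ≤ B * lam ^ j * (q + h * K' / lam) := by
  induction k with
  | zero => exact ⟨0, le_rfl, by intros; omega⟩
  | succ k ih =>
    obtain ⟨K', hK', ih⟩ := ih
    -- Induction through `D(v ∘ g) = (Dv ∘ g) Dg`: the old constant, plus at most `2^k` Leibniz
    -- terms of size `(1 + K')K`. As the induction hypothesis is applied to `Dv`, it has to hold for
    -- every target space.
    refine ⟨K' + 2 ^ k * (1 + K') * K, by positivity, ?_⟩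
    intro F _ _ U g q h lam B v hU hgU hg hq hq1 hh hh1 hlam hDg hDDg hv hbd j hj1 hjk x hx
    have hlam0 : 0 < lam := by linarith
    have hB : 0 ≤ B := by
      have := (norm_nonneg _).trans (hbd j hj1 hjk x hx)
      by_contra hB
      nlinarith [pow_pos hlam0 j]
    have hg' : ContDiffOn ℝ k g U := hg.of_le (by exact_mod_cast Nat.le_succ k)
    have hv' : ContDiffOn ℝ k v U := hv.of_le (by exact_mod_cast Nat.le_succ k)
    rcases Nat.lt_or_ge j (k + 1) with hjk' | hjk'
    · refine (ih F hU hgU hg' hq hq1 hh hh1 hlam hDg (fun i hi hi' => hDDg i hi (by omega)) hv'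
        (fun i hi hi' => hbd i hi (by omega)) j hj1 (by omega) x hx).trans ?_
      gcongr
      have : 0 ≤ 2 ^ k * (1 + K') * K := by positivity
      linarith
    obtain rfl : j = k + 1 := by omega
    have hsplit : ∀ {E' : Type} [NormedAddCommGroup E'] [NormedSpace ℝ E'] {w : E → E'},
        ContDiffOn ℝ (k + 1 : ℕ) w U → DifferentiableOn ℝ w U ∧ ContDiffOn ℝ k (fderiv ℝ w) U := by
      intro E' _ _ w hw
      have := contDiffOn_succ_iff_fderiv_of_isOpen (𝕜 := ℝ) (f := w) (n := (k : WithTop ℕ∞)) hU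
      push_cast at hw
      have h2 := this.1 hw
      exact ⟨h2.1, h2.2.2⟩
    obtain ⟨hgd, hDgC⟩ := hsplit hg
    obtain ⟨hvd, hDvC⟩ := hsplit hv
    have hDv : EqOn (fderiv ℝ (v ∘ g)) (fun y => ContinuousLinearMap.compL ℝ E E F
        ((fderiv ℝ v ∘ g) y) (fderiv ℝ g y)) U := by
      intro y hy
      exact fderiv_comp y ((hvd _ (hgU hy)).differentiableAt (hU.mem_nhds (hgU hy)))
        ((hgd y hy).differentiableAt (hU.mem_nhds hy))
    rw [← norm_iteratedFDeriv_fderiv, iteratedFDeriv_congr_of_isOpen hU hDv k hx]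
    have hbil := (ContinuousLinearMap.compL ℝ E E F).norm_iteratedFDerivWithin_le_of_bilinear_of_le_one
      (n := k) (N := k) (hDvC.comp hg' hgU) hDgC hU.uniqueDiffOn hx le_rfl
      (ContinuousLinearMap.norm_compL_le ℝ E E F)
    rw [iteratedFDerivWithin_of_isOpen _ hU hx] at hbil
    refine hbil.trans ?_
    simp_rw [iteratedFDerivWithin_of_isOpen _ hU hx]
    have hbd' : ∀ i, 1 ≤ i → i ≤ k → ∀ x ∈ U,
        ‖iteratedFDeriv ℝ i (fderiv ℝ v) x‖ ≤ (B * lam) * lam ^ i := by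
      intro i hi hi' y hy
      rw [norm_iteratedFDeriv_fderiv]
      refine (hbd (i + 1) (by omega) (by omega) y hy).trans_eq (by ring)
    have h1 : ∀ i, 1 ≤ i → i ≤ k →
        ‖iteratedFDeriv ℝ i (fderiv ℝ v ∘ g) x‖ ≤ B * lam * lam ^ i * (q + h * K' / lam) :=
      fun i hi hi' => ih _ hU hgU hg' hq hq1 hh hh1 hlam hDg
        (fun i hi hi' => hDDg i hi (by omega)) hDvC hbd' i hi hi' x hx
    have h0 : ‖fderiv ℝ v (g x)‖ ≤ B * lam := by
      have := hbd 1 le_rfl (by omega) (g x) (hgU hx)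
      rwa [← zero_add 1, ← norm_iteratedFDeriv_fderiv, norm_iteratedFDeriv_zero, zero_add,
        pow_one] at this
    rw [Finset.sum_range_succ]
    -- The only term in which `Dg` is not differentiated. The contraction comes from the induction
    -- hypothesis for `Dv ∘ g`, and `‖Dg‖ ≤ 1` suffices for the other factor; for `k = 0` it comes
    -- from `Dg` itself.
    have hlast : (k.choose k : ℝ) * ‖iteratedFDeriv ℝ k (fderiv ℝ v ∘ g) x‖ *
        ‖iteratedFDeriv ℝ (k - k) (fderiv ℝ g) x‖ ≤ B * lam ^ (k + 1) * (q + h * K' / lam) := by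
      rw [Nat.choose_self, Nat.cast_one, one_mul, Nat.sub_self, norm_iteratedFDeriv_zero]
      rcases Nat.eq_zero_or_pos k with hk | hk
      · subst hk
        rw [norm_iteratedFDeriv_zero]
        calc _ ≤ (B * lam) * q := by gcongr; exacts [h0, hDg x hx]
          _ ≤ _ := by
            rw [zero_add, pow_one]
            gcongr
            have : 0 ≤ h * K' / lam := by positivity
            linarith
      · calc _ ≤ (B * lam * lam ^ k * (q + h * K' / lam)) * 1 := by
              gcongr
              exacts [h1 k hk le_rfl, (hDg x hx).trans hq1]
          _ = _ := by ring
    -- In all other terms a derivative falls on `Dg`. This produces the factor `h K` and one power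
    -- of `lam` fewer, whence the correction `h K' / lam`.
    have hrest : ∑ i ∈ Finset.range k, (k.choose i : ℝ) *
        ‖iteratedFDeriv ℝ i (fderiv ℝ v ∘ g) x‖ * ‖iteratedFDeriv ℝ (k - i) (fderiv ℝ g) x‖ ≤
        2 ^ k * (B * lam ^ k * (1 + K') * (h * K)) := by
      calc _ ≤ ∑ i ∈ Finset.range k, (k.choose i : ℝ) * (B * lam ^ k * (1 + K') * (h * K)) := by
            refine Finset.sum_le_sum fun i hi => ?_
            have hik : i < k := Finset.mem_range.1 hi
            rw [mul_assoc]
            have e1 : ‖iteratedFDeriv ℝ i (fderiv ℝ v ∘ g) x‖ ≤ B * lam ^ k * (1 + K') := by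
              have e2 : lam ^ (i + 1) ≤ lam ^ k := pow_le_pow_right₀ hlam (by omega)
              rcases Nat.eq_zero_or_pos i with hi0 | hi0
              · subst hi0
                rw [norm_iteratedFDeriv_zero]
                calc _ ≤ B * lam := h0
                  _ ≤ B * lam ^ k * 1 := by
                    rw [mul_one]; gcongr; simpa using e2
                  _ ≤ _ := by gcongr; linarith
              · calc _ ≤ B * lam * lam ^ i * (q + h * K' / lam) := h1 i hi0 hik.le
                  _ = B * lam ^ (i + 1) * (q + h * K' / lam) := by ring
                  _ ≤ B * lam ^ k * (1 + K') := by
                    gcongr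
                    rw [div_le_iff₀ hlam0]
                    calc h * K' ≤ 1 * K' := by gcongr
                      _ = K' * 1 := by ring
                      _ ≤ K' * lam := by gcongr
            have e3 := hDDg (k - i) (by omega) (by omega) x hx
            gcongr
        _ ≤ _ := by
            rw [← Finset.sum_mul]
            gcongr
            have := Nat.sum_range_choose k
            rw [Finset.sum_range_succ] at this
            exact_mod_cast (show _ ≤ 2 ^ k by omega)
    calc _ ≤ 2 ^ k * (B * lam ^ k * (1 + K') * (h * K)) + B * lam ^ (k + 1) * (q + h * K' / lam) :=
          add_le_add hrest hlast
      _ = _ := by field_simp; ring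

end Composition

/-! ### Joint regularity in space and time -/

section Joint

variable {E F : Type} [NormedAddCommGroup E] [NormedSpace ℝ E] [NormedAddCommGroup F]
  [NormedSpace ℝ F] {U : Set E} {M : ℝ}

theorem DerivBound.norm_sub_le {k : ℕ} (hU : IsOpen U) (hc : Convex ℝ U) {g : E → F}
    (hg : DerivBound U k M g) {x y : E} (hx : x ∈ U) (hy : y ∈ U) : ‖g y - g x‖ ≤ M * ‖y - x‖ :=
  hc.norm_image_sub_le_of_norm_fderiv_le (𝕜 := ℝ)
    (fun w hw => (hg.1 w hw).differentiableAt (hU.mem_nhds hw))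
    (fun _ hw => hg.2.norm_le hw) hx hy

theorem DerivBound.lipschitzOnWith {k : ℕ} (hU : IsOpen U) (hc : Convex ℝ U) {g : E → F}
    (hg : DerivBound U k M g) : LipschitzOnWith M.toNNReal g U :=
  LipschitzOnWith.of_dist_le_mul fun x hx y hy => by
    rw [dist_eq_norm, dist_eq_norm]
    refine (hg.norm_sub_le hU hc hy hx).trans ?_
    gcongr
    exact Real.le_coe_toNNReal M

theorem continuousOn_uncurry_of_derivBound {k : ℕ} (hU : IsOpen U) (hc : Convex ℝ U) {S : Set ℝ}
    {v : E → ℝ → F} (hv : ∀ t ∈ S, DerivBound U k M (fun x => v x t))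
    (ht : ∀ x ∈ U, ContinuousOn (v x) S) :
    ContinuousOn (fun p : E × ℝ => v p.1 p.2) (U ×ˢ S) :=
  continuousOn_prod_of_continuousOn_lipschitzOnWith _ M.toNNReal ht
    fun t h => (hv t h).lipschitzOnWith hU hc

/-- As `s → t` the functions `v(·, s)` converge pointwise with bounded second derivatives, so their
derivatives converge as well. -/
theorem continuousOn_fderiv_of_derivBound [FiniteDimensional ℝ E] [CompleteSpace F]
    (hU : IsOpen U) {S : Set ℝ} {v : E → ℝ → F} (hv : ∀ t ∈ S, DerivBound U 1 M (fun x => v x t))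
    (ht : ∀ x ∈ U, ContinuousOn (v x) S) :
    ∀ x ∈ U, ContinuousOn (fun t => fderiv ℝ (fun y => v y t) x) S := by
  intro x hx t hts
  have : (𝓝[S] t).NeBot := mem_closure_iff_nhdsWithin_neBot.1 (subset_closure hts)
  exact (DerivBound.tendsto_fderiv (f := fun s y => v y s) (g := fun y => v y t) hU
    (eventually_mem_nhdsWithin.mono fun s hs => hv s hs) fun y hy => ht y hy t hts).2 x hx

/-- The increment is split into a spatial part at the later time, handled by the mean value
inequality and joint continuity of `A`, and a temporal part at the fixed point `x`. Time is allowed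
to range over a set with boundary, such as `[0, ∞)`. -/
theorem contDiffOn_one_of_partial (hU : IsOpen U) {S : Set ℝ} (hS : UniqueDiffOn ℝ S)
    {v : E → ℝ → F} {A : E × ℝ → E →L[ℝ] F} {b : E × ℝ → F}
    (hx : ∀ p ∈ U ×ˢ S, HasFDerivAt (fun y => v y p.2) (A p) p.1)
    (ht : ∀ p ∈ U ×ˢ S, HasDerivWithinAt (fun s => v p.1 s) (b p) S p.2)
    (hA : ContinuousOn A (U ×ˢ S)) (hb : ContinuousOn b (U ×ˢ S)) :
    ContDiffOn ℝ 1 (fun p : E × ℝ => v p.1 p.2) (U ×ˢ S) := by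
  have huniq : UniqueDiffOn ℝ (U ×ˢ S) := hU.uniqueDiffOn.prod hS
  set L : E × ℝ → (E × ℝ) →L[ℝ] F := fun p =>
    (A p).coprod (ContinuousLinearMap.toSpanSingleton ℝ (b p)) with hL
  have hLc : ContinuousOn L (U ×ˢ S) := by
    have h1 : L = fun p => (A p).comp (ContinuousLinearMap.fst ℝ E ℝ) +
        (ContinuousLinearMap.toSpanSingletonCLE (𝕜 := ℝ) (b p)).comp
          (ContinuousLinearMap.snd ℝ E ℝ) := by
      funext p
      ext <;> simp [hL]
    rw [h1]
    refine ContinuousOn.add (hA.clm_comp continuousOn_const) (ContinuousOn.clm_comp ?_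
      continuousOn_const)
    exact (ContinuousLinearMap.toSpanSingletonCLE (𝕜 := ℝ) (E := F)).continuous.comp_continuousOn hb
  have hder : ∀ p ∈ U ×ˢ S, HasFDerivWithinAt (fun p : E × ℝ => v p.1 p.2) (L p) (U ×ˢ S) p := by
    rintro ⟨x, t⟩ hp
    have hxU : x ∈ U := hp.1
    have e2 : (fun q : E × ℝ => v x q.2 - v x t - (q.2 - t) • b (x, t))
        =o[𝓝[U ×ˢ S] (x, t)] fun q => q - (x, t) := by
      have h1 := (hasDerivWithinAt_iff_isLittleO.1 (ht _ hp))
      have h2 : Tendsto (fun q : E × ℝ => q.2) (𝓝[U ×ˢ S] (x, t)) (𝓝[S] t) :=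
        tendsto_nhdsWithin_iff.2 ⟨(continuous_snd.tendsto (x, t)).mono_left nhdsWithin_le_nhds,
          eventually_mem_nhdsWithin.mono fun q hq => hq.2⟩
      refine (h1.comp_tendsto h2).trans_isBigO ?_
      refine Asymptotics.IsBigO.of_bound 1 (Eventually.of_forall fun q => ?_)
      simpa using! norm_snd_le (q - (x, t))
    have e1 : (fun q : E × ℝ => v q.1 q.2 - v x q.2 - A (x, t) (q.1 - x))
        =o[𝓝[U ×ˢ S] (x, t)] fun q => q - (x, t) := by
      rw [Asymptotics.isLittleO_iff]
      intro ε hε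
      obtain ⟨δ, hδ, hδA⟩ := Metric.continuousOn_iff.1 hA _ hp ε hε
      obtain ⟨r, hr, hrU⟩ := Metric.isOpen_iff.1 hU x hxU
      have hmem : ball ((x, t) : E × ℝ) (min δ r) ∈ 𝓝[U ×ˢ S] (x, t) :=
        nhdsWithin_le_nhds (ball_mem_nhds _ (by positivity))
      filter_upwards [hmem, self_mem_nhdsWithin] with q hq hqU
      rw [mem_ball, Prod.dist_eq] at hq
      have hq1 := (le_max_left _ _).trans_lt hq
      have hq2 := (le_max_right _ _).trans_lt hq
      have hsub : ball x (min δ r) ⊆ U := (ball_subset_ball (min_le_right _ _)).trans hrU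
      have := (convex_ball x (min δ r)).norm_image_sub_le_of_norm_hasFDerivWithin_le'
        (𝕜 := ℝ) (f := fun y => v y q.2) (f' := fun y => A (y, q.2)) (φ := A (x, t)) (C := ε)
        (fun y hy => (hx (y, q.2) ⟨hsub hy, hqU.2⟩).hasFDerivWithinAt)
        (fun y hy => ?_) (mem_ball_self (by positivity)) (y := q.1) hq1
      · refine this.trans ?_
        gcongr
        simpa using! norm_fst_le (q - (x, t))
      · rw [← dist_eq_norm]
        refine (hδA (y, q.2) ⟨hsub hy, hqU.2⟩ ?_).le
        rw [Prod.dist_eq]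
        exact max_lt (lt_of_lt_of_le hy (min_le_left _ _)) (hq2.trans_le (min_le_left _ _))
    rw [hasFDerivWithinAt_iff_isLittleO]
    refine (e1.add e2).congr_left fun q => ?_
    simp [hL]
    abel
  have : ContDiffOn ℝ ((0 : WithTop ℕ∞) + 1) (fun p : E × ℝ => v p.1 p.2) (U ×ˢ S) := by
    rw [contDiffOn_succ_iff_fderivWithin huniq]
    refine ⟨fun p hp => (hder p hp).differentiableWithinAt, by simp, ?_⟩
    rw [contDiffOn_zero]
    exact hLc.congr fun p hp => (hder p hp).fderivWithin (huniq p hp)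
  simpa using this

end Joint

/-! ### Taylor estimates and right derivatives in one variable -/

section OneDim

variable {F : Type*} [NormedAddCommGroup F] [NormedSpace ℝ F]

theorem norm_sub_le_of_hasDerivAt {p p' : ℝ → F} {T C : ℝ} (hT : 0 ≤ T)
    (h : ∀ s ∈ Icc 0 T, HasDerivAt p (p' s) s) (hC : ∀ s ∈ Icc 0 T, ‖p' s‖ ≤ C) :
    ‖p T - p 0‖ ≤ C * T := by
  have := norm_image_sub_le_of_norm_deriv_le_segment' (f := p) (f' := p') (a := 0) (b := T) (C := C)
    (fun s hs => (h s hs).hasDerivWithinAt) (fun s hs => hC s (Ico_subset_Icc_self hs)) T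
    (right_mem_Icc.2 hT)
  simpa using this

theorem taylor_one_bound {p p₁ p₂ : ℝ → F} {T C : ℝ} (hT : 0 ≤ T)
    (h : ∀ s ∈ Icc 0 T, HasDerivAt p (p₁ s) s) (h₁ : ∀ s ∈ Icc 0 T, HasDerivAt p₁ (p₂ s) s)
    (hC : ∀ s ∈ Icc 0 T, ‖p₂ s‖ ≤ C) : ‖p T - p 0 - T • p₁ 0‖ ≤ C * T ^ 2 := by
  have hC0 : 0 ≤ C := (norm_nonneg _).trans (hC 0 ⟨le_rfl, hT⟩)
  have key := norm_sub_le_of_hasDerivAt (p := fun s => p s - s • p₁ 0)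
    (p' := fun s => p₁ s - p₁ 0) (C := C * T) hT
    (fun s hs => by simpa using! (h s hs).sub ((hasDerivAt_id s).smul_const (p₁ 0)))
    (fun s hs => by
      have := norm_sub_le_of_hasDerivAt (p := p₁) hs.1 (fun r hr => h₁ r ⟨hr.1, hr.2.trans hs.2⟩)
        (fun r hr => hC r ⟨hr.1, hr.2.trans hs.2⟩)
      exact this.trans (by gcongr; exact hs.2))
  calc _ = ‖p T - T • p₁ 0 - (p 0 - (0 : ℝ) • p₁ 0)‖ := by congr 1; simp; abel
    _ ≤ _ := key
    _ = _ := by ring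

theorem taylor_two_bound {p p₁ p₂ p₃ : ℝ → F} {T C : ℝ} (hT : 0 ≤ T)
    (h : ∀ s ∈ Icc 0 T, HasDerivAt p (p₁ s) s) (h₁ : ∀ s ∈ Icc 0 T, HasDerivAt p₁ (p₂ s) s)
    (h₂ : ∀ s ∈ Icc 0 T, HasDerivAt p₂ (p₃ s) s)
    (hC : ∀ s ∈ Icc 0 T, ‖p₃ s‖ ≤ C) :
    ‖p T - p 0 - T • p₁ 0 - (T ^ 2 / 2) • p₂ 0‖ ≤ C * T ^ 3 := by
  have hC0 : 0 ≤ C := (norm_nonneg _).trans (hC 0 ⟨le_rfl, hT⟩)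
  have key := norm_sub_le_of_hasDerivAt (p := fun s => p s - s • p₁ 0 - (s ^ 2 / 2) • p₂ 0)
    (p' := fun s => p₁ s - p₁ 0 - s • p₂ 0) (C := C * T ^ 2) hT
    (fun s hs => by
      have e1 := (h s hs).sub ((hasDerivAt_id s).smul_const (p₁ 0))
      have e2 : HasDerivAt (fun s : ℝ => s ^ 2 / 2) s s := by
        simpa using (hasDerivAt_pow 2 s).div_const 2
      simpa using! e1.sub (e2.smul_const (p₂ 0)))
    (fun s hs => by
      have := taylor_one_bound (p := p₁) hs.1 (fun r hr => h₁ r ⟨hr.1, hr.2.trans hs.2⟩)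
        (fun r hr => h₂ r ⟨hr.1, hr.2.trans hs.2⟩) (fun r hr => hC r ⟨hr.1, hr.2.trans hs.2⟩)
      refine this.trans ?_
      have := hs.1
      gcongr
      exact hs.2)
  calc _ = ‖p T - T • p₁ 0 - (T ^ 2 / 2) • p₂ 0
          - (p 0 - (0 : ℝ) • p₁ 0 - ((0 : ℝ) ^ 2 / 2) • p₂ 0)‖ := by
        congr 1; simp; abel
    _ ≤ _ := key
    _ = _ := by ring

/-- A continuous function with continuous right derivative is differentiable. -/
theorem hasDerivWithinAt_Ici_of_right [CompleteSpace F] {p r : ℝ → F} (hp : ContinuousOn p (Ici 0))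
    (hr : ContinuousOn r (Ici 0)) (h : ∀ t, 0 ≤ t → HasDerivWithinAt p (r t) (Ioi t) t) :
    (∀ t, 0 ≤ t → HasDerivWithinAt p (r t) (Ici 0) t) ∧
      ∀ a b, 0 ≤ a → a ≤ b → ∫ s in a..b, r s = p b - p a := by
  have hint : ∀ a b, 0 ≤ a → a ≤ b → ∫ s in a..b, r s = p b - p a := by
    intro a b ha hab
    have hsub : uIcc a b ⊆ Ici 0 := by
      rw [uIcc_of_le hab]; exact fun s hs => ha.trans hs.1
    refine intervalIntegral.integral_eq_sub_of_hasDeriv_right (hp.mono hsub) (fun s hs => ?_)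
      (hr.mono hsub).intervalIntegrable
    rw [min_eq_left hab] at hs
    exact h s (ha.trans hs.1.le)
  refine ⟨fun t ht => ?_, hint⟩
  have hrc : Continuous fun t => r (max t 0) :=
    hr.comp_continuous (by fun_prop) fun t => mem_Ici.2 (le_max_right _ _)
  have hd : HasDerivAt (fun t => p 0 + ∫ s in (0 : ℝ)..t, r (max s 0)) (r (max t 0)) t :=
    (intervalIntegral.integral_hasDerivAt_right (hrc.intervalIntegrable _ _)
      (hrc.stronglyMeasurableAtFilter _ _) hrc.continuousAt).const_add _
  rw [max_eq_left ht] at hd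
  have heq : ∀ t ∈ Ici (0 : ℝ), p t = p 0 + ∫ s in (0 : ℝ)..t, r (max s 0) := by
    intro t ht
    have : ∫ s in (0 : ℝ)..t, r (max s 0) = ∫ s in (0 : ℝ)..t, r s := by
      refine intervalIntegral.integral_congr fun s hs => ?_
      rw [uIcc_of_le ht] at hs
      simp [max_eq_left hs.1]
    rw [this, hint 0 t le_rfl ht]
    abel
  exact hd.hasDerivWithinAt.congr heq (heq t ht)

end OneDim

/-! ### Semiflows and global integral curves -/

/-- `Φ` is the semiflow on `U` of the vector field `-V`. -/
structure IsSemiflow {E : Type} [NormedAddCommGroup E] [NormedSpace ℝ E] (U : Set E) (V : E → E)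
    (Φ : E → ℝ → E) : Prop where
  zero : ∀ x ∈ U, Φ x 0 = x
  mem : ∀ x ∈ U, ∀ t, 0 ≤ t → Φ x t ∈ U
  deriv : ∀ x ∈ U, ∀ t, 0 ≤ t → HasDerivAt (Φ x) (-V (Φ x t)) t
  add : ∀ x ∈ U, ∀ s t, 0 ≤ s → 0 ≤ t → Φ x (s + t) = Φ (Φ x s) t

section Existence

/-- Extend, then truncate each coordinate at a level that is not reached on `s`. A bounded, globally
Lipschitz field has global integral curves, whereas `V` is controlled on the ball only. -/
theorem LipschitzOnWith.exists_bounded_extension {α F : Type*} [PseudoMetricSpace α]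
    [NormedAddCommGroup F] [NormedSpace ℝ F] [FiniteDimensional ℝ F] {s : Set α} {f : α → F}
    {K : NNReal} {M : ℝ} (hf : LipschitzOnWith K f s) (hM : ∀ x ∈ s, ‖f x‖ ≤ M) :
    ∃ (g : α → F) (K' : NNReal) (M' : ℝ), LipschitzWith K' g ∧ (∀ x, ‖g x‖ ≤ M') ∧ EqOn f g s := by
  obtain ⟨g, hg, hfg⟩ := hf.extend_finite_dimension
  let e := (Module.finBasis ℝ F).equivFunL
  have hM0 : 0 ≤ max M 0 := le_max_right _ _
  set N : ℝ := ‖(e : F →L[ℝ] (Fin (Module.finrank ℝ F) → ℝ))‖ * max M 0 with hN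
  have hN0 : 0 ≤ N := by positivity
  let c : (Fin (Module.finrank ℝ F) → ℝ) → (Fin (Module.finrank ℝ F) → ℝ) :=
    fun z i => max (-N) (min N (z i))
  have hc : LipschitzWith 1 c := by
    refine LipschitzWith.of_dist_le_mul fun z z' => ?_
    rw [NNReal.coe_one, one_mul]
    refine (dist_pi_le_iff dist_nonneg).2 fun i => ?_
    calc dist (c z i) (c z' i) ≤ dist (z i) (z' i) := by
          have h1 : LipschitzWith 1 fun y : ℝ => max (-N) (min N y) :=
            (LipschitzWith.id.const_min N).const_max (-N)
          simpa using h1.dist_le_mul (z i) (z' i)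
      _ ≤ dist z z' := dist_le_pi_dist z z' i
  have hcN : ∀ z, ‖c z‖ ≤ N := fun z => (pi_norm_le_iff_of_nonneg hN0).2 fun i => by
    rw [Real.norm_eq_abs, abs_le]
    exact ⟨le_max_left _ _, max_le (by linarith) (min_le_left _ _)⟩
  refine ⟨fun x => e.symm (c (e (g x))), _, _,
    (e.symm : (Fin (Module.finrank ℝ F) → ℝ) →L[ℝ] F).lipschitz.comp
      (hc.comp ((e : F →L[ℝ] (Fin (Module.finrank ℝ F) → ℝ)).lipschitz.comp hg)), fun x =>
      ((e.symm : (Fin (Module.finrank ℝ F) → ℝ) →L[ℝ] F).le_opNorm _).trans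
        (mul_le_mul_of_nonneg_left (hcN _) (norm_nonneg _)), fun x hx => ?_⟩
  have h1 : c (e (g x)) = e (g x) := by
    have h2 : ‖e (g x)‖ ≤ N := by
      rw [← hfg hx]
      refine ((e : F →L[ℝ] (Fin (Module.finrank ℝ F) → ℝ)).le_opNorm _).trans ?_
      exact mul_le_mul_of_nonneg_left ((hM x hx).trans (le_max_left _ _)) (norm_nonneg _)
    funext i
    have h3 := abs_le.1 ((norm_le_pi_norm (e (g x)) i).trans h2)
    change max (-N) (min N (e (g x) i)) = _
    rw [min_eq_right h3.2, max_eq_right h3.1]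
  simp [h1, hfg hx]

variable {E : Type*} [NormedAddCommGroup E] [NormedSpace ℝ E] [CompleteSpace E]

/-- Speed at most `M` confines a curve on `[-n, n]` to the ball of radius `Mn`, so Picard–Lindelöf
applies on the whole interval. The curves for different `n` agree by uniqueness and glue. -/
theorem exists_global_integralCurve {W : E → E} {K : NNReal} {M : ℝ} (hW : LipschitzWith K W)
    (hM : ∀ x, ‖W x‖ ≤ M) (x : E) :
    ∃ α : ℝ → E, α 0 = x ∧ ∀ t, HasDerivAt α (W (α t)) t := by
  have hloc : ∀ n : ℕ, ∃ α : ℝ → E, α 0 = x ∧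
      ∀ t ∈ Ioo (-(n : ℝ)) n, HasDerivAt α (W (α t)) t := by
    intro n
    have hM0 : 0 ≤ M := (norm_nonneg _).trans (hM x)
    have h0 : (0 : ℝ) ∈ Icc (-(n : ℝ)) n := ⟨by simp, by simp⟩
    have hpl : IsPicardLindelof (fun _ => W) (⟨0, h0⟩ : Icc (-(n : ℝ)) n) x
        (M.toNNReal * n) 0 M.toNNReal K := by
      refine IsPicardLindelof.of_time_independent (fun y _ => ?_) hW.lipschitzOnWith ?_
      · exact (hM y).trans (Real.le_coe_toNNReal M)
      · simp
    obtain ⟨α, hα0, hα⟩ := hpl.exists_eq_forall_mem_Icc_hasDerivWithinAt₀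
    exact ⟨α, hα0, fun t ht => (hα t (Ioo_subset_Icc_self ht)).hasDerivAt
      (Icc_mem_nhds ht.1 ht.2)⟩
  choose α hα0 hα using hloc
  have huniq : ∀ (m n : ℕ) (t : ℝ), |t| < m → |t| < n → α m t = α n t := by
    have key : ∀ (m n : ℕ) (t : ℝ), m ≤ n → |t| < m → α m t = α n t := by
      intro m n t hmn ht
      have hmn' : (m : ℝ) ≤ n := by exact_mod_cast hmn
      have hm : (0 : ℝ) < m := (abs_nonneg t).trans_lt ht
      refine ODE_solution_unique_of_mem_Ioo (v := fun _ => W) (s := fun _ => univ)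
        (a := -(m : ℝ)) (b := m) (t₀ := 0) (K := K) (fun _ _ => hW.lipschitzOnWith)
        ⟨by linarith, hm⟩ (fun s hs => ⟨hα m s hs, mem_univ _⟩)
        (fun s hs => ⟨hα n s ⟨by linarith [hs.1], by linarith [hs.2]⟩, mem_univ _⟩)
        (by rw [hα0, hα0]) (abs_lt.1 ht)
    intro m n t hm hn
    rcases le_total m n with h | h
    · exact key m n t h hm
    · exact (key n m t h hn).symm
  let N : ℝ → ℕ := fun t => ⌈|t|⌉₊ + 1
  have hN : ∀ t, |t| < N t := fun t => by
    have := Nat.le_ceil |t|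
    push_cast [N]
    linarith
  refine ⟨fun t => α (N t) t, hα0 _, fun t => ?_⟩
  refine (hα (N t) t (abs_lt.1 (hN t))).congr_of_eventuallyEq ?_
  have : ∀ᶠ s : ℝ in 𝓝 t, |s| < N t := continuous_abs.continuousAt.eventually (gt_mem_nhds (hN t))
  filter_upwards [this] with s hs
  exact huniq _ _ s (hN s) hs

end Existence

/-! ### The semiflow of a strongly monotone field and the decay of derivatives -/

section Dissipative

variable {E F : Type} [NormedAddCommGroup E] [InnerProductSpace ℝ E]
  [NormedAddCommGroup F] [NormedSpace ℝ F] {R γ K : ℝ} {V : E → E}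

/-- The vector field `V` on the ball `B(0, R)` vanishes at the origin, is `γ`-strongly monotone and
has derivatives up to order `k` bounded by `K`. -/
structure IsDissipative (R γ K : ℝ) (k : ℕ) (V : E → E) : Prop where
  gamma_pos : 0 < γ
  gamma_le : γ ≤ K
  ckBound : CkBound (ball (0 : E) R) (k + 1) K V
  zero : V 0 = 0
  monotone : ∀ x ∈ ball (0 : E) R, ∀ y ∈ ball (0 : E) R,
    γ * ‖x - y‖ ^ 2 ≤ ⟪V x - V y, x - y⟫_ℝ

namespace IsDissipative

variable {k : ℕ}

theorem K_pos (hV : IsDissipative R γ K k V) : 0 < K := hV.gamma_pos.trans_le hV.gamma_le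

theorem derivBound (hV : IsDissipative R γ K k V) : DerivBound (ball (0 : E) R) k K V :=
  hV.ckBound.derivBound isOpen_ball

theorem inner_self (hV : IsDissipative R γ K k V) {x : E} (hx : x ∈ ball (0 : E) R) :
    γ * ‖x‖ ^ 2 ≤ ⟪V x, x⟫_ℝ := by
  have h0 : (0 : E) ∈ ball (0 : E) R := by
    exact mem_ball_self (pos_of_mem_ball hx)
  simpa [hV.zero] using hV.monotone x hx 0 h0

/-- The semiflow is that of a bounded Lipschitz extension `W` of `V`. Its orbits do not leave the
ball, where `W = V`, because monotonicity makes `‖Φ‖` strictly decrease at any time at which it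
equals `‖x‖`. The origin is stationary and is treated apart, as strictness fails there. -/
theorem exists_semiflow [FiniteDimensional ℝ E] (hV : IsDissipative R γ K k V) :
    ∃ Φ : E → ℝ → E, IsSemiflow (ball (0 : E) R) V Φ := by
  obtain ⟨W, K', M', hW, hWM, hVW⟩ := (hV.derivBound.lipschitzOnWith isOpen_ball
    (convex_ball _ _)).exists_bounded_extension fun x hx => hV.ckBound.norm_le hx
  have hW' : LipschitzWith K' (fun x => -W x) := hW.neg
  choose Φ hΦ0 hΦ using exists_global_integralCurve hW' (M := M') (fun x => by simpa using hWM x)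
  have huniq : ∀ f g : ℝ → E, (∀ t, HasDerivAt f (-W (f t)) t) → (∀ t, HasDerivAt g (-W (g t)) t) →
      f 0 = g 0 → f = g := fun f g hf hg h =>
    ODE_solution_unique_univ (v := fun _ x => -W x) (s := fun _ => univ) (t₀ := 0)
      (fun _ => hW'.lipschitzOnWith) (fun t => ⟨hf t, mem_univ _⟩) (fun t => ⟨hg t, mem_univ _⟩) h
  have hmem : ∀ x ∈ ball (0 : E) R, ∀ t, 0 ≤ t → Φ x t ∈ ball (0 : E) R := by
    intro x hx t ht
    have h0 : (0 : E) ∈ ball (0 : E) R := by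
      exact mem_ball_self (pos_of_mem_ball hx)
    rcases eq_or_ne x 0 with rfl | hx0
    · have h1 : Φ 0 = fun _ => 0 := by
        refine huniq _ _ (hΦ 0) (fun t => ?_) (hΦ0 0)
        rw [← hVW h0, hV.zero, neg_zero]
        exact hasDerivAt_const t 0
      rw [h1]; exact h0
    · have hd : ∀ s, HasDerivAt (fun s => ‖Φ x s‖ ^ 2) (2 * ⟪Φ x s, -W (Φ x s)⟫_ℝ) s :=
        fun s => (hΦ x s).norm_sq
      have := image_le_of_deriv_right_lt_deriv_boundary' (f := fun s => ‖Φ x s‖ ^ 2)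
        (f' := fun s => 2 * ⟪Φ x s, -W (Φ x s)⟫_ℝ) (B := fun _ => ‖x‖ ^ 2) (B' := fun _ => 0)
        (a := 0) (b := t) (fun s _ => (hd s).continuousAt.continuousWithinAt)
        (fun s _ => (hd s).hasDerivWithinAt) (by simp [hΦ0]) continuousOn_const
        (fun s _ => hasDerivWithinAt_const _ _ _) (fun s hs heq => ?_) (right_mem_Icc.2 ht)
      · have h2 : ‖Φ x t‖ ≤ ‖x‖ := by
          simpa using abs_le_of_sq_le_sq this (norm_nonneg x)
        simp only [mem_ball_zero_iff] at hx ⊢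
        linarith
      · have h3 : ‖Φ x s‖ = ‖x‖ := by
          have := congrArg Real.sqrt heq
          simpa using this
        have h4 : Φ x s ∈ ball (0 : E) R := by
          simp only [mem_ball_zero_iff] at hx ⊢
          rwa [h3]
        have h5 := hV.inner_self h4
        rw [hVW h4, real_inner_comm, h3] at h5
        rw [inner_neg_right]
        have : 0 < γ * ‖x‖ ^ 2 := mul_pos hV.gamma_pos (by positivity)
        linarith
  refine ⟨Φ, fun x _ => hΦ0 x, hmem, fun x hx t ht => ?_, fun x hx s t hs ht => ?_⟩
  · rw [hVW (hmem x hx t ht)]; exact hΦ x t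
  · refine congrFun (huniq (fun t => Φ x (s + t)) _ (fun t => ?_) (hΦ (Φ x s)) ?_) t
    · simpa using (hΦ x (s + t)).comp_const_add s t
    · simp [hΦ0]

/-! ### The explicit Euler scheme -/

/-- Expanding the square gives the factor `1 - 2hγ + h²K² ≤ 1 - hγ ≤ (1 - hγ/2)²`, by the step
condition `hK² ≤ γ`. -/
theorem norm_euler_sub_le (hV : IsDissipative R γ K k V) {h : ℝ} (hh : 0 ≤ h)
    (hhK : h * K ^ 2 ≤ γ) {x y : E} (hx : x ∈ ball (0 : E) R) (hy : y ∈ ball (0 : E) R) :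
    ‖(x - h • V x) - (y - h • V y)‖ ≤ (1 - h * γ / 2) * ‖x - y‖ := by
  have hγ := hV.gamma_pos
  have hK := hV.K_pos
  have h1 : h * γ ≤ 1 := by
    have : h * γ * γ ≤ γ := by
      calc h * γ * γ = h * (γ ^ 2) := by ring
        _ ≤ h * K ^ 2 := by gcongr; exact hV.gamma_le
        _ ≤ γ := hhK
    nlinarith
  have h2 : ‖V x - V y‖ ≤ K * ‖x - y‖ :=
    hV.derivBound.norm_sub_le isOpen_ball (convex_ball _ _) hy hx
  have h3 := hV.monotone x hx y hy
  have h4 : ‖(x - h • V x) - (y - h • V y)‖ ^ 2 =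
      ‖x - y‖ ^ 2 - 2 * h * ⟪V x - V y, x - y⟫_ℝ + h ^ 2 * ‖V x - V y‖ ^ 2 := by
    have e : (x - h • V x) - (y - h • V y) = (x - y) - h • (V x - V y) := by module
    rw [e, norm_sub_sq_real, inner_smul_right, real_inner_comm, norm_smul, mul_pow,
      Real.norm_eq_abs, sq_abs]
    ring
  refine abs_le_of_sq_le_sq' ?_ (by nlinarith [norm_nonneg (x - y)]) |>.2
  rw [h4]
  have h5 : ‖V x - V y‖ ^ 2 ≤ K ^ 2 * ‖x - y‖ ^ 2 := by
    rw [← mul_pow]; gcongr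
  have h6 : h ^ 2 * ‖V x - V y‖ ^ 2 ≤ h * γ * ‖x - y‖ ^ 2 := by
    calc _ ≤ h ^ 2 * (K ^ 2 * ‖x - y‖ ^ 2) := by gcongr
      _ = h * (h * K ^ 2) * ‖x - y‖ ^ 2 := by ring
      _ ≤ h * γ * ‖x - y‖ ^ 2 := by gcongr
  have h7 : 2 * h * (γ * ‖x - y‖ ^ 2) ≤ 2 * h * ⟪V x - V y, x - y⟫_ℝ := by gcongr
  have h8 : 0 ≤ (h * γ / 2) ^ 2 * ‖x - y‖ ^ 2 := by positivity
  nlinarith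

theorem gamma_half_le (hV : IsDissipative R γ K k V) {h : ℝ} (hh : 0 ≤ h)
    (hhK : h * K ^ 2 ≤ γ) : h * γ ≤ 1 := by
  have hγ := hV.gamma_pos
  have : h * γ * γ ≤ γ := by
    calc h * γ * γ = h * (γ ^ 2) := by ring
      _ ≤ h * K ^ 2 := by gcongr; exact hV.gamma_le
      _ ≤ γ := hhK
  nlinarith

theorem norm_euler_sub_le' (hV : IsDissipative R γ K k V) {h : ℝ} (hh : 0 ≤ h)
    (hhK : h * K ^ 2 ≤ γ) {x y : E} (hx : x ∈ ball (0 : E) R) (hy : y ∈ ball (0 : E) R) :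
    ‖(x - h • V x) - (y - h • V y)‖ ≤ ‖x - y‖ := by
  refine (hV.norm_euler_sub_le hh hhK hx hy).trans ?_
  have := mul_nonneg hh hV.gamma_pos.le
  nlinarith [norm_nonneg (x - y)]

theorem mapsTo_euler (hV : IsDissipative R γ K k V) {h : ℝ} (hh : 0 ≤ h)
    (hhK : h * K ^ 2 ≤ γ) : MapsTo (fun x => x - h • V x) (ball (0 : E) R) (ball (0 : E) R) := by
  intro x hx
  have h0 : (0 : E) ∈ ball (0 : E) R := by
    exact mem_ball_self (pos_of_mem_ball hx)
  have := hV.norm_euler_sub_le' hh hhK hx h0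
  simp only [hV.zero, smul_zero, sub_zero] at this
  simp only [mem_ball_zero_iff] at hx ⊢
  linarith

theorem norm_flow_sub_euler_le (hV : IsDissipative R γ K k V) {Φ : E → ℝ → E}
    (hΦ : IsSemiflow (ball (0 : E) R) V Φ) {x : E} (hx : x ∈ ball (0 : E) R) {h : ℝ} (hh : 0 ≤ h) :
    ‖Φ x h - (x - h • V x)‖ ≤ K ^ 2 * h ^ 2 := by
  have hK := hV.K_pos
  have := taylor_one_bound (p := Φ x) (p₁ := fun s => -V (Φ x s))
    (p₂ := fun s => -fderiv ℝ V (Φ x s) (-V (Φ x s))) (C := K ^ 2) hh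
    (fun s hs => hΦ.deriv x hx s hs.1)
    (fun s hs => (((hV.derivBound.1 _ (hΦ.mem x hx s hs.1)).differentiableAt
      (isOpen_ball.mem_nhds (hΦ.mem x hx s hs.1))).hasFDerivAt.comp_hasDerivAt s
        (hΦ.deriv x hx s hs.1)).neg)
    (fun s hs => by
      rw [norm_neg, pow_two]
      refine (ContinuousLinearMap.le_opNorm _ _).trans ?_
      rw [norm_neg]
      have h1 := hΦ.mem x hx s hs.1
      gcongr
      · exact hV.derivBound.2.norm_le h1
      · exact hV.ckBound.norm_le h1)
  rw [hΦ.zero x hx] at this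
  convert this using 2
  rw [smul_neg]; abel

/-- Each step commits an error `K²h²`, and the Euler map, being nonexpansive, does not amplify the
earlier ones. With `h = t/n` the total is `K²t²/n`. -/
theorem norm_euler_iterate_sub_le (hV : IsDissipative R γ K k V) {Φ : E → ℝ → E}
    (hΦ : IsSemiflow (ball (0 : E) R) V Φ) {x : E} (hx : x ∈ ball (0 : E) R) {h : ℝ} (hh : 0 ≤ h)
    (hhK : h * K ^ 2 ≤ γ) (n : ℕ) :
    (fun x => x - h • V x)^[n] x ∈ ball (0 : E) R ∧
    ‖(fun x => x - h • V x)^[n] x - Φ x (n * h)‖ ≤ n * (K ^ 2 * h ^ 2) := by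
  induction n with
  | zero => simp [hΦ.zero x hx, hx, -mem_ball]
  | succ n ih =>
    obtain ⟨ih1, ih2⟩ := ih
    rw [Function.iterate_succ_apply']
    refine ⟨hV.mapsTo_euler hh hhK ih1, ?_⟩
    set y := (fun x => x - h • V x)^[n] x
    have hm : Φ x (n * h) ∈ ball (0 : E) R := hΦ.mem x hx _ (by positivity)
    have e : Φ x ((n + 1 : ℕ) * h) = Φ (Φ x (n * h)) h := by
      rw [← hΦ.add x hx _ _ (by positivity) hh]; push_cast; ring_nf
    rw [e]
    set z := Φ x (n * h)
    calc ‖y - h • V y - Φ z h‖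
        = ‖((y - h • V y) - (z - h • V z)) - (Φ z h - (z - h • V z))‖ := by congr 1; abel
      _ ≤ ‖(y - h • V y) - (z - h • V z)‖ + ‖Φ z h - (z - h • V z)‖ := norm_sub_le _ _
      _ ≤ n * (K ^ 2 * h ^ 2) + K ^ 2 * h ^ 2 :=
        add_le_add ((hV.norm_euler_sub_le' hh hhK ih1 hm).trans ih2)
          (hV.norm_flow_sub_euler_le hΦ hm hh)
      _ = _ := by push_cast; ring

theorem eventually_step_le (hV : IsDissipative R γ K k V) (t : ℝ) :
    ∀ᶠ n : ℕ in atTop, t / n * K ^ 2 ≤ γ ∧ t / n ≤ 1 ∧ 1 ≤ n := by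
  have h1 : Tendsto (fun n : ℕ => t / n) atTop (𝓝 0) := tendsto_const_div_atTop_nhds_zero_nat t
  have h2 : Tendsto (fun n : ℕ => t / n * K ^ 2) atTop (𝓝 0) := by simpa using h1.mul_const (K ^ 2)
  filter_upwards [h2.eventually (ge_mem_nhds hV.gamma_pos), h1.eventually (ge_mem_nhds zero_lt_one),
    eventually_ge_atTop 1] with n a b c using ⟨a, b, c⟩

theorem tendsto_euler_iterate (hV : IsDissipative R γ K k V) {Φ : E → ℝ → E}
    (hΦ : IsSemiflow (ball (0 : E) R) V Φ) {x : E} (hx : x ∈ ball (0 : E) R) {t : ℝ} (ht : 0 ≤ t) :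
    Tendsto (fun n : ℕ => (fun x => x - (t / n) • V x)^[n] x) atTop (𝓝 (Φ x t)) := by
  rw [tendsto_iff_norm_sub_tendsto_zero]
  refine squeeze_zero' (Eventually.of_forall fun _ => norm_nonneg _)
    (g := fun n : ℕ => (K ^ 2 * t ^ 2) / n) ?_ (tendsto_const_div_atTop_nhds_zero_nat _)
  filter_upwards [hV.eventually_step_le t] with n hn
  have hn0 : (0 : ℝ) < n := by exact_mod_cast hn.2.2
  have := (hV.norm_euler_iterate_sub_le hΦ hx (h := t / n) (by positivity) hn.1 n).2
  rw [mul_div_cancel₀ _ hn0.ne'] at this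
  refine this.trans_eq ?_
  field_simp

theorem contDiffOn_euler (hV : IsDissipative R γ K k V) (h : ℝ) :
    ContDiffOn ℝ (k + 1 : ℕ) (fun x => x - h • V x) (ball (0 : E) R) :=
  contDiffOn_id.sub (hV.ckBound.1.const_smul h)

theorem norm_fderiv_euler_le (hV : IsDissipative R γ K k V) {h : ℝ} (hh : 0 ≤ h)
    (hhK : h * K ^ 2 ≤ γ) {x : E} (hx : x ∈ ball (0 : E) R) :
    ‖fderiv ℝ (fun x => x - h • V x) x‖ ≤ 1 - h * γ / 2 := by
  have h1 := hV.gamma_half_le hh hhK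
  refine norm_fderiv_le_of_lip' ℝ (by linarith) ?_
  filter_upwards [isOpen_ball.mem_nhds hx] with y hy
  exact hV.norm_euler_sub_le hh hhK hy hx

theorem norm_iteratedFDeriv_fderiv_euler_le (hV : IsDissipative R γ K k V) {h : ℝ} (hh : 0 ≤ h)
    {j : ℕ} (hj : 1 ≤ j) (hjk : j ≤ k) {x : E} (hx : x ∈ ball (0 : E) R) :
    ‖iteratedFDeriv ℝ j (fderiv ℝ (fun x => x - h • V x)) x‖ ≤ h * K := by
  have e : EqOn (fderiv ℝ (fun x => x - h • V x))
      (fun x => ContinuousLinearMap.id ℝ E - h • fderiv ℝ V x) (ball (0 : E) R) := fun y hy =>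
    ((hasFDerivAt_id y).sub (((hV.derivBound.1 y hy).differentiableAt
      (isOpen_ball.mem_nhds hy)).hasFDerivAt.const_smul h)).fderiv
  rw [iteratedFDeriv_congr_of_isOpen isOpen_ball e j hx]
  have hc : ContDiffAt ℝ j (fderiv ℝ V) x :=
    (hV.derivBound.2.1.contDiffAt (isOpen_ball.mem_nhds hx)).of_le (by exact_mod_cast hjk)
  have e2 : iteratedFDeriv ℝ j (fun x => ContinuousLinearMap.id ℝ E - h • fderiv ℝ V x) x
      = iteratedFDeriv ℝ j (fun _ : E => ContinuousLinearMap.id ℝ E) x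
        - h • iteratedFDeriv ℝ j (fderiv ℝ V) x := by
    rw [← iteratedFDeriv_const_smul_apply hc]
    exact iteratedFDeriv_sub_apply contDiffAt_const (hc.const_smul h)
  obtain ⟨i, rfl⟩ : ∃ i, j = i + 1 := ⟨j - 1, by omega⟩
  rw [e2, iteratedFDeriv_succ_const, Pi.zero_apply, zero_sub, norm_neg, norm_smul,
    Real.norm_of_nonneg hh]
  gcongr
  exact hV.derivBound.2.2 _ hjk x hx

/-- Exponential decay of the derivatives along the semiflow. -/
theorem exists_derivBound_comp_flow [FiniteDimensional ℝ E] [CompleteSpace F] (hγ : 0 < γ)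
    (hK : 0 ≤ K) (k : ℕ) :
    ∃ C : ℝ, 0 ≤ C ∧ ∀ {R : ℝ} {V : E → E} {Φ : E → ℝ → E}, IsDissipative R γ K (k + 1) V →
      IsSemiflow (ball (0 : E) R) V Φ → ∀ {M : ℝ} {v : E → F},
      DerivBound (ball (0 : E) R) (k + 1) M v → ∀ t, 0 ≤ t →
      DerivBound (ball (0 : E) R) k (C * M * Real.exp (-(γ / 4) * t)) (fun x => v (Φ x t)) := by
  obtain ⟨K', hK', H⟩ := exists_norm_iteratedFDeriv_comp_le (E := E) hK (k + 2)
  -- Chosen so that `hK'/lam ≤ hγ/4`: half of the contraction `hγ/2` pays for the higher derivatives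
  -- of the Euler map.
  set lam : ℝ := max 1 (4 * K' / γ) with hlam
  have hlam1 : 1 ≤ lam := le_max_left _ _
  have hlam0 : 0 < lam := by linarith
  have hlamK : K' / lam ≤ γ / 4 := by
    rw [div_le_iff₀ hlam0]
    have := le_max_right 1 (4 * K' / γ)
    rw [← hlam, div_le_iff₀ hγ] at this
    linarith
  refine ⟨lam ^ (k + 2), by positivity, ?_⟩
  intro R V Φ hV hΦ M v hv t ht
  have step : ∀ h, 0 ≤ h → h ≤ 1 → h * K ^ 2 ≤ γ → ∀ n : ℕ,
      ContDiffOn ℝ (k + 2 : ℕ) (fun x => v ((fun x => x - h • V x)^[n] x)) (ball (0 : E) R) ∧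
      ∀ j, 1 ≤ j → j ≤ k + 2 → ∀ x ∈ ball (0 : E) R,
        ‖iteratedFDeriv ℝ j (fun x => v ((fun x => x - h • V x)^[n] x)) x‖ ≤
          (M * (1 - h * γ / 4) ^ n) * lam ^ j := by
    intro h hh hh1 hhK n
    have hγ1 := hV.gamma_half_le hh hhK
    induction n with
    | zero =>
      refine ⟨hv.contDiffOn isOpen_ball, fun j hj hjk x hx => ?_⟩
      simp only [Function.iterate_zero, id_eq, pow_zero, mul_one]
      obtain ⟨i, rfl⟩ : ∃ i, j = i + 1 := ⟨j - 1, by omega⟩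
      have h1 := hv.2.2 i (by omega) x hx
      rw [norm_iteratedFDeriv_fderiv] at h1
      have h0 : 0 ≤ M := (norm_nonneg _).trans h1
      refine h1.trans (le_mul_of_one_le_right h0 (one_le_pow₀ hlam1))
    | succ n ih =>
      obtain ⟨ih1, ih2⟩ := ih
      have e : (fun x => v ((fun x => x - h • V x)^[n + 1] x)) =
          (fun x => v ((fun x => x - h • V x)^[n] x)) ∘ (fun x => x - h • V x) := by
        funext x; simp [Function.iterate_succ_apply]
      rw [e]
      refine ⟨ih1.comp (hV.contDiffOn_euler h) (hV.mapsTo_euler hh hhK), fun j hj hjk x hx => ?_⟩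
      have h2 := H F isOpen_ball (hV.mapsTo_euler hh hhK) (hV.contDiffOn_euler h)
        (by linarith : 0 ≤ 1 - h * γ / 2)
        (by nlinarith : 1 - h * γ / 2 ≤ 1) hh hh1 hlam1
        (fun y hy => hV.norm_fderiv_euler_le hh hhK hy)
        (fun i hi hik y hy => hV.norm_iteratedFDeriv_fderiv_euler_le hh hi (by omega) hy)
        ih1 ih2 j hj hjk x hx
      refine h2.trans ?_
      have h3 : 0 ≤ M * (1 - h * γ / 4) ^ n * lam ^ j := (norm_nonneg _).trans (ih2 j hj hjk x hx)
      calc _ ≤ M * (1 - h * γ / 4) ^ n * lam ^ j * (1 - h * γ / 4) := by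
            refine mul_le_mul_of_nonneg_left ?_ h3
            have : h * K' / lam ≤ h * (γ / 4) := by
              rw [mul_div_assoc]; gcongr
            linarith
        _ = _ := by ring
  -- The bounds for `n` steps of size `t/n` are uniform in `n`, since `(1 - tγ/(4n))^n ≤ e^{-γt/4}`
  -- and the weights cost at most `lam^(k+2)`. The limit drops the top order, hence `k + 1` in the
  -- hypotheses and `k` in the conclusion.
  refine DerivBound.of_tendsto isOpen_ball (l := atTop)
    (f := fun n : ℕ => fun x => v ((fun x => x - (t / n) • V x)^[n] x)) ?_ ?_
  · filter_upwards [hV.eventually_step_le t] with n hn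
    have hn0 : (0 : ℝ) < n := by exact_mod_cast hn.2.2
    obtain ⟨h1, h2⟩ := step (t / n) (by positivity) hn.2.1 hn.1 n
    have h3 := contDiffOn_succ_iff_fderiv_of_isOpen (𝕜 := ℝ)
      (f := fun x => v ((fun x => x - (t / n) • V x)^[n] x)) (n := ((k + 1 : ℕ) : WithTop ℕ∞))
      (isOpen_ball (x := (0 : E)) (ε := R))
    have h4 := h3.1 (by exact_mod_cast h1)
    refine ⟨h4.1, h4.2.2, fun j hj x hx => ?_⟩
    rw [norm_iteratedFDeriv_fderiv]
    refine (h2 (j + 1) (by omega) (by omega) x hx).trans ?_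
    have hM : 0 ≤ M := (norm_nonneg _).trans (hv.2.norm_le hx)
    have hγ1 := hV.gamma_half_le (h := t / n) (by positivity) hn.1
    have h5 : (1 - t / n * γ / 4) ^ n ≤ Real.exp (-(γ / 4) * t) := by
      calc _ ≤ (Real.exp (-(t / n * γ / 4))) ^ n := by
            gcongr
            · linarith
            · have := Real.add_one_le_exp (-(t / n * γ / 4)); linarith
        _ = _ := by
            rw [← Real.exp_nat_mul]
            congr 1
            field_simp
    have h6 : lam ^ (j + 1) ≤ lam ^ (k + 2) := pow_le_pow_right₀ hlam1 (by omega)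
    calc _ ≤ (M * Real.exp (-(γ / 4) * t)) * lam ^ (k + 2) := by gcongr
      _ = _ := by ring
  · intro x hx
    have h1 : ContinuousAt v (Φ x t) := (hv.contDiffOn isOpen_ball).continuousOn.continuousAt
      (isOpen_ball.mem_nhds (hΦ.mem x hx t ht))
    exact h1.tendsto.comp (hV.tendsto_euler_iterate hΦ hx ht)

end IsDissipative

end Dissipative

/-! ### The first and second order operators -/

section Operators

set_option maxSynthPendingDepth 5 in
noncomputable instance instNormedAddCommGroupDualBilin {E : Type} [NormedAddCommGroup E]
    [NormedSpace ℝ E] : NormedAddCommGroup ((E →L[ℝ] E →L[ℝ] ℝ) →L[ℝ] ℝ) := inferInstance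

set_option maxSynthPendingDepth 5 in
noncomputable instance instNormedSpaceDualBilin {E : Type} [NormedAddCommGroup E]
    [NormedSpace ℝ E] : NormedSpace ℝ ((E →L[ℝ] E →L[ℝ] ℝ) →L[ℝ] ℝ) := inferInstance

variable {E F G : Type} [NormedAddCommGroup E] [NormedSpace ℝ E]
  [NormedAddCommGroup F] [NormedSpace ℝ F] [NormedAddCommGroup G] [NormedSpace ℝ G]
  {U : Set E} {k : ℕ} {M N : ℝ}

theorem CkBound.clm_apply (hU : IsOpen U) (hM : 0 ≤ M) (hN : 0 ≤ N) {A : E → F →L[ℝ] G}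
    {g : E → F} (hA : CkBound U k M A) (hg : CkBound U k N g) :
    CkBound U k (2 ^ k * M * N) (fun x => A x (g x)) := by
  refine (hA.bilin (ContinuousLinearMap.id ℝ (F →L[ℝ] G)) hU hg).mono le_rfl ?_
  exact mul_le_of_le_one_left (by positivity) ContinuousLinearMap.norm_id_le

/-- The first order operator `u ↦ -V · ∇u`. -/
noncomputable def transportOp (V : E → E) (v : E → ℝ) (x : E) : ℝ := -fderiv ℝ v x (V x)

/-- The second order operator with coefficients `a` (first order) and `T` (second order). -/
noncomputable def secondOrderOp (a : E → (E →L[ℝ] ℝ) →L[ℝ] ℝ)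
    (T : E → (E →L[ℝ] E →L[ℝ] ℝ) →L[ℝ] ℝ) (v : E → ℝ) (x : E) : ℝ :=
  a x (fderiv ℝ v x) + T x (fderiv ℝ (fderiv ℝ v) x)

theorem DerivBound.ckBound_transportOp (hU : IsOpen U) (hM : 0 ≤ M) (hN : 0 ≤ N) {V : E → E}
    {v : E → ℝ}
    (hV : CkBound U k N V) (hv : DerivBound U k M v) :
    CkBound U k (2 ^ k * M * N) (transportOp V v) :=
  (hv.2.clm_apply hU hM hN hV).neg

theorem DerivBound.ckBound_secondOrderOp (hU : IsOpen U) (hM : 0 ≤ M) (hN : 0 ≤ N)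
    {a : E → (E →L[ℝ] ℝ) →L[ℝ] ℝ} {T : E → (E →L[ℝ] E →L[ℝ] ℝ) →L[ℝ] ℝ} {v : E → ℝ}
    (ha : CkBound U k N a) (hT : CkBound U k N T) (hv : DerivBound U (k + 1) M v) :
    CkBound U k (2 ^ (k + 1) * N * M) (secondOrderOp a T v) := by
  have h2 := (hv.2.derivBound hU).2
  exact ((ha.clm_apply hU hN hM (hv.mono (Nat.le_succ k) le_rfl).2).add hU
    (hT.clm_apply hU hN hM h2)).mono le_rfl (le_of_eq (by ring))

theorem secondOrderOp_congr (hU : IsOpen U) {a : E → (E →L[ℝ] ℝ) →L[ℝ] ℝ}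
    {T : E → (E →L[ℝ] E →L[ℝ] ℝ) →L[ℝ] ℝ} {v v' : E → ℝ} (h : EqOn v v' U) :
    EqOn (secondOrderOp a T v) (secondOrderOp a T v') U := fun x hx => by
  simp only [secondOrderOp, fderiv_congr_of_isOpen hU h hx,
    fderiv_congr_of_isOpen hU (fderiv_congr_of_isOpen hU h) hx]

set_option maxSynthPendingDepth 5 in
theorem secondOrderOp_sub (hU : IsOpen U) {a : E → (E →L[ℝ] ℝ) →L[ℝ] ℝ}
    {T : E → (E →L[ℝ] E →L[ℝ] ℝ) →L[ℝ] ℝ} {v v' : E → ℝ} (hv : DerivBound U 1 M v)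
    (hv' : DerivBound U 1 N v') {x : E} (hx : x ∈ U) :
    secondOrderOp a T (fun y => v y - v' y) x =
      secondOrderOp a T v x - secondOrderOp a T v' x := by
  have h1 : EqOn (fderiv ℝ (fun y => v y - v' y)) (fun y => fderiv ℝ v y - fderiv ℝ v' y) U :=
    fun y hy => fderiv_fun_sub ((hv.1 y hy).differentiableAt (hU.mem_nhds hy))
      ((hv'.1 y hy).differentiableAt (hU.mem_nhds hy))
  have h2 := fderiv_fun_sub (((hv.2.derivBound hU).1 x hx).differentiableAt (hU.mem_nhds hx))
      (((hv'.2.derivBound hU).1 x hx).differentiableAt (hU.mem_nhds hx))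
  simp only [secondOrderOp]
  rw [h1 hx, fderiv_congr_of_isOpen hU h1 hx, h2, map_sub, map_sub]
  ring

end Operators

/-! ### The transport equation and its characteristics -/

section Transport

variable {E : Type} [NormedAddCommGroup E] [NormedSpace ℝ E]
  {U : Set E} {V : E → E} {Φ : E → ℝ → E}

theorem IsSemiflow.continuousOn (hΦ : IsSemiflow U V Φ) {x : E} (hx : x ∈ U) :
    ContinuousOn (Φ x) (Ici 0) := fun t ht =>
  (hΦ.deriv x hx t ht).continuousAt.continuousWithinAt

theorem IsSemiflow.hasDerivAt_comp (hΦ : IsSemiflow U V Φ) (hU : IsOpen U) {v : E → ℝ}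
    (hv : DifferentiableOn ℝ v U) {x : E} (hx : x ∈ U) {t : ℝ} (ht : 0 ≤ t) :
    HasDerivAt (fun t => v (Φ x t)) (transportOp V v (Φ x t)) t := by
  have h1 := hΦ.mem x hx t ht
  have := ((hv _ h1).differentiableAt (hU.mem_nhds h1)).hasFDerivAt.comp_hasDerivAt t
    (hΦ.deriv x hx t ht)
  simpa [transportOp] using! this

/-- The function `s ↦ v(Φ(x, s + t))` is differentiated at `s = 0` in two ways, letting the flow act
for time `s` first or last. Thus the generator commutes with the semigroup, and `v ∘ Φ_t` solves the
transport equation. -/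
theorem IsSemiflow.transportOp_comp (hΦ : IsSemiflow U V Φ) (hU : IsOpen U) {v : E → ℝ}
    (hv : DifferentiableOn ℝ v U) {t : ℝ} (ht : 0 ≤ t)
    (hv' : DifferentiableOn ℝ (fun x => v (Φ x t)) U) {x : E} (hx : x ∈ U) :
    transportOp V (fun x => v (Φ x t)) x = transportOp V v (Φ x t) := by
  have h1 : HasDerivAt (fun s => v (Φ (Φ x s) t)) (transportOp V (fun x => v (Φ x t)) x) 0 := by
    have := hΦ.hasDerivAt_comp hU hv' hx le_rfl
    rwa [hΦ.zero x hx] at this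
  have h2 : HasDerivAt (fun s => v (Φ x (s + t))) (transportOp V v (Φ x t)) 0 := by
    have := (hΦ.hasDerivAt_comp hU hv hx ht)
    rw [← zero_add t] at this
    have := this.comp_add_const 0 t
    simpa using this
  have h3 := h2.hasDerivWithinAt (s := Ici 0)
  refine (uniqueDiffWithinAt_Ici (0 : ℝ)).eq_deriv _ (h1.hasDerivWithinAt (s := Ici 0)) ?_
  refine h3.congr (fun s hs => ?_) ?_
  · rw [← hΦ.add x hx s t hs ht]
  · simp [hΦ.zero x hx]

/-- `v` is a classical solution of `∂ₜ v = -V · ∇v + g` on `U × [0, ∞)`. -/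
structure SolvesTransport (U : Set E) (V : E → E) (g v : E → ℝ → ℝ) : Prop where
  contDiffOn : ContDiffOn ℝ 1 (fun p : E × ℝ => v p.1 p.2) (U ×ˢ Ici 0)
  equation : ∀ x ∈ U, ∀ t, 0 ≤ t →
    HasDerivWithinAt (fun s => v x s) (transportOp V (fun y => v y t) x + g x t) (Ici 0) t

/-- Chain rule along `s ↦ (Φ(x, s), t - s)`: the transport terms cancel and only the source remains.
Two solutions with the same source therefore differ by a constant along this curve. -/
theorem SolvesTransport.hasDerivWithinAt_characteristic {g v : E → ℝ → ℝ} (hU : IsOpen U)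
    (hΦ : IsSemiflow U V Φ) (hv : SolvesTransport U V g v) {x : E} (hx : x ∈ U) {t s : ℝ}
    (hs : s ∈ Icc 0 t) :
    HasDerivWithinAt (fun s => v (Φ x s) (t - s)) (-g (Φ x s) (t - s)) (Icc 0 t) s := by
  set y := Φ x s with hy
  have hyU : y ∈ U := hΦ.mem x hx s hs.1
  have hr : 0 ≤ t - s := by linarith [hs.2]
  have h1 := ((hv.contDiffOn.differentiableOn (by norm_num)) (y, t - s) ⟨hyU, hr⟩).hasFDerivWithinAt
  set D := fderivWithin ℝ (fun p : E × ℝ => v p.1 p.2) (U ×ˢ Ici 0) (y, t - s) with hD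
  have h2 : HasFDerivWithinAt (fun z : E => (z, t - s)) (ContinuousLinearMap.inl ℝ E ℝ) U y := by
    simpa using! ((hasFDerivAt_id y).prodMk (hasFDerivAt_const (t - s) y)).hasFDerivWithinAt (s := U)
  have h3 : HasFDerivAt (fun z => v z (t - s)) (D.comp (ContinuousLinearMap.inl ℝ E ℝ)) y :=
    (HasFDerivWithinAt.comp (g := fun p : E × ℝ => v p.1 p.2) (t := U ×ˢ Ici 0) y h1 h2
      (fun z hz => ⟨hz, hr⟩)).hasFDerivAt (hU.mem_nhds hyU)
  have h4 : HasDerivWithinAt (fun r : ℝ => (y, r)) ((0 : E), (1 : ℝ)) (Ici 0) (t - s) :=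
    (hasDerivWithinAt_const _ _ _).prodMk (hasDerivWithinAt_id _ _)
  have h5 : HasDerivWithinAt (fun r => v y r) (D (0, 1)) (Ici 0) (t - s) :=
    h1.comp_hasDerivWithinAt (t - s) h4 (fun r hr => ⟨hyU, hr⟩)
  have h6 := (uniqueDiffOn_Ici 0 (t - s) hr).eq_deriv _ h5
    (hv.equation y hyU _ hr)
  have h7 : HasDerivWithinAt (fun s => (Φ x s, t - s)) (-V y, (-1 : ℝ)) (Icc 0 t) s :=
    (hΦ.deriv x hx s hs.1).hasDerivWithinAt.prodMk
      (by simpa using ((hasDerivAt_id s).const_sub t).hasDerivWithinAt (s := Icc 0 t))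
  have h8 := HasFDerivWithinAt.comp_hasDerivWithinAt (l := fun p : E × ℝ => v p.1 p.2)
    (t := U ×ˢ Ici 0) s h1 h7
    (fun r hr => ⟨hΦ.mem x hx r hr.1, sub_nonneg.2 hr.2⟩)
  convert! h8 using 1
  have h9 : D (-V y, (-1 : ℝ)) = -(D (V y, 0)) - D (0, 1) := by
    rw [← map_neg, ← map_sub]; simp
  rw [h9, h6, transportOp, h3.fderiv]
  simp

/-- Uniqueness for the transport equation, by the method of characteristics. -/
theorem SolvesTransport.unique {g v v' : E → ℝ → ℝ} (hU : IsOpen U) (hΦ : IsSemiflow U V Φ)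
    (hv : SolvesTransport U V g v) (hv' : SolvesTransport U V g v')
    (h0 : ∀ x ∈ U, v x 0 = v' x 0) : ∀ x ∈ U, ∀ t, 0 ≤ t → v x t = v' x t := by
  intro x hx t ht
  have hd : ∀ s ∈ Icc 0 t, HasDerivWithinAt
      (fun s => v (Φ x s) (t - s) - v' (Φ x s) (t - s)) 0 (Icc 0 t) s := fun s hs => by
    have := (hv.hasDerivWithinAt_characteristic hU hΦ hx hs).sub
      (hv'.hasDerivWithinAt_characteristic hU hΦ hx hs)
    rw [sub_self] at this
    exact this
  rcases ht.eq_or_lt with rfl | ht'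
  · exact h0 x hx
  have := constant_of_derivWithin_zero (fun s hs => (hd s hs).differentiableWithinAt)
    (fun s hs => (hd s (Ico_subset_Icc_self hs)).derivWithin
      (uniqueDiffOn_Icc ht' s (Ico_subset_Icc_self hs))) t (right_mem_Icc.2 ht)
  simp only [sub_self, sub_zero, hΦ.zero x hx, h0 _ (hΦ.mem x hx t ht)] at this
  linarith

/-- Solutions with bounded spatial derivatives are jointly `C¹`. -/
theorem SolvesTransport.of_derivBound [FiniteDimensional ℝ E] (hU : IsOpen U) (hc : Convex ℝ U)
    {M : ℝ} {g v : E → ℝ → ℝ} (hV : ContinuousOn V U)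
    (hg : ContinuousOn (fun p : E × ℝ => g p.1 p.2) (U ×ˢ Ici 0))
    (hv : ∀ t, 0 ≤ t → DerivBound U 1 M (fun x => v x t))
    (heq : ∀ x ∈ U, ∀ t, 0 ≤ t →
      HasDerivWithinAt (fun s => v x s) (transportOp V (fun y => v y t) x + g x t) (Ici 0) t) :
    SolvesTransport U V g v := by
  have hvt : ∀ x ∈ U, ContinuousOn (v x) (Ici 0) := fun x hx t ht =>
    (heq x hx t ht).continuousWithinAt
  have hA : ContinuousOn (fun p : E × ℝ => fderiv ℝ (fun y => v y p.2) p.1) (U ×ˢ Ici 0) :=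
    continuousOn_uncurry_of_derivBound (v := fun x t => fderiv ℝ (fun y => v y t) x) (k := 0)
      hU hc (fun t ht => (hv t ht).2.derivBound hU)
      (continuousOn_fderiv_of_derivBound hU (fun t ht => hv t ht) hvt)
  refine ⟨contDiffOn_one_of_partial hU (uniqueDiffOn_Ici 0)
    (b := fun p => transportOp V (fun y => v y p.2) p.1 + g p.1 p.2)
    (fun p hp => (((hv p.2 hp.2).1 p.1 hp.1).differentiableAt (hU.mem_nhds hp.1)).hasFDerivAt)
    (fun p hp => heq p.1 hp.1 p.2 hp.2) hA ?_, heq⟩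
  exact (hA.clm_apply (hV.comp continuousOn_fst fun p hp => hp.1)).neg.add hg

end Transport

/-! ### Duhamel's principle -/

theorem hasDerivWithinAt_integral_diag {H : ℝ → ℝ → ℝ}
    (hH : Continuous fun p : ℝ × ℝ => H p.1 p.2) :
    HasDerivWithinAt (fun s => ∫ r in (0 : ℝ)..s, H s r) (H 0 0) (Ici 0) 0 := by
  rw [hasDerivWithinAt_iff_isLittleO, Asymptotics.isLittleO_iff]
  intro ε hε
  obtain ⟨δ, hδ, hδH⟩ := Metric.continuousAt_iff.1 (hH.continuousAt (x := (0, 0))) ε hε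
  have : ball (0 : ℝ) δ ∈ 𝓝[Ici 0] 0 := nhdsWithin_le_nhds (ball_mem_nhds _ hδ)
  filter_upwards [this, self_mem_nhdsWithin] with s hs hs0
  have hs0' : (0 : ℝ) ≤ s := hs0
  have e : ∫ r in (0 : ℝ)..s, (H s r - H 0 0) = (∫ r in (0 : ℝ)..s, H s r) - s * H 0 0 := by
    rw [intervalIntegral.integral_sub]
    · simp
    · exact (hH.comp (by fun_prop : Continuous fun r : ℝ => (s, r))).intervalIntegrable _ _
    · simp
  have e2 : (∫ r in (0 : ℝ)..s, H s r) - (∫ r in (0 : ℝ)..0, H 0 r) - (s - 0) • H 0 0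
      = ∫ r in (0 : ℝ)..s, (H s r - H 0 0) := by
    rw [e]; simp
  rw [e2]
  refine intervalIntegral.norm_integral_le_of_norm_le_const fun r hr => ?_
  rw [uIoc_of_le hs0'] at hr
  have h2 : dist ((s, r) : ℝ × ℝ) (0, 0) < δ := by
    rw [mem_ball, Real.dist_eq, sub_zero, abs_of_nonneg hs0'] at hs
    rw [Prod.dist_eq]
    simp only [Real.dist_eq, sub_zero, abs_of_nonneg hs0', abs_of_pos hr.1]
    exact max_lt hs (hr.2.trans_lt hs)
  exact (hδH h2).le

section Duhamel

variable {E : Type} [NormedAddCommGroup E] [NormedSpace ℝ E] {U : Set E} {V : E → E}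
  {Φ : E → ℝ → E}

/-- The solution of `∂ₜ v = -V · ∇v + w`, `v(·, 0) = 0`, by Duhamel's principle. -/
noncomputable def duhamel (Φ : E → ℝ → E) (w : E → ℝ → ℝ) (x : E) (t : ℝ) : ℝ :=
  ∫ s in (0 : ℝ)..t, w (Φ x (t - s)) s

/-- The absolute values extend the integrand from nonnegative times to the whole plane, where
continuity gives interval integrability without side conditions. -/
theorem IsSemiflow.continuous_duhamel_integrand (hΦ : IsSemiflow U V Φ) {w : E → ℝ → ℝ}
    (hw : ContinuousOn (fun p : E × ℝ => w p.1 p.2) (U ×ˢ Ici 0)) {x : E} (hx : x ∈ U) :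
    Continuous fun p : ℝ × ℝ => w (Φ x |p.1|) |p.2| := by
  have h1 : Continuous fun s : ℝ => Φ x |s| :=
    (hΦ.continuousOn hx).comp_continuous continuous_abs fun s => mem_Ici.2 (abs_nonneg s)
  exact hw.comp_continuous (f := fun p : ℝ × ℝ => (Φ x |p.1|, |p.2|))
    ((h1.comp continuous_fst).prodMk (continuous_abs.comp continuous_snd))
    fun p => ⟨hΦ.mem x hx _ (abs_nonneg _), mem_Ici.2 (abs_nonneg _)⟩

theorem IsSemiflow.intervalIntegrable_duhamel (hΦ : IsSemiflow U V Φ) {w : E → ℝ → ℝ}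
    (hw : ContinuousOn (fun p : E × ℝ => w p.1 p.2) (U ×ˢ Ici 0)) {x : E} (hx : x ∈ U) {a b t : ℝ}
    (ha : 0 ≤ a) (hab : a ≤ b) (hbt : b ≤ t) :
    IntervalIntegrable (fun s => w (Φ x (t - s)) s) volume a b := by
  have h := (hΦ.continuous_duhamel_integrand hw hx).comp
    (by fun_prop : Continuous fun s : ℝ => (t - s, s))
  refine (h.intervalIntegrable (μ := volume) a b).congr (fun s hs => ?_)
  rw [uIoc_of_le hab] at hs
  simp only [Function.comp]
  rw [abs_of_nonneg (by linarith [hs.2]), abs_of_nonneg (by linarith [hs.1])]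

/-- Split the integral at `t` and use the semigroup law on `[0, t]`. This isolates the effect of a
short additional time `s`: old data carried along the flow, plus the newly created source. -/
theorem IsSemiflow.duhamel_add (hΦ : IsSemiflow U V Φ) {w : E → ℝ → ℝ}
    (hw : ContinuousOn (fun p : E × ℝ => w p.1 p.2) (U ×ˢ Ici 0)) {x : E} (hx : x ∈ U) {s t : ℝ}
    (hs : 0 ≤ s) (ht : 0 ≤ t) :
    duhamel Φ w x (t + s) =
      duhamel Φ w (Φ x s) t + ∫ r in (0 : ℝ)..s, w (Φ x (s - r)) (t + r) := by
  unfold duhamel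
  rw [← intervalIntegral.integral_add_adjacent_intervals
    (hΦ.intervalIntegrable_duhamel hw hx le_rfl ht (by linarith))
    (hΦ.intervalIntegrable_duhamel hw hx ht (by linarith) le_rfl)]
  congr 1
  · refine intervalIntegral.integral_congr fun r hr => ?_
    rw [uIcc_of_le ht] at hr
    rw [← hΦ.add x hx s (t - r) hs (by linarith [hr.2])]
    ring_nf
  · have := intervalIntegral.integral_comp_add_left (a := 0) (b := s)
      (fun r => w (Φ x (t + s - r)) r) t
    rw [add_zero] at this
    rw [← this]
    refine intervalIntegral.integral_congr fun r _ => ?_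
    ring_nf

theorem IsSemiflow.continuousOn_duhamel (hΦ : IsSemiflow U V Φ) {w : E → ℝ → ℝ}
    (hw : ContinuousOn (fun p : E × ℝ => w p.1 p.2) (U ×ˢ Ici 0)) {x : E} (hx : x ∈ U) :
    ContinuousOn (duhamel Φ w x) (Ici 0) := by
  have h1 : Continuous (Function.uncurry fun t s : ℝ => w (Φ x |t - s|) |s|) :=
    (hΦ.continuous_duhamel_integrand hw hx).comp
      (by fun_prop : Continuous fun p : ℝ × ℝ => (p.1 - p.2, p.2))
  have h2 := intervalIntegral.continuous_parametric_intervalIntegral_of_continuous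
    (μ := volume) (a₀ := 0) h1 continuous_id
  refine h2.continuousOn.congr fun t ht => ?_
  refine intervalIntegral.integral_congr fun s hs => ?_
  rw [uIcc_of_le ht] at hs
  have hs2 : s ≤ t := hs.2
  rw [abs_of_nonneg (by linarith), abs_of_nonneg hs.1]

/-- `duhamel_add`, differentiated at `s = 0`, gives a right derivative: a transport term from the
moving starting point and the value `w x t` from the short integral. This right derivative is
continuous in `t`, hence a genuine derivative. -/
theorem IsSemiflow.hasDerivWithinAt_duhamel [FiniteDimensional ℝ E] (hΦ : IsSemiflow U V Φ)
    (hU : IsOpen U) {w : E → ℝ → ℝ} {M : ℝ}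
    (hw : ContinuousOn (fun p : E × ℝ => w p.1 p.2) (U ×ˢ Ici 0))
    (hd : ∀ t, 0 ≤ t → DerivBound U 1 M (fun x => duhamel Φ w x t)) {x : E} (hx : x ∈ U) {t : ℝ}
    (ht : 0 ≤ t) :
    HasDerivWithinAt (fun s => duhamel Φ w x s)
      (transportOp V (fun y => duhamel Φ w y t) x + w x t) (Ici 0) t := by
  refine (hasDerivWithinAt_Ici_of_right (p := duhamel Φ w x)
    (r := fun t => transportOp V (fun y => duhamel Φ w y t) x + w x t)
    (hΦ.continuousOn_duhamel hw hx) ?_ ?_).1 t ht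
  · refine ContinuousOn.add (ContinuousOn.neg ?_) ?_
    · exact (continuousOn_fderiv_of_derivBound hU (fun t ht => hd t ht)
        (fun y hy => hΦ.continuousOn_duhamel hw hy) x hx).clm_apply continuousOn_const
    · exact hw.comp (f := fun t : ℝ => (x, t)) (by fun_prop) fun t ht => ⟨hx, ht⟩
  · intro t ht
    have h1 : HasDerivWithinAt (fun s => duhamel Φ w (Φ x s) t)
        (transportOp V (fun y => duhamel Φ w y t) x) (Ici 0) 0 := by
      have := (hΦ.hasDerivAt_comp hU (hd t ht).1 hx le_rfl).hasDerivWithinAt (s := Ici 0)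
      rwa [hΦ.zero x hx] at this
    have hw' : ContinuousOn (fun p : E × ℝ => w p.1 (t + p.2)) (U ×ˢ Ici 0) :=
      hw.comp (f := fun p : E × ℝ => (p.1, t + p.2)) (by fun_prop)
        fun p hp => ⟨hp.1, add_nonneg ht hp.2⟩
    have h2 : HasDerivWithinAt (fun s => ∫ r in (0 : ℝ)..s, w (Φ x |s - r|) (t + |r|))
        (w x t) (Ici 0) 0 := by
      have h3 := hasDerivWithinAt_integral_diag (H := fun s r => w (Φ x |s - r|) (t + |r|))
        ((hΦ.continuous_duhamel_integrand (w := fun x r => w x (t + r)) hw' hx).comp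
          (by fun_prop : Continuous fun p : ℝ × ℝ => (p.1 - p.2, p.2)))
      simpa [hΦ.zero x hx] using h3
    have h4 : HasDerivWithinAt (fun s => duhamel Φ w x (t + s))
        (transportOp V (fun y => duhamel Φ w y t) x + w x t) (Ici 0) 0 := by
      refine (h1.add h2).congr (fun s hs => ?_) ?_
      · rw [hΦ.duhamel_add hw hx hs ht]
        simp only [Pi.add_apply]
        congr 1
        refine intervalIntegral.integral_congr fun r hr => ?_
        rw [uIcc_of_le hs] at hr
        rw [abs_of_nonneg (by linarith [hr.2]), abs_of_nonneg hr.1]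
      · simp [hΦ.zero x hx]
    have h5 : HasDerivWithinAt (fun s => duhamel Φ w x s)
        (transportOp V (fun y => duhamel Φ w y t) x + w x t) (Ici t) t := by
      have h6 : HasDerivWithinAt (fun s : ℝ => s - t) 1 (Ici t) t := by
        simpa using ((hasDerivAt_id t).sub_const t).hasDerivWithinAt (s := Ici t)
      have h7 := HasDerivWithinAt.scomp_of_eq (g₁ := fun s => duhamel Φ w x (t + s))
        (t' := Ici 0) t h4 h6 (fun s hs => mem_Ici.2 (sub_nonneg.2 hs)) (by simp)
      simpa [Function.comp_def] using h7
    exact h5.mono Ioi_subset_Ici_self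

end Duhamel

/-- The source at time `s` has size `e^{-cs}` and is then transported for time `t - s`, which
contributes `e^{-c(t-s)}`. The product `e^{-ct}` does not depend on `s`, so integration costs only
the factor `t`. -/
theorem IsDissipative.exists_derivBound_duhamel {E : Type} [NormedAddCommGroup E]
    [InnerProductSpace ℝ E] [FiniteDimensional ℝ E] {γ K : ℝ} (hγ : 0 < γ) (hK : 0 ≤ K) (k : ℕ) :
    ∃ C : ℝ, 0 ≤ C ∧ ∀ {R : ℝ} {V : E → E} {Φ : E → ℝ → E}, IsDissipative R γ K (k + 1) V →
      IsSemiflow (ball (0 : E) R) V Φ → ∀ {N : ℝ} {w : E → ℝ → ℝ},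
      (∀ t, 0 ≤ t → CkBound (ball (0 : E) R) (k + 2) (N * Real.exp (-(γ / 4) * t))
        (fun x => w x t)) →
      ContinuousOn (fun p : E × ℝ => w p.1 p.2) (ball (0 : E) R ×ˢ Ici 0) → ∀ t, 0 ≤ t →
      DerivBound (ball (0 : E) R) k (C * N * Real.exp (-(γ / 4) * t) * t)
        (fun x => duhamel Φ w x t) := by
  obtain ⟨C, hC, H⟩ := exists_derivBound_comp_flow (E := E) (F := ℝ) hγ hK k
  refine ⟨C, hC, ?_⟩
  intro R V Φ hV hΦ N w hw hwc t ht
  -- Clamping `s` to `[0, t]` makes the bounds valid for every real `s`; on the domain of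
  -- integration nothing changes.
  let c : ℝ → ℝ := fun s => max 0 (min s t)
  have hc0 : ∀ s, 0 ≤ c s := fun s => le_max_left _ _
  have hct : ∀ s, c s ≤ t := fun s => max_le ht (min_le_right _ _)
  have hcc : Continuous c := by fun_prop
  have hcs : ∀ s ∈ Ioc 0 t, c s = s := fun s hs => by
    simp only [c]; rw [min_eq_left hs.2, max_eq_right hs.1.le]
  have hf : ∀ s, DerivBound (ball (0 : E) R) k (C * N * Real.exp (-(γ / 4) * t))
      (fun x => w (Φ x (t - c s)) (c s)) := by
    intro s
    have h1 := H hV hΦ ((hw (c s) (hc0 s)).derivBound isOpen_ball) (t - c s)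
      (by linarith [hct s])
    refine h1.mono le_rfl (le_of_eq ?_)
    rw [← mul_assoc, mul_assoc, ← Real.exp_add]
    ring_nf
  have h2 := DerivBound.integral (ν := volume.restrict (Ioc 0 t)) isOpen_ball hf
    (N := |N|) (fun s x hx => ?_) (fun x hx => ?_)
  · rw [measureReal_restrict_apply_univ, Real.volume_real_Ioc, sub_zero, max_eq_left ht] at h2
    refine h2.congr isOpen_ball fun x _ => ?_
    simp only [duhamel]
    rw [intervalIntegral.integral_of_le ht]
    exact setIntegral_congr_fun measurableSet_Ioc fun s hs => by simp only [hcs s hs]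
  · refine ((hw (c s) (hc0 s)).norm_le (hΦ.mem x hx _ (by linarith [hct s]))).trans ?_
    calc _ ≤ |N| * 1 := by
          gcongr
          · exact le_abs_self N
          · refine Real.exp_le_one_iff.2 ?_
            have := mul_nonneg hγ.le (hc0 s)
            linarith
      _ = |N| := mul_one _
  · have h3 : Continuous fun s => w (Φ x |t - c s|) |c s| :=
      (hΦ.continuous_duhamel_integrand hwc hx).comp
        (by fun_prop : Continuous fun s : ℝ => (t - c s, c s))
    refine (h3.congr fun s => ?_).aestronglyMeasurable
    rw [abs_of_nonneg (hc0 s), abs_of_nonneg (by linarith [hct s])]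

/-! ### Taylor expansions along the flow and along a gradient step -/

section Taylor

variable {E : Type} [NormedAddCommGroup E] [NormedSpace ℝ E] {U : Set E} {V : E → E}
  {Φ : E → ℝ → E} {M K : ℝ} {v : E → ℝ}

theorem IsSemiflow.taylor_one (hΦ : IsSemiflow U V Φ) (hU : IsOpen U) (hM : 0 ≤ M) (hK : 0 ≤ K)
    (hV : CkBound U 1 K V) (hv : DerivBound U 1 M v) {x : E} (hx : x ∈ U) {h : ℝ} (hh : 0 ≤ h) :
    ‖v (Φ x h) - v x - h * transportOp V v x‖ ≤ 2 * M * K ^ 2 * h ^ 2 := by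
  have h1 := hv.ckBound_transportOp hU hM hK hV
  have h2 := (h1.derivBound hU).ckBound_transportOp hU (by positivity) hK (hV.mono zero_le_one le_rfl)
  have := taylor_one_bound (p := fun s => v (Φ x s)) (p₁ := fun s => transportOp V v (Φ x s))
    (p₂ := fun s => transportOp V (transportOp V v) (Φ x s)) (C := 2 * M * K ^ 2) hh
    (fun s hs => hΦ.hasDerivAt_comp hU hv.1 hx hs.1)
    (fun s hs => hΦ.hasDerivAt_comp hU (h1.derivBound hU).1 hx hs.1)
    (fun s hs => (h2.norm_le (hΦ.mem x hx s hs.1)).trans (le_of_eq (by ring)))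
  simpa [hΦ.zero x hx] using this

theorem IsSemiflow.taylor_two (hΦ : IsSemiflow U V Φ) (hU : IsOpen U) (hM : 0 ≤ M) (hK : 0 ≤ K)
    (hV : CkBound U 2 K V) (hv : DerivBound U 2 M v) {x : E} (hx : x ∈ U) {h : ℝ} (hh : 0 ≤ h) :
    ‖v (Φ x h) - v x - h * transportOp V v x - h ^ 2 / 2 * transportOp V (transportOp V v) x‖
      ≤ 8 * M * K ^ 3 * h ^ 3 := by
  have h1 := hv.ckBound_transportOp hU hM hK hV
  have h2 := (h1.derivBound hU).ckBound_transportOp hU (by positivity) hK (hV.mono one_le_two le_rfl)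
  have h3 := (h2.derivBound hU).ckBound_transportOp hU (by positivity) hK (hV.mono zero_le_two le_rfl)
  have := taylor_two_bound (p := fun s => v (Φ x s)) (p₁ := fun s => transportOp V v (Φ x s))
    (p₂ := fun s => transportOp V (transportOp V v) (Φ x s))
    (p₃ := fun s => transportOp V (transportOp V (transportOp V v)) (Φ x s))
    (C := 8 * M * K ^ 3) hh
    (fun s hs => hΦ.hasDerivAt_comp hU hv.1 hx hs.1)
    (fun s hs => hΦ.hasDerivAt_comp hU (h1.derivBound hU).1 hx hs.1)
    (fun s hs => hΦ.hasDerivAt_comp hU (h2.derivBound hU).1 hx hs.1)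
    (fun s hs => (h3.norm_le (hΦ.mem x hx s hs.1)).trans (le_of_eq (by ring)))
  simpa [hΦ.zero x hx] using this

theorem sub_smul_mem_of_convex (hc : Convex ℝ U) {x g : E} (hx : x ∈ U) {h s : ℝ}
    (hh : x - h • g ∈ U) (hs : s ∈ Icc 0 h) : x - s • g ∈ U := by
  rcases hs.1.eq_or_lt with h0 | h0
  · simpa [← h0] using hx
  have hpos : 0 < h := h0.trans_le hs.2
  have := hc hx hh (a := 1 - s / h) (b := s / h)
    (by rw [sub_nonneg, div_le_one hpos]; exact hs.2) (div_nonneg hs.1 hpos.le) (by ring)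
  convert this using 1
  rw [smul_sub, smul_smul, div_mul_cancel₀ _ hpos.ne']
  module

theorem hasDerivAt_sub_smul (x g : E) (s : ℝ) : HasDerivAt (fun s : ℝ => x - s • g) (-g) s := by
  simpa using! ((hasDerivAt_id s).smul_const g).const_sub x

theorem DerivBound.step_taylor_one (hv : DerivBound U 1 M v) (hU : IsOpen U) (hc : Convex ℝ U)
    (hM : 0 ≤ M) {x g : E} (hx : x ∈ U) (hg : ‖g‖ ≤ K) {h : ℝ} (hh : 0 ≤ h)
    (hstep : x - h • g ∈ U) :
    ‖v (x - h • g) - v x + h * fderiv ℝ v x g‖ ≤ M * K ^ 2 * h ^ 2 := by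
  have hD : DerivBound U 0 M (fderiv ℝ v) := hv.2.derivBound hU
  have hmem := fun s (hs : s ∈ Icc 0 h) => sub_smul_mem_of_convex hc hx hstep hs
  have := taylor_one_bound (p := fun s => v (x - s • g)) (p₁ := fun s => fderiv ℝ v (x - s • g) (-g))
    (p₂ := fun s => fderiv ℝ (fderiv ℝ v) (x - s • g) (-g) (-g)) (C := M * K ^ 2) hh
    (fun s hs => (((hv.1 _ (hmem s hs)).differentiableAt
      (hU.mem_nhds (hmem s hs))).hasFDerivAt).comp_hasDerivAt s (hasDerivAt_sub_smul x g s))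
    (fun s hs => by
      have := ((((hD.1 _ (hmem s hs)).differentiableAt
        (hU.mem_nhds (hmem s hs))).hasFDerivAt).comp_hasDerivAt s
          (hasDerivAt_sub_smul x g s)).clm_apply (hasDerivAt_const s (-g))
      simpa using! this)
    (fun s hs => by
      have hK : 0 ≤ K := (norm_nonneg _).trans hg
      refine (ContinuousLinearMap.le_opNorm₂ _ _ _).trans ?_
      rw [norm_neg]
      calc _ ≤ M * K * K := by
            gcongr
            exact hD.2.norm_le (hmem s hs)
        _ = _ := by ring)
  simpa [sub_neg_eq_add] using this

set_option maxSynthPendingDepth 5 in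
theorem DerivBound.step_taylor_two (hv : DerivBound U 2 M v) (hU : IsOpen U) (hc : Convex ℝ U)
    (hM : 0 ≤ M) {x g : E} (hx : x ∈ U) (hg : ‖g‖ ≤ K) {h : ℝ} (hh : 0 ≤ h)
    (hstep : x - h • g ∈ U) :
    ‖v (x - h • g) - v x + h * fderiv ℝ v x g - h ^ 2 / 2 * fderiv ℝ (fderiv ℝ v) x g g‖
      ≤ M * K ^ 3 * h ^ 3 := by
  have hD : DerivBound U 1 M (fderiv ℝ v) := hv.2.derivBound hU
  have hD2 : DerivBound U 0 M (fderiv ℝ (fderiv ℝ v)) := hD.2.derivBound hU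
  have hmem := fun s (hs : s ∈ Icc 0 h) => sub_smul_mem_of_convex hc hx hstep hs
  have := taylor_two_bound (p := fun s => v (x - s • g)) (p₁ := fun s => fderiv ℝ v (x - s • g) (-g))
    (p₂ := fun s => fderiv ℝ (fderiv ℝ v) (x - s • g) (-g) (-g))
    (p₃ := fun s => fderiv ℝ (fderiv ℝ (fderiv ℝ v)) (x - s • g) (-g) (-g) (-g))
    (C := M * K ^ 3) hh
    (fun s hs => (((hv.1 _ (hmem s hs)).differentiableAt
      (hU.mem_nhds (hmem s hs))).hasFDerivAt).comp_hasDerivAt s (hasDerivAt_sub_smul x g s))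
    (fun s hs => by
      have := ((((hD.1 _ (hmem s hs)).differentiableAt
        (hU.mem_nhds (hmem s hs))).hasFDerivAt).comp_hasDerivAt s
          (hasDerivAt_sub_smul x g s)).clm_apply (hasDerivAt_const s (-g))
      simpa using! this)
    (fun s hs => by
      have := (((((hD2.1 _ (hmem s hs)).differentiableAt
        (hU.mem_nhds (hmem s hs))).hasFDerivAt).comp_hasDerivAt s
          (hasDerivAt_sub_smul x g s)).clm_apply (hasDerivAt_const s (-g))).clm_apply
            (hasDerivAt_const s (-g))
      simpa using! this)
    (fun s hs => by
      have hK : 0 ≤ K := (norm_nonneg _).trans hg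
      refine (ContinuousLinearMap.le_opNorm₂ _ _ _).trans ?_
      rw [norm_neg]
      calc _ ≤ (M * K) * K * K := by
            gcongr
            have h1 := hD2.2.norm_le (hmem s hs)
            rw [map_neg, norm_neg]
            exact ContinuousLinearMap.le_of_opNorm_le_of_le _ h1 hg
        _ = _ := by ring)
  simpa [sub_neg_eq_add] using this

theorem transportOp_transportOp (hU : IsOpen U) (hV : DifferentiableOn ℝ V U)
    (hv : DerivBound U 1 M v) {x : E} (hx : x ∈ U) :
    transportOp V (transportOp V v) x =
      fderiv ℝ (fderiv ℝ v) x (V x) (V x) + fderiv ℝ v x (fderiv ℝ V x (V x)) := by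
  have h1 := ((((hv.2.derivBound hU).1 x hx).differentiableAt (hU.mem_nhds hx)).hasFDerivAt.clm_apply
    ((hV x hx).differentiableAt (hU.mem_nhds hx)).hasFDerivAt).neg
  have h2 : fderiv ℝ (transportOp V v) x = _ := h1.fderiv
  rw [transportOp, h2]
  simp
  ring

end Taylor

/-! ### Averages over one random step -/

section Measurability

/-- Nothing is known about `v` off `U`, so measurability is obtained by factoring through the
subtype. -/
theorem ContinuousOn.measurable_comp_of_mem {E F Θ : Type*} [TopologicalSpace E]
    [MeasurableSpace E] [BorelSpace E] [TopologicalSpace F] [MeasurableSpace F] [BorelSpace F]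
    [MeasurableSpace Θ] {U : Set E}
    {v : E → F} (hv : ContinuousOn v U) {g : Θ → E} (hg : Measurable g) (hU : ∀ θ, g θ ∈ U) :
    Measurable fun θ => v (g θ) :=
  (continuousOn_iff_continuous_domRestrict.1 hv).measurable.comp (hg.subtype_mk (h := hU))

end Measurability

section RandomStep

variable {E : Type} [NormedAddCommGroup E] [NormedSpace ℝ E]
  [MeasurableSpace E] [BorelSpace E]
  {Ξ : Type*} [MeasurableSpace Ξ] {μ : Measure Ξ} [IsProbabilityMeasure μ]
  {U : Set E} {V : E → E} {M K : ℝ} {v : E → ℝ}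

theorem integrable_comp_step (hv : ContinuousOn v U) (hM : ∀ y ∈ U, ‖v y‖ ≤ M) {g : Ξ → E}
    (hg : Measurable g) {x : E} {h : ℝ} (hstep : ∀ ξ, x - h • g ξ ∈ U) :
    Integrable (fun ξ => v (x - h • g ξ)) μ :=
  Integrable.of_bound (hv.measurable_comp_of_mem (by fun_prop) hstep).aestronglyMeasurable M
    (ae_of_all _ fun ξ => hM _ (hstep ξ))

theorem integrable_bilin {g : Ξ → E} (hg : Measurable g) (hK : ∀ ξ, ‖g ξ‖ ≤ K)
    (A : E →L[ℝ] E →L[ℝ] ℝ) : Integrable (fun ξ => A (g ξ) (g ξ)) μ := by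
  have hc : Continuous fun y : E => A y y := by fun_prop
  refine Integrable.of_bound (hc.measurable.comp hg).aestronglyMeasurable (‖A‖ * K * K)
    (ae_of_all _ fun ξ => (A.le_opNorm₂ _ _).trans ?_)
  have hK0 : 0 ≤ K := (norm_nonneg _).trans (hK ξ)
  have := hK ξ
  gcongr

theorem DerivBound.integral_step_one [FiniteDimensional ℝ E] (hv : DerivBound U 1 M v)
    (hU : IsOpen U) (hc : Convex ℝ U)
    (hM : 0 ≤ M) {M' : ℝ} (hM' : ∀ y ∈ U, ‖v y‖ ≤ M') {g : Ξ → E} (hg : Measurable g)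
    (hK : ∀ ξ, ‖g ξ‖ ≤ K) {x : E} (hx : x ∈ U)
    (hgV : ∫ ξ, g ξ ∂μ = V x) {h : ℝ} (hh : 0 ≤ h) (hstep : ∀ ξ, x - h • g ξ ∈ U) :
    ‖(∫ ξ, v (x - h • g ξ) ∂μ) - v x - h * transportOp V v x‖ ≤ M * K ^ 2 * h ^ 2 := by
  have hgi : Integrable g μ := Integrable.of_bound hg.aestronglyMeasurable K (ae_of_all _ hK)
  have h1 := integrable_comp_step (μ := μ) hv.1.continuousOn hM' hg hstep
  have h2 : Integrable (fun ξ => fderiv ℝ v x (g ξ)) μ :=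
    (fderiv ℝ v x).integrable_comp hgi
  have h4 : Integrable (fun ξ => v (x - h • g ξ) - v x) μ := h1.sub (integrable_const _)
  have e : (∫ ξ, v (x - h • g ξ) ∂μ) - v x - h * transportOp V v x
      = ∫ ξ, (v (x - h • g ξ) - v x + h * fderiv ℝ v x (g ξ)) ∂μ := by
    rw [integral_add h4 (h2.const_mul h), integral_sub h1
      (integrable_const _), integral_const_mul, (fderiv ℝ v x).integral_comp_comm hgi, hgV]
    simp [transportOp]
  rw [e]
  refine (norm_integral_le_of_norm_le_const (ae_of_all _ fun ξ =>
    hv.step_taylor_one hU hc hM hx (hK ξ) hh (hstep ξ))).trans ?_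
  simp

theorem DerivBound.integral_step_two [FiniteDimensional ℝ E] (hv : DerivBound U 2 M v)
    (hU : IsOpen U) (hc : Convex ℝ U)
    (hM : 0 ≤ M) {M' : ℝ} (hM' : ∀ y ∈ U, ‖v y‖ ≤ M') {g : Ξ → E} (hg : Measurable g)
    (hK : ∀ ξ, ‖g ξ‖ ≤ K) {x : E} (hx : x ∈ U)
    (hgV : ∫ ξ, g ξ ∂μ = V x) {h : ℝ} (hh : 0 ≤ h) (hstep : ∀ ξ, x - h • g ξ ∈ U) :
    ‖(∫ ξ, v (x - h • g ξ) ∂μ) - v x - h * transportOp V v x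
      - h ^ 2 / 2 * ∫ ξ, fderiv ℝ (fderiv ℝ v) x (g ξ) (g ξ) ∂μ‖ ≤ M * K ^ 3 * h ^ 3 := by
  have hgi : Integrable g μ := Integrable.of_bound hg.aestronglyMeasurable K (ae_of_all _ hK)
  have h1 := integrable_comp_step (μ := μ) hv.1.continuousOn hM' hg hstep
  have h2 : Integrable (fun ξ => fderiv ℝ v x (g ξ)) μ :=
    (fderiv ℝ v x).integrable_comp hgi
  have h3 := integrable_bilin (μ := μ) hg hK (fderiv ℝ (fderiv ℝ v) x)
  have h4 : Integrable (fun ξ => v (x - h • g ξ) - v x) μ := h1.sub (integrable_const _)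
  have h5 : Integrable (fun ξ => v (x - h • g ξ) - v x + h * fderiv ℝ v x (g ξ)) μ :=
    h4.add (h2.const_mul h)
  have e : (∫ ξ, v (x - h • g ξ) ∂μ) - v x - h * transportOp V v x
      - h ^ 2 / 2 * (∫ ξ, fderiv ℝ (fderiv ℝ v) x (g ξ) (g ξ) ∂μ)
      = ∫ ξ, (v (x - h • g ξ) - v x + h * fderiv ℝ v x (g ξ)
        - h ^ 2 / 2 * fderiv ℝ (fderiv ℝ v) x (g ξ) (g ξ)) ∂μ := by
    rw [integral_sub h5 (h3.const_mul _),
      integral_add h4 (h2.const_mul h), integral_sub h1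
      (integrable_const _), integral_const_mul, integral_const_mul,
      (fderiv ℝ v x).integral_comp_comm hgi, hgV]
    simp [transportOp]
  rw [e]
  refine (norm_integral_le_of_norm_le_const (ae_of_all _ fun ξ =>
    hv.step_taylor_two hU hc hM hx (hK ξ) hh (hstep ξ))).trans ?_
  simp

end RandomStep

/-! ### Coefficients of the second order operator -/

section Coefficients

variable {E : Type} [NormedAddCommGroup E] [NormedSpace ℝ E]
  [MeasurableSpace E] [BorelSpace E]
  {Ξ : Type*} [MeasurableSpace Ξ] {μ : Measure Ξ} [IsProbabilityMeasure μ]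
  {U : Set E} {V : E → E} {G : Ξ → E → E} {M K : ℝ} {v : E → ℝ}

/-- The functional `ℓ ↦ -(1/2) ℓ(DV(x) V(x))`. -/
noncomputable def driftCoeff (V : E → E) (x : E) : (E →L[ℝ] ℝ) →L[ℝ] ℝ :=
  (-(1 / 2) : ℝ) • ContinuousLinearMap.apply ℝ ℝ (fderiv ℝ V x (V x))

/-- The functional `A ↦ A(y)(y)` on bilinear forms. -/
noncomputable def evalDiag (y : E) : (E →L[ℝ] E →L[ℝ] ℝ) →L[ℝ] ℝ :=
  ContinuousLinearMap.compL ℝ (E →L[ℝ] E →L[ℝ] ℝ) (E →L[ℝ] ℝ) ℝ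
    (ContinuousLinearMap.apply ℝ ℝ y) (ContinuousLinearMap.apply ℝ (E →L[ℝ] ℝ) y)

omit [MeasurableSpace E] [BorelSpace E] in
@[simp] theorem evalDiag_apply (y : E) (A : E →L[ℝ] E →L[ℝ] ℝ) : evalDiag y A = A y y := rfl

/-- The functional `A ↦ (1/2) 𝔼[A(G - V)(G - V)]` on bilinear forms. -/
noncomputable def diffusionCoeff (μ : Measure Ξ) (G : Ξ → E → E) (V : E → E) (x : E) :
    (E →L[ℝ] E →L[ℝ] ℝ) →L[ℝ] ℝ :=
  (1 / 2 : ℝ) • ∫ ξ, evalDiag (G ξ x - V x) ∂μ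

omit [MeasurableSpace E] [BorelSpace E] in
set_option maxSynthPendingDepth 5 in
theorem exists_ckBound_driftCoeff (hU : IsOpen U) (hK : 0 ≤ K) {k : ℕ}
    (hV : CkBound U (k + 1) K V) : ∃ N, 0 ≤ N ∧ CkBound U k N (driftCoeff V) := by
  have h1 := (hV.derivBound hU).2.clm_apply hU hK hK (hV.mono (Nat.le_succ k) le_rfl)
  have h2 := h1.clm_comp (G := (E →L[ℝ] ℝ) →L[ℝ] ℝ)
    ((-(1 / 2) : ℝ) • ContinuousLinearMap.apply ℝ ℝ) hU
  exact ⟨_, by positivity, h2⟩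

omit [MeasurableSpace E] [BorelSpace E] in
set_option maxSynthPendingDepth 5 in
theorem continuous_evalDiag :
    Continuous (evalDiag : E → (E →L[ℝ] E →L[ℝ] ℝ) →L[ℝ] ℝ) := by
  unfold evalDiag
  fun_prop

set_option maxSynthPendingDepth 5 in
theorem exists_ckBound_diffusionCoeff [FiniteDimensional ℝ E] (hU : IsOpen U) (hK : 0 ≤ K) {k : ℕ}
    (hV : CkBound U k K V) (hG : ∀ ξ, CkBound U k K (G ξ))
    (hm : ∀ x ∈ U, Measurable fun ξ => G ξ x) :
    ∃ N, 0 ≤ N ∧ CkBound U k N (diffusionCoeff μ G V) := by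
  have h1 : ∀ ξ, CkBound U k (K + K) (fun x => G ξ x - V x) := fun ξ => (hG ξ).sub hU hV
  have h2 := fun ξ => ((h1 ξ).clm_comp (ContinuousLinearMap.apply ℝ ℝ) hU).bilin
    (ContinuousLinearMap.compL ℝ (E →L[ℝ] E →L[ℝ] ℝ) (E →L[ℝ] ℝ) ℝ) hU
    ((h1 ξ).clm_comp (ContinuousLinearMap.apply ℝ (E →L[ℝ] ℝ)) hU)
  have h3 := CkBound.integral (ν := μ) hU h2 fun x hx => by
    have := ((continuous_evalDiag (E := E)).measurable.comp
      ((hm x hx).sub_const (V x))).aestronglyMeasurable (μ := μ)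
    exact this
  have h4 := h3.clm_comp ((1 / 2 : ℝ) • ContinuousLinearMap.id ℝ _) hU
  exact ⟨_, by positivity, h4⟩

set_option maxSynthPendingDepth 5 in
theorem diffusionCoeff_apply [FiniteDimensional ℝ E] {x : E} (hm : Measurable fun ξ => G ξ x)
    (hK : ∀ ξ, ‖G ξ x‖ ≤ K) (A : E →L[ℝ] E →L[ℝ] ℝ) :
    diffusionCoeff μ G V x A = 1 / 2 * ∫ ξ, A (G ξ x - V x) (G ξ x - V x) ∂μ := by
  have hi : Integrable (fun ξ => evalDiag (G ξ x - V x)) μ := by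
    have hc : Continuous fun y : E => evalDiag (y - V x) :=
      continuous_evalDiag.comp (continuous_id.sub continuous_const)
    obtain ⟨B, hB⟩ := (isCompact_closedBall (0 : E) K).exists_bound_of_continuousOn hc.continuousOn
    exact Integrable.of_bound (hc.measurable.comp hm).aestronglyMeasurable B
      (ae_of_all _ fun ξ => hB _ (by simpa using hK ξ))
  rw [diffusionCoeff, smul_apply, ContinuousLinearMap.integral_apply hi]
  simp

/-- The algebraic core. Unbiasedness turns the covariance term into `𝔼[A(G,G)] - A(V,V)` with `A =
D²v`, and the drift coefficient supplies the rest of `𝓛₁²v = A(V,V) + Dv(DV V)`. What results is the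
mismatch of the `h²` terms of a random step and of the flow. -/
theorem secondOrderOp_eq [FiniteDimensional ℝ E] (hU : IsOpen U) (hV : DifferentiableOn ℝ V U)
    (hv : DerivBound U 1 M v) {x : E} (hx : x ∈ U) (hm : Measurable fun ξ => G ξ x)
    (hK : ∀ ξ, ‖G ξ x‖ ≤ K) (hGV : ∫ ξ, G ξ x ∂μ = V x) :
    secondOrderOp (driftCoeff V) (diffusionCoeff μ G V) v x =
      1 / 2 * (∫ ξ, fderiv ℝ (fderiv ℝ v) x (G ξ x) (G ξ x) ∂μ)
        - 1 / 2 * transportOp V (transportOp V v) x := by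
  have hgi : Integrable (fun ξ => G ξ x) μ :=
    Integrable.of_bound hm.aestronglyMeasurable K (ae_of_all _ hK)
  rw [secondOrderOp, diffusionCoeff_apply hm hK, transportOp_transportOp hU hV hv hx]
  set A := fderiv ℝ (fderiv ℝ v) x
  have h3 := integrable_bilin (μ := μ) hm hK A
  have h4 : Integrable (fun ξ => A (G ξ x) (V x)) μ := (A.flip (V x)).integrable_comp hgi
  have h5 : Integrable (fun ξ => A (V x) (G ξ x)) μ := (A (V x)).integrable_comp hgi
  have e : ∫ ξ, A (G ξ x - V x) (G ξ x - V x) ∂μ =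
      (∫ ξ, A (G ξ x) (G ξ x) ∂μ) - A (V x) (V x) := by
    have e1 : (fun ξ => A (G ξ x - V x) (G ξ x - V x)) = fun ξ =>
        A (G ξ x) (G ξ x) - A (G ξ x) (V x) - A (V x) (G ξ x) + A (V x) (V x) := by
      funext ξ
      simp only [map_sub, sub_apply]
      ring
    have h6 : Integrable (fun ξ => A (G ξ x) (G ξ x) - A (G ξ x) (V x)) μ := h3.sub h4
    have h7 : Integrable (fun ξ => A (G ξ x) (G ξ x) - A (G ξ x) (V x) - A (V x) (G ξ x)) μ :=
      h6.sub h5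
    have e2 : ∫ ξ, A (G ξ x) (V x) ∂μ = A (V x) (V x) := by
      rw [← hGV]; exact (A.flip _).integral_comp_comm hgi
    have e3 : ∫ ξ, A (V x) (G ξ x) ∂μ = A (V x) (V x) := by
      rw [(A (V x)).integral_comp_comm hgi, hGV]
    rw [e1, integral_add h7 (integrable_const _), integral_sub h6 h5,
      integral_sub h3 h4, e2, e3]
    simp
  rw [e]
  simp [driftCoeff]
  ring

end Coefficients

theorem IsDissipative.mono {E : Type} [NormedAddCommGroup E] [InnerProductSpace ℝ E] {R γ K : ℝ}
    {V : E → E} {k l : ℕ} (hV : IsDissipative R γ K k V) (h : l ≤ k) : IsDissipative R γ K l V :=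
  ⟨hV.gamma_pos, hV.gamma_le, hV.ckBound.mono (by omega) le_rfl, hV.zero, hV.monotone⟩

/-! ### Regularity and decay of the leading coefficient -/

section Expansion

variable {E : Type} [NormedAddCommGroup E] [InnerProductSpace ℝ E] [FiniteDimensional ℝ E]
  {R γ K M N : ℝ} {V : E → E} {Φ : E → ℝ → E} {φ : E → ℝ}
  {a : E → (E →L[ℝ] ℝ) →L[ℝ] ℝ} {T : E → (E →L[ℝ] E →L[ℝ] ℝ) →L[ℝ] ℝ}

theorem exp_neg_mul_le_one {c t : ℝ} (hc : 0 ≤ c) (ht : 0 ≤ t) : Real.exp (-c * t) ≤ 1 :=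
  Real.exp_le_one_iff.2 (by nlinarith)

/-- The leading term `u₀ = φ ∘ Φ` of the expansion. -/
theorem IsDissipative.exists_derivBound_leading (hV : IsDissipative R γ K 5 V)
    (hΦ : IsSemiflow (ball (0 : E) R) V Φ) (hM : 0 ≤ M) (hφ : DerivBound (ball (0 : E) R) 5 M φ) :
    ∃ C, 0 ≤ C ∧ ∀ t, 0 ≤ t →
      DerivBound (ball (0 : E) R) 4 (C * Real.exp (-(γ / 4) * t)) (fun x => φ (Φ x t)) := by
  obtain ⟨C, hC, H⟩ := IsDissipative.exists_derivBound_comp_flow (E := E) (F := ℝ) hV.gamma_pos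
    hV.K_pos.le 4
  exact ⟨C * M, by positivity, fun t ht => H hV hΦ hφ t ht⟩

theorem IsDissipative.solvesTransport_leading (hV : IsDissipative R γ K 5 V)
    (hΦ : IsSemiflow (ball (0 : E) R) V Φ) (hM : 0 ≤ M) (hφ : DerivBound (ball (0 : E) R) 5 M φ) :
    SolvesTransport (ball (0 : E) R) V (fun _ _ => 0) (fun x t => φ (Φ x t)) := by
  obtain ⟨C, hC, H⟩ := hV.exists_derivBound_leading hΦ hM hφ
  refine SolvesTransport.of_derivBound (M := C) isOpen_ball (convex_ball _ _)
    hV.ckBound.continuousOn continuousOn_const (fun t ht => (H t ht).mono (by omega) ?_)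
    fun x hx t ht => ?_
  · exact mul_le_of_le_one_right hC
      (exp_neg_mul_le_one (by linarith [hV.gamma_pos]) ht)
  · rw [hΦ.transportOp_comp isOpen_ball hφ.1 ht (H t ht).1 hx, add_zero]
    exact (hΦ.hasDerivAt_comp isOpen_ball hφ.1 hx ht).hasDerivWithinAt

omit [FiniteDimensional ℝ E] in
theorem SolvesTransport.continuousOn_time {U : Set E} {g v : E → ℝ → ℝ}
    (hv : SolvesTransport U V g v) {x : E} (hx : x ∈ U) : ContinuousOn (v x) (Ici 0) :=
  fun t ht => (hv.equation x hx t ht).continuousWithinAt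

theorem SolvesTransport.continuousOn_fderiv {U : Set E} (hU : IsOpen U) (hc : Convex ℝ U)
    {g v : E → ℝ → ℝ} (hv : SolvesTransport U V g v) {k : ℕ} (hk : 1 ≤ k)
    (hd : ∀ t, 0 ≤ t → DerivBound U k M (fun x => v x t)) :
    ContinuousOn (fun p : E × ℝ => fderiv ℝ (fun y => v y p.2) p.1) (U ×ˢ Ici 0) :=
  continuousOn_uncurry_of_derivBound (v := fun x t => fderiv ℝ (fun y => v y t) x) (k := 0)
    hU hc (fun t ht => ((hd t ht).mono hk le_rfl).2.derivBound hU)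
    (continuousOn_fderiv_of_derivBound hU (fun t ht => (hd t ht).mono hk le_rfl)
      fun _ hx => hv.continuousOn_time hx)

set_option maxSynthPendingDepth 5 in
theorem SolvesTransport.continuousOn_secondOrderOp {U : Set E} (hU : IsOpen U) (hc : Convex ℝ U)
    {g v : E → ℝ → ℝ} (hv : SolvesTransport U V g v) (ha : ContinuousOn a U)
    (hT : ContinuousOn T U) (hd : ∀ t, 0 ≤ t → DerivBound U 2 M (fun x => v x t)) :
    ContinuousOn (fun p : E × ℝ => secondOrderOp a T (fun y => v y p.2) p.1) (U ×ˢ Ici 0) := by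
  have h1 := hv.continuousOn_fderiv hU hc one_le_two hd
  have h2 : ∀ x ∈ U, ContinuousOn (fun t => fderiv ℝ (fun y => v y t) x) (Ici 0) :=
    fun x hx => h1.comp (f := fun t : ℝ => (x, t)) (by fun_prop) fun t ht => ⟨hx, ht⟩
  have h3 : ∀ t ∈ Ici (0 : ℝ), DerivBound U 1 M (fun x => fderiv ℝ (fun y => v y t) x) :=
    fun t ht => (hd t ht).2.derivBound hU
  have h4 : ContinuousOn (fun p : E × ℝ => fderiv ℝ (fderiv ℝ (fun y => v y p.2)) p.1)
      (U ×ˢ Ici 0) :=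
    continuousOn_uncurry_of_derivBound
      (v := fun x t => fderiv ℝ (fderiv ℝ (fun y => v y t)) x) (k := 0) hU hc
      (fun t ht => (h3 t ht).2.derivBound hU) (continuousOn_fderiv_of_derivBound hU h3 h2)
  have hfst : ContinuousOn (fun p : E × ℝ => p.1) (U ×ˢ Ici 0) := continuousOn_fst
  exact ((ha.comp hfst fun p hp => hp.1).clm_apply h1).add
    ((hT.comp hfst fun p hp => hp.1).clm_apply h4)

/-- Time increments of a solution of the homogeneous transport equation. -/
theorem SolvesTransport.derivBound_sub {U : Set E} (hU : IsOpen U) (hc : Convex ℝ U)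
    {v : E → ℝ → ℝ} {k : ℕ} {C c : ℝ} (hC : 0 ≤ C) (hc0 : 0 ≤ c) (hK : 0 ≤ K)
    (hV : CkBound U (k + 2) K V) (hv : SolvesTransport U V (fun _ _ => 0) v)
    (hd : ∀ t, 0 ≤ t → DerivBound U (k + 2) (C * Real.exp (-c * t)) (fun x => v x t))
    {s t : ℝ} (hs : 0 ≤ s) (ht : 0 ≤ t) :
    CkBound U (k + 2) (2 ^ (k + 2) * C * K * Real.exp (-c * t) * s)
      (fun x => v x (t + s) - v x t) := by
  have hd' : ∀ t, 0 ≤ t → DerivBound U (k + 2) C (fun x => v x t) := fun t ht =>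
    (hd t ht).mono le_rfl (mul_le_of_le_one_right hC (exp_neg_mul_le_one hc0 ht))
  have hct : ContinuousOn (fun p : E × ℝ => transportOp V (fun y => v y p.2) p.1) (U ×ˢ Ici 0) :=
    ((hv.continuousOn_fderiv hU hc (by omega) hd').clm_apply
      (hV.continuousOn.comp continuousOn_fst fun p hp => hp.1)).neg
  -- The increment is the integral of `𝓛₁v` over `(t, t + s]`. Replacing `r` by `max r t` keeps the
  -- decay factor `e^{-ct}` available for all real `r`.
  have hmax : ∀ r, 0 ≤ max r t := fun r => ht.trans (le_max_right _ _)
  have hb : ∀ r, CkBound U (k + 2) (2 ^ (k + 2) * C * K * Real.exp (-c * t))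
      (transportOp V (fun y => v y (max r t))) := fun r => by
    refine ((hd _ (hmax r)).ckBound_transportOp hU (by positivity) hK hV).mono le_rfl ?_
    have : Real.exp (-c * max r t) ≤ Real.exp (-c * t) := by
      apply Real.exp_le_exp.2
      nlinarith [le_max_right r t]
    calc _ ≤ 2 ^ (k + 2) * (C * Real.exp (-c * t)) * K := by gcongr
      _ = _ := by ring
  have hcr : ∀ x ∈ U, Continuous fun r : ℝ => transportOp V (fun y => v y (max r t)) x :=
    fun x hx => hct.comp_continuous (f := fun r : ℝ => (x, max r t)) (by fun_prop)
      fun r => ⟨hx, hmax r⟩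
  have h1 := CkBound.integral (ν := volume.restrict (Ioc t (t + s))) hU hb
    fun x hx => (hcr x hx).aestronglyMeasurable
  rw [measureReal_restrict_apply_univ, Real.volume_real_Ioc, add_sub_cancel_left,
    max_eq_left hs] at h1
  refine h1.congr hU fun x hx => ?_
  have h2 := (hasDerivWithinAt_Ici_of_right (p := v x)
    (r := fun t => transportOp V (fun y => v y t) x) (hv.continuousOn_time hx)
    (hct.comp (f := fun t : ℝ => (x, t)) (by fun_prop) fun t ht => ⟨hx, ht⟩)
    (fun r hr => by
      have := hv.equation x hx r hr
      rw [add_zero] at this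
      exact this.mono fun y hy => hr.trans hy.le)).2 t (t + s) ht (by linarith)
  simp only
  rw [← h2, intervalIntegral.integral_of_le (by linarith)]
  exact setIntegral_congr_fun measurableSet_Ioc fun r hr => by simp only [max_eq_left hr.1.le]

end Expansion

/-! ### Bounds for the expansion and the local error -/

section LocalError

variable {E : Type} [NormedAddCommGroup E] [InnerProductSpace ℝ E]
  [MeasurableSpace E] [BorelSpace E] {Ξ : Type*} [MeasurableSpace Ξ]

/-- The random fields `G ξ` are uniformly bounded in `C^6(B(0, R))` and are unbiased estimates of
the dissipative field `V`. -/
structure IsUnbiasedField (μ : Measure Ξ) (R γ K : ℝ) (G : Ξ → E → E) (V : E → E) : Prop where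
  dissipative : IsDissipative R γ K 5 V
  ckBound : ∀ ξ, CkBound (ball (0 : E) R) 6 K (G ξ)
  measurable : ∀ x, Measurable fun ξ => G ξ x
  integral_eq : ∀ x ∈ ball (0 : E) R, ∫ ξ, G ξ x ∂μ = V x

/-- The source term of the equation for the second coefficient of the expansion. -/
noncomputable def expansionSource (μ : Measure Ξ) (G : Ξ → E → E) (V : E → E) (Φ : E → ℝ → E)
    (φ : E → ℝ) (x : E) (t : ℝ) : ℝ :=
  secondOrderOp (driftCoeff V) (diffusionCoeff μ G V) (fun y => φ (Φ y t)) x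

/-- Bounds for the first two coefficients of the expansion. -/
structure ExpansionBounds (μ : Measure Ξ) (R γ K : ℝ) (G : Ξ → E → E) (V : E → E)
    (Φ : E → ℝ → E) (φ : E → ℝ) (C : ℝ) : Prop where
  nonneg : 0 ≤ C
  leading_le : ∀ x ∈ ball (0 : E) R, ‖φ x‖ ≤ C
  leading : ∀ t, 0 ≤ t → DerivBound (ball (0 : E) R) 4 (C * Real.exp (-(γ / 4) * t))
    (fun x => φ (Φ x t))
  source : ∀ t, 0 ≤ t → CkBound (ball (0 : E) R) 3 (C * Real.exp (-(γ / 4) * t))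
    (fun x => expansionSource μ G V Φ φ x t)
  source_continuous : ContinuousOn (fun p : E × ℝ => expansionSource μ G V Φ φ p.1 p.2)
    (ball (0 : E) R ×ˢ Ici 0)
  source_sub : ∀ x ∈ ball (0 : E) R, ∀ s t, 0 ≤ s → 0 ≤ t →
    ‖expansionSource μ G V Φ φ x (t + s) - expansionSource μ G V Φ φ x t‖
      ≤ C * Real.exp (-(γ / 4) * t) * s
  correction : ∀ t, 0 ≤ t → DerivBound (ball (0 : E) R) 1 (C * Real.exp (-(γ / 4) * t) * t)
    (fun x => duhamel Φ (expansionSource μ G V Φ φ) x t)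
  correction_solves : SolvesTransport (ball (0 : E) R) V (expansionSource μ G V Φ φ)
    (duhamel Φ (expansionSource μ G V Φ φ))

variable [FiniteDimensional ℝ E] {μ : Measure Ξ} [IsProbabilityMeasure μ] {R γ K M C : ℝ}
  {G : Ξ → E → E} {V : E → E} {Φ : E → ℝ → E} {φ : E → ℝ}

theorem mul_exp_neg_le {c t : ℝ} (hc : 0 < c) : t * Real.exp (-c * t) ≤ 1 / c := by
  have h1 := Real.add_one_le_exp (c * t)
  have h2 : Real.exp (-c * t) * Real.exp (c * t) = 1 := by rw [← Real.exp_add]; simp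
  rw [le_div_iff₀ hc]
  nlinarith [Real.exp_pos (-c * t)]

/-- The count of derivatives: six for `φ` and `V`, five for `u₀` after the limit in the flow
estimate, three for the source after a second order operator, two for `u₁` after another use of the
flow estimate. The local error needs three for `u₀` and two for `u₁`. -/
theorem IsUnbiasedField.exists_expansionBounds (hG : IsUnbiasedField μ R γ K G V)
    (hΦ : IsSemiflow (ball (0 : E) R) V Φ) (hM : 0 ≤ M) (hφ : CkBound (ball (0 : E) R) 6 M φ) :
    ∃ C, ExpansionBounds μ R γ K G V Φ φ C := by
  have hV := hG.dissipative
  have hK := hV.K_pos.le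
  have hγ := hV.gamma_pos
  have hc0 : 0 ≤ γ / 4 := by linarith
  have hc : Convex ℝ (ball (0 : E) R) := convex_ball _ _
  have hU : IsOpen (ball (0 : E) R) := isOpen_ball
  have hφ' := hφ.derivBound hU
  obtain ⟨C₁, hC₁, H₁⟩ := hV.exists_derivBound_leading hΦ hM hφ'
  obtain ⟨N₁, hN₁, ha⟩ := exists_ckBound_driftCoeff hU hK hV.ckBound
  obtain ⟨N₂, hN₂, hT⟩ := exists_ckBound_diffusionCoeff (μ := μ) hU hK hV.ckBound hG.ckBound
    fun x _ => hG.measurable x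
  have ha' : CkBound (ball (0 : E) R) 3 (N₁ + N₂) (driftCoeff V) :=
    ha.mono (by norm_num) (by linarith)
  have hT' : CkBound (ball (0 : E) R) 3 (N₁ + N₂) (diffusionCoeff μ G V) :=
    hT.mono (by norm_num) (by linarith)
  have hN : 0 ≤ N₁ + N₂ := by positivity
  have hlead := hV.solvesTransport_leading hΦ hM hφ'
  set C₂ := 2 ^ 4 * (N₁ + N₂) * C₁ with hC₂
  have hC₂0 : 0 ≤ C₂ := by positivity
  have hsrc : ∀ t, 0 ≤ t → CkBound (ball (0 : E) R) 3 (C₂ * Real.exp (-(γ / 4) * t))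
      (fun x => expansionSource μ G V Φ φ x t) := fun t ht =>
    ((H₁ t ht).ckBound_secondOrderOp hU (by positivity) hN ha' hT').mono le_rfl
      (le_of_eq (by rw [hC₂]; ring))
  have hsrcc : ContinuousOn (fun p : E × ℝ => expansionSource μ G V Φ φ p.1 p.2)
      (ball (0 : E) R ×ˢ Ici 0) :=
    hlead.continuousOn_secondOrderOp hU hc ha'.continuousOn hT'.continuousOn (M := C₁)
      fun t ht => (H₁ t ht).mono (by norm_num)
        (mul_le_of_le_one_right hC₁ (exp_neg_mul_le_one hc0 ht))
  obtain ⟨C₃, hC₃, H₃⟩ := IsDissipative.exists_derivBound_duhamel (E := E) hγ hK 1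
  have hcor := H₃ (hV.mono (by norm_num)) hΦ hsrc hsrcc
  have hcor' : SolvesTransport (ball (0 : E) R) V (expansionSource μ G V Φ φ)
      (duhamel Φ (expansionSource μ G V Φ φ)) := by
    have hd : ∀ t, 0 ≤ t → DerivBound (ball (0 : E) R) 1 (C₃ * C₂ * (1 / (γ / 4)))
        (fun x => duhamel Φ (expansionSource μ G V Φ φ) x t) := fun t ht => by
      refine (hcor t ht).mono le_rfl ?_
      rw [mul_assoc]
      gcongr
      rw [mul_comm]
      exact mul_exp_neg_le (by positivity)
    exact SolvesTransport.of_derivBound hU hc hV.ckBound.continuousOn hsrcc hd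
      fun x hx t ht => hΦ.hasDerivWithinAt_duhamel hU hsrcc hd hx ht
  set C₄ := 2 ^ 1 * (N₁ + N₂) * (2 ^ 4 * C₁ * K) with hC₄
  have hC₄0 : 0 ≤ C₄ := by positivity
  have hsub : ∀ x ∈ ball (0 : E) R, ∀ s t, 0 ≤ s → 0 ≤ t →
      ‖expansionSource μ G V Φ φ x (t + s) - expansionSource μ G V Φ φ x t‖
        ≤ C₄ * Real.exp (-(γ / 4) * t) * s := by
    intro x hx s t hs ht
    have h1 := hlead.derivBound_sub (k := 2) hU hc hC₁ hc0 hK (hV.ckBound.mono (by norm_num) le_rfl)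
      H₁ hs ht
    have h2 := ((h1.mono (k' := 2) (by norm_num) le_rfl).derivBound hU).ckBound_secondOrderOp
      (k := 0) hU (by positivity) hN (ha'.mono (by norm_num) le_rfl)
      (hT'.mono (by norm_num) le_rfl)
    have h3 := secondOrderOp_sub (a := driftCoeff V) (T := diffusionCoeff μ G V) hU
      ((H₁ (t + s) (by linarith)).mono (k' := 1) (by norm_num) le_rfl)
      ((H₁ t ht).mono (k' := 1) (by norm_num) le_rfl) hx
    have h4 := h2.norm_le hx
    rw [h3] at h4
    exact h4.trans (le_of_eq (by rw [hC₄]; ring))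
  refine ⟨M + C₁ + C₂ + C₃ * C₂ + C₄, by positivity, fun x hx => (hφ.norm_le hx).trans ?_,
    fun t ht => (H₁ t ht).mono le_rfl ?_, fun t ht => (hsrc t ht).mono le_rfl ?_, hsrcc,
    fun x hx s t hs ht => (hsub x hx s t hs ht).trans ?_,
    fun t ht => (hcor t ht).mono le_rfl ?_, hcor'⟩
  · have : 0 ≤ C₃ * C₂ := by positivity
    linarith
  all_goals
    have : 0 ≤ C₃ * C₂ := by positivity
    gcongr
    linarith

omit [MeasurableSpace E] [BorelSpace E] [FiniteDimensional ℝ E] in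
theorem IsSemiflow.norm_sub_le {U : Set E} (hΦ : IsSemiflow U V Φ) (hVK : ∀ y ∈ U, ‖V y‖ ≤ K)
    {x : E} (hx : x ∈ U) {h : ℝ} (hh : 0 ≤ h) : ‖Φ x h - x‖ ≤ K * h := by
  have := norm_sub_le_of_hasDerivAt (p := Φ x) hh (fun s hs => hΦ.deriv x hx s hs.1)
    (C := K) fun s hs => by rw [norm_neg]; exact hVK _ (hΦ.mem x hx s hs.1)
  rwa [hΦ.zero x hx] at this

namespace ExpansionBounds

omit [MeasurableSpace E] [BorelSpace E] [FiniteDimensional ℝ E] [IsProbabilityMeasure μ] in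
theorem norm_correction_le (hγ : 0 ≤ γ) (hC : ExpansionBounds μ R γ K G V Φ φ C)
    (hΦ : IsSemiflow (ball (0 : E) R) V Φ) {x : E} (hx : x ∈ ball (0 : E) R) {t : ℝ} (ht : 0 ≤ t) :
    ‖duhamel Φ (expansionSource μ G V Φ φ) x t‖ ≤ C * t := by
  have := intervalIntegral.norm_integral_le_of_norm_le_const (a := 0) (b := t) (C := C)
    (f := fun s => expansionSource μ G V Φ φ (Φ x (t - s)) s) fun s hs => by
      rw [uIoc_of_le ht] at hs
      refine ((hC.source s hs.1.le).norm_le (hΦ.mem x hx (t - s) (by linarith [hs.2]))).trans ?_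
      exact mul_le_of_le_one_right hC.nonneg (exp_neg_mul_le_one (by linarith) hs.1.le)
  rwa [sub_zero, abs_of_nonneg ht] at this

-- The source is Lipschitz in space and in time with constants of order `e^{-ct}`, and over a step
-- both arguments move by `O(h)`.
omit [BorelSpace E] [FiniteDimensional ℝ E] [IsProbabilityMeasure μ] in
theorem norm_integral_source_sub_le (hC : ExpansionBounds μ R γ K G V Φ φ C)
    (hG : IsUnbiasedField μ R γ K G V)
    (hΦ : IsSemiflow (ball (0 : E) R) V Φ) {x : E} (hx : x ∈ ball (0 : E) R) {t h : ℝ}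
    (ht : 0 ≤ t) (hh : 0 ≤ h) :
    ‖(∫ r in (0 : ℝ)..h, expansionSource μ G V Φ φ (Φ x (h - r)) (t + r))
      - h * expansionSource μ G V Φ φ x t‖
      ≤ C * Real.exp (-(γ / 4) * t) * (1 + K) * h ^ 2 := by
  set w := expansionSource μ G V Φ φ
  have hC0 := hC.nonneg
  have hw' : ContinuousOn (fun p : E × ℝ => w p.1 (t + p.2)) (ball (0 : E) R ×ˢ Ici 0) :=
    hC.source_continuous.comp (f := fun p : E × ℝ => (p.1, t + p.2)) (by fun_prop)
      fun p hp => ⟨hp.1, add_nonneg ht hp.2⟩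
  have hi := hΦ.intervalIntegrable_duhamel (w := fun x r => w x (t + r)) hw' hx le_rfl hh le_rfl
  have e : (∫ r in (0 : ℝ)..h, w (Φ x (h - r)) (t + r)) - h * w x t
      = ∫ r in (0 : ℝ)..h, (w (Φ x (h - r)) (t + r) - w x t) := by
    rw [intervalIntegral.integral_sub hi (by simp)]
    simp
  rw [e]
  have := intervalIntegral.norm_integral_le_of_norm_le_const (a := 0) (b := h)
    (C := C * Real.exp (-(γ / 4) * t) * (1 + K) * h)
    (f := fun r => w (Φ x (h - r)) (t + r) - w x t) fun r hr => by
      rw [uIoc_of_le hh] at hr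
      have hr' : 0 ≤ h - r := by linarith [hr.2]
      have hy := hΦ.mem x hx (h - r) hr'
      have h1 := hC.source_sub _ hy r t hr.1.le ht
      have h2 := ((hC.source t ht).derivBound isOpen_ball).norm_sub_le isOpen_ball
        (convex_ball _ _) hx hy
      have h3 := hΦ.norm_sub_le (fun y hy => hG.dissipative.ckBound.norm_le hy) hx hr'
      have hK := hG.dissipative.K_pos.le
      calc _ ≤ ‖w (Φ x (h - r)) (t + r) - w (Φ x (h - r)) t‖ + ‖w (Φ x (h - r)) t - w x t‖ :=
            norm_sub_le_norm_sub_add_norm_sub _ _ _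
        _ ≤ C * Real.exp (-(γ / 4) * t) * r
            + C * Real.exp (-(γ / 4) * t) * (K * (h - r)) :=
          add_le_add h1 (h2.trans (by gcongr))
        _ ≤ C * Real.exp (-(γ / 4) * t) * h + C * Real.exp (-(γ / 4) * t) * (K * h) := by
            gcongr
            · exact hr.2
            · linarith [hr.1]
        _ = _ := by ring
  rw [sub_zero, abs_of_nonneg hh] at this
  exact this.trans (le_of_eq (by ring))

theorem norm_local_error_le (hC : ExpansionBounds μ R γ K G V Φ φ C)
    (hG : IsUnbiasedField μ R γ K G V)
    (hΦ : IsSemiflow (ball (0 : E) R) V Φ) {x : E} (hx : x ∈ ball (0 : E) R) {t h : ℝ}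
    (ht : 0 ≤ t) (hh : 0 ≤ h) (hstep : ∀ ξ, x - h • G ξ x ∈ ball (0 : E) R) :
    ‖(∫ ξ, (φ (Φ (x - h • G ξ x) t)
        + h * duhamel Φ (expansionSource μ G V Φ φ) (x - h • G ξ x) t) ∂μ)
      - (φ (Φ x (t + h)) + h * duhamel Φ (expansionSource μ G V Φ φ) x (t + h))‖
      ≤ C * (9 * K ^ 3 + 3 * K ^ 2 + 1 + K) * h ^ 3 * (Real.exp (-(γ / 4) * t) * (1 + t)) := by
  have hV := hG.dissipative
  have hK := hV.K_pos.le
  have hC0 := hC.nonneg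
  have hU : IsOpen (ball (0 : E) R) := isOpen_ball
  have hc : Convex ℝ (ball (0 : E) R) := convex_ball _ _
  set w := expansionSource μ G V Φ φ with hw
  set D := C * Real.exp (-(γ / 4) * t) with hD
  have hD0 : 0 ≤ D := by positivity
  have hlead := (hC.leading t ht).mono (k' := 2) (by norm_num) le_rfl
  have hcor := hC.correction t ht
  have hleadb : ∀ y ∈ ball (0 : E) R, ‖φ (Φ y t)‖ ≤ C := fun y hy =>
    hC.leading_le _ (hΦ.mem y hy t ht)
  have hcorb : ∀ y ∈ ball (0 : E) R, ‖duhamel Φ w y t‖ ≤ C * t := fun y hy =>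
    hC.norm_correction_le hV.gamma_pos.le hΦ hy ht
  have hGb : ∀ ξ, ‖G ξ x‖ ≤ K := fun ξ => (hG.ckBound ξ).norm_le hx
  have hm := hG.measurable x
  have hGV := hG.integral_eq x hx
  have a1 := hlead.integral_step_two (μ := μ) hU hc hD0 hleadb hm hGb hx hGV hh hstep
  have a2 := hΦ.taylor_two hU hD0 hK (hV.ckBound.mono (by norm_num) le_rfl) hlead hx hh
  have a3 : w x t = _ := secondOrderOp_eq (μ := μ) hU hV.derivBound.1
    (hlead.mono (by norm_num) le_rfl) hx hm hGb hGV
  have b1 := hcor.integral_step_one (μ := μ) hU hc (by positivity) hcorb hm hGb hx hGV hh hstep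
  have b2 := hΦ.taylor_one hU (by positivity) hK (hV.ckBound.mono (by norm_num) le_rfl) hcor hx hh
  have c1 := hC.norm_integral_source_sub_le hG hΦ hx ht hh
  have c2 := hΦ.duhamel_add hC.source_continuous hx hh ht
  have c3 : φ (Φ x (t + h)) = φ (Φ (Φ x h) t) := by rw [← hΦ.add x hx h t hh ht, add_comm]
  rw [integral_add (integrable_comp_step hlead.1.continuousOn hleadb hm hstep)
    ((integrable_comp_step hcor.1.continuousOn hcorb hm hstep).const_mul h),
    integral_const_mul, c3, c2]
  rw [← hw, ← hD] at c1
  set I := ∫ r in (0 : ℝ)..h, w (Φ x (h - r)) (t + r)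
  set S := ∫ ξ, φ (Φ (x - h • G ξ x) t) ∂μ
  set S' := ∫ ξ, duhamel Φ w (x - h • G ξ x) t ∂μ
  set Q := ∫ ξ, fderiv ℝ (fderiv ℝ fun x => φ (Φ x t)) x (G ξ x) (G ξ x) ∂μ
  set P₁ := transportOp V (fun x => φ (Φ x t)) x
  set P₂ := transportOp V (transportOp V fun x => φ (Φ x t)) x
  set P₃ := transportOp V (fun x => duhamel Φ w x t) x
  rw [Real.norm_eq_abs] at a1 a2 b1 b2 c1 ⊢
  -- The first order terms `P₁` and `P₃` cancel between the random step and the flow. The second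
  -- order terms of `u₀` leave `(h²/2)(Q - P₂)`, which by `a3` is `h² w x t`, the main part of `h
  -- I`. Five remainders of order `h³` are left.
  have e : S + h * S' - (φ (Φ (Φ x h) t) + h * (duhamel Φ w (Φ x h) t + I)) =
      (S - φ (Φ x t) - h * P₁ - h ^ 2 / 2 * Q)
      - (φ (Φ (Φ x h) t) - φ (Φ x t) - h * P₁ - h ^ 2 / 2 * P₂)
      + h * (S' - duhamel Φ w x t - h * P₃) - h * (duhamel Φ w (Φ x h) t - duhamel Φ w x t - h * P₃)
      - h * (I - h * w x t) := by
    rw [a3]; ring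
  rw [e]
  have t1 := abs_le.1 a1
  have t2 := abs_le.1 a2
  have t3 : |h * (S' - duhamel Φ w x t - h * P₃)| ≤ h * (D * t * K ^ 2 * h ^ 2) := by
    rw [abs_mul, abs_of_nonneg hh]; gcongr
  have t4 : |h * (duhamel Φ w (Φ x h) t - duhamel Φ w x t - h * P₃)|
      ≤ h * (2 * (D * t) * K ^ 2 * h ^ 2) := by
    rw [abs_mul, abs_of_nonneg hh]; gcongr
  have t5 : |h * (I - h * w x t)| ≤ h * (D * (1 + K) * h ^ 2) := by
    rw [abs_mul, abs_of_nonneg hh]; gcongr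
  have t3' := abs_le.1 t3
  have t4' := abs_le.1 t4
  have t5' := abs_le.1 t5
  -- The factor `1 + t` accounts for the correction, whose derivatives are bounded by `D t` instead
  -- of `D`.
  have bound : D * K ^ 3 * h ^ 3 + 8 * D * K ^ 3 * h ^ 3 + h * (D * t * K ^ 2 * h ^ 2)
      + h * (2 * (D * t) * K ^ 2 * h ^ 2) + h * (D * (1 + K) * h ^ 2)
      ≤ C * (9 * K ^ 3 + 3 * K ^ 2 + 1 + K) * h ^ 3 * (Real.exp (-(γ / 4) * t) * (1 + t)) := by
    have e1 : C * (9 * K ^ 3 + 3 * K ^ 2 + 1 + K) * h ^ 3 * (Real.exp (-(γ / 4) * t) * (1 + t))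
        = D * h ^ 3 * ((9 * K ^ 3 + 3 * K ^ 2 + 1 + K) * (1 + t)) := by rw [hD]; ring
    rw [e1]
    calc _ = D * h ^ 3 * (9 * K ^ 3 + 3 * K ^ 2 * t + (1 + K)) := by ring
      _ ≤ _ := by
        gcongr
        have : 0 ≤ (9 * K ^ 3 + (1 + K)) * t := by positivity
        have : 0 ≤ 3 * K ^ 2 := by positivity
        linarith
  rw [abs_le]
  constructor <;> linarith [t1.1, t1.2, t2.1, t2.2, t3'.1, t3'.2, t4'.1, t4'.2, t5'.1, t5'.2]

end ExpansionBounds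

end LocalError

/-! ### Gradients and strong convexity -/

section Gradient

variable {E : Type} [NormedAddCommGroup E] [InnerProductSpace ℝ E] [CompleteSpace E]
  {U : Set E} {k : ℕ} {M γ : ℝ} {f : E → ℝ}

variable (E) in
/-- The Riesz isomorphism from the dual of a real Hilbert space, as a continuous linear map. -/
noncomputable def dualToVector : (E →L[ℝ] ℝ) →L[ℝ] E :=
  LinearMap.mkContinuous
    { toFun := (InnerProductSpace.toDual ℝ E).symm
      map_add' := map_add _
      map_smul' := fun c ℓ => by simp } 1 fun ℓ => by simp

@[simp]
theorem dualToVector_fderiv (f : E → ℝ) (x : E) : dualToVector E (fderiv ℝ f x) = gradient f x :=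
  rfl

theorem norm_dualToVector_le : ‖dualToVector E‖ ≤ 1 :=
  LinearMap.mkContinuous_norm_le _ zero_le_one _

theorem inner_gradient (f : E → ℝ) (x y : E) : ⟪gradient f x, y⟫_ℝ = fderiv ℝ f x y :=
  InnerProductSpace.toDual_symm_apply

theorem CkBound.gradient (hU : IsOpen U) (hM : 0 ≤ M) (hf : CkBound U (k + 1) M f) :
    CkBound U k M (gradient f) := by
  have h1 := (hf.derivBound hU).2.clm_comp (dualToVector E) hU
  exact h1.mono le_rfl (mul_le_of_le_one_left hM norm_dualToVector_le)

theorem ContDiff.gradient {n : ℕ} (hf : ContDiff ℝ (n + 1 : ℕ) f) : ContDiff ℝ n (gradient f) :=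
  (dualToVector E).contDiff.comp (hf.fderiv_right le_rfl)

-- On the line through `y` and `x`, the slope of the chord lies between the derivatives at the two
-- ends.
omit [CompleteSpace E] in
theorem ConvexOn.fderiv_sub_apply_nonneg {g : E → ℝ} (hg : ConvexOn ℝ U g) {x y : E} (hx : x ∈ U)
    (hy : y ∈ U) {g' : E → E →L[ℝ] ℝ} (hd : ∀ z ∈ U, HasFDerivAt g (g' z) z) :
    0 ≤ (g' x - g' y) (x - y) := by
  have h1 := hg.comp_affineMap (AffineMap.lineMap y x : ℝ →ᵃ[ℝ] E)
  have h2 : ∀ t : ℝ, AffineMap.lineMap y x t ∈ U →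
      HasDerivAt (g ∘ (AffineMap.lineMap y x : ℝ →ᵃ[ℝ] E)) (g' (AffineMap.lineMap y x t) (x - y)) t :=
    fun t ht => (hd _ ht).comp_hasDerivAt t AffineMap.hasDerivAt_lineMap
  have h3 := h2 0 (by simpa using hy)
  have h4 := h2 1 (by simpa using hx)
  have h5 := h1.le_slope_of_hasDerivAt (x := 0) (y := 1) (by simpa using hy) (by simpa using hx)
    zero_lt_one h3
  have h6 := h1.slope_le_of_hasDerivAt (x := 0) (y := 1) (by simpa using hy) (by simpa using hx)
    zero_lt_one h4
  simpa using h5.trans h6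

/-- The gradient of a strongly convex function is strongly monotone. -/
theorem StrongConvexOn.inner_gradient_sub (hf : StrongConvexOn U γ f) (hd : Differentiable ℝ f)
    {x y : E} (hx : x ∈ U) (hy : y ∈ U) :
    γ * ‖x - y‖ ^ 2 ≤ ⟪gradient f x - gradient f y, x - y⟫_ℝ := by
  have h1 := strongConvexOn_iff_convex.1 hf
  have h2 := h1.fderiv_sub_apply_nonneg hx hy
    (g' := fun z => fderiv ℝ f z - (γ / 2) • ((2 : ℝ) • innerSL ℝ z)) fun z _ =>
      (hd z).hasFDerivAt.sub (((hasStrictFDerivAt_norm_sq z).hasFDerivAt.congr_fderiv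
        (by ext; simp)).const_mul (γ / 2))
  rw [inner_sub_left, inner_gradient, inner_gradient]
  rw [← real_inner_self_eq_norm_sq]
  nth_rw 1 [inner_sub_left]
  simp only [sub_apply, smul_apply, innerSL_apply_apply, smul_eq_mul] at h2
  linarith

/-- Differentiating `‖∇f‖²` puts the Hessian on the direction `∇v`; its symmetry moves it to `∇f`.
The factor 2 turns the `-1/4` of `𝓛₂` into the `-1/2` of `driftCoeff`. -/
theorem inner_gradient_norm_sq_gradient {v : E → ℝ} {x : E} (hU : IsOpen U)
    (hf : DifferentiableOn ℝ f U)
    (hf' : DifferentiableOn ℝ (gradient f) U) (hx : x ∈ U) :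
    ⟪gradient (fun y => ‖gradient f y‖ ^ 2) x, gradient v x⟫_ℝ =
      2 * fderiv ℝ v x (fderiv ℝ (gradient f) x (gradient f x)) := by
  have h1 := ((hf' x hx).differentiableAt (hU.mem_nhds hx)).hasFDerivAt
  have h2 : HasFDerivAt (fderiv ℝ f) ((innerSL ℝ).comp (fderiv ℝ (gradient f) x)) x := by
    have e : fderiv ℝ f = fun y => innerSL ℝ (gradient f y) := by
      ext y z; simp
    rw [e]
    exact (innerSL ℝ (E := E)).hasFDerivAt.comp x h1
  have h3 := second_derivative_symmetric_of_eventually_of_real (f := f) (f' := fderiv ℝ f)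
    (by filter_upwards [hU.mem_nhds hx] with y hy
        exact ((hf y hy).differentiableAt (hU.mem_nhds hy)).hasFDerivAt) h2
  have h4 := h3 (gradient v x) (gradient f x)
  simp only [ContinuousLinearMap.comp_apply, innerSL_apply_apply] at h4
  rw [inner_gradient, h1.norm_sq.fderiv, ← inner_gradient v]
  simp only [smul_apply, ContinuousLinearMap.comp_apply, innerSL_apply_apply,
    real_inner_comm _ (gradient f x), h4]
  rw [real_inner_comm]; simp

end Gradient

/-! ### Identification with the operators of the statement -/

section Operators

variable {d : ℕ} {U : Set (SGD.E d)} {f v : SGD.E d → ℝ} {x : SGD.E d}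

theorem SGD.L1_eq_transportOp (f v : SGD.E d → ℝ) :
    SGD.L1 f v = transportOp (gradient f) v := by
  ext x
  rw [SGD.L1, transportOp, real_inner_comm, inner_gradient]

/-- The basis vectors occur in the order `j, i` so that the sum matches the trace of a matrix
product, with entries `Σ i j` and `H j i`; no symmetry of `A` is needed. -/
theorem EuclideanSpace.bilin_apply_self (A : SGD.E d →L[ℝ] SGD.E d →L[ℝ] ℝ) (a : SGD.E d) :
    A a a = ∑ i, ∑ j, a i * a j *
      A (EuclideanSpace.single j (1 : ℝ)) (EuclideanSpace.single i (1 : ℝ)) := by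
  have h := (EuclideanSpace.basisFun (Fin d) ℝ).sum_repr a
  simp only [EuclideanSpace.basisFun_repr, EuclideanSpace.basisFun_apply] at h
  conv_lhs => rw [← h]
  simp only [map_sum, map_smul, FunLike.coe_sum, Finset.sum_apply, FunLike.coe_smul,
    Pi.smul_apply, smul_eq_mul]
  refine Finset.sum_congr rfl fun i _ => ?_
  rw [Finset.mul_sum]
  exact Finset.sum_congr rfl fun j _ => by ring

variable {Ξ : Type*} [MeasurableSpace Ξ] {μ : Measure Ξ} [IsProbabilityMeasure μ]
  {F : Ξ → SGD.E d → ℝ} {K : ℝ}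

theorem trace_covMatrix_mul_hessMatrix (hm : Measurable fun ξ => gradient (F ξ) x)
    (hK : ∀ ξ, ‖gradient (F ξ) x‖ ≤ K) :
    (SGD.covMatrix μ F f x * SGD.hessMatrix v x).trace =
      ∫ ξ, fderiv ℝ (fderiv ℝ v) x (gradient (F ξ) x - gradient f x)
        (gradient (F ξ) x - gradient f x) ∂μ := by
  have hi : ∀ i j, Integrable (fun ξ => (gradient (F ξ) x - gradient f x) i *
      (gradient (F ξ) x - gradient f x) j) μ := fun i j => by
    have hb : ∀ i ξ, ‖(gradient (F ξ) x - gradient f x) i‖ ≤ K + ‖gradient f x‖ := fun i ξ =>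
      (PiLp.norm_apply_le _ i).trans ((norm_sub_le _ _).trans (by linarith [hK ξ]))
    have hm' : ∀ i, Measurable fun ξ => (gradient (F ξ) x - gradient f x) i := fun i =>
      (EuclideanSpace.proj (𝕜 := ℝ) i).continuous.measurable.comp (hm.sub_const _)
    refine Integrable.of_bound ((hm' i).mul (hm' j)).aestronglyMeasurable
      ((K + ‖gradient f x‖) * (K + ‖gradient f x‖)) (ae_of_all _ fun ξ => ?_)
    rw [norm_mul]
    exact mul_le_mul (hb i ξ) (hb j ξ) (norm_nonneg _) ((norm_nonneg _).trans (hb i ξ))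
  simp_rw [EuclideanSpace.bilin_apply_self (fderiv ℝ (fderiv ℝ v) x)]
  rw [integral_finsetSum _ fun i _ => integrable_finsetSum _ fun j _ => (hi i j).mul_const _]
  rw [Matrix.trace]
  refine Finset.sum_congr rfl fun i _ => ?_
  rw [integral_finsetSum _ fun j _ => (hi i j).mul_const _, Matrix.diag, Matrix.mul_apply]
  refine Finset.sum_congr rfl fun j _ => ?_
  rw [integral_mul_const]
  simp [SGD.covMatrix, SGD.hessMatrix, iteratedFDeriv_two_apply]

theorem SGD.L2_eq_secondOrderOp (hU : IsOpen U) (hf : DifferentiableOn ℝ f U)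
    (hf' : DifferentiableOn ℝ (gradient f) U) (hx : x ∈ U)
    (hm : Measurable fun ξ => gradient (F ξ) x) (hK : ∀ ξ, ‖gradient (F ξ) x‖ ≤ K) :
    SGD.L2 μ F f v x = secondOrderOp (driftCoeff (gradient f))
      (diffusionCoeff μ (fun ξ => gradient (F ξ)) (gradient f)) v x := by
  rw [SGD.L2, secondOrderOp, diffusionCoeff_apply (G := fun ξ => gradient (F ξ)) hm hK,
    trace_covMatrix_mul_hessMatrix hm hK, inner_gradient_norm_sq_gradient hU hf hf' hx]
  simp [driftCoeff]
  ring

end Operators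

/-! ### Invariance of the ball -/

section InvariantBall

variable {E : Type} [NormedAddCommGroup E] [InnerProductSpace ℝ E]

/-- A gradient step that is not too long maps the ball `B(0, R)` into itself. -/
theorem norm_sub_smul_lt {x g : E} {γ b L R η : ℝ} (hγ : 0 < γ) (hb : 0 < b) (hγL : γ ≤ L)
    (hη : 0 < η) (hη' : η * (b + L * R) ^ 2 ≤ 2 * R * (γ * R - b)) (hx : ‖x‖ < R)
    (h1 : γ * ‖x‖ ^ 2 - b * ‖x‖ ≤ ⟪g, x⟫_ℝ) (h2 : ‖g‖ ≤ b + L * ‖x‖) : ‖x - η • g‖ < R := by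
  have hr := norm_nonneg x
  set r := ‖x‖ with hr'
  have hR : 0 < R := hr.trans_lt hx
  -- This is the leading coefficient of `p(r) = r² - 2η(γr² - br) + η²(b + Lr)²`, the bound for `‖x
  -- - ηg‖²`. So `p` is convex on `[0, R]`, and its end values decide: `p(0) = (ηb)² < R²`, and
  -- `p(R) ≤ R²` is the threshold condition.
  have hA : 0 ≤ 1 - 2 * η * γ + η ^ 2 * L ^ 2 := by
    have : η ^ 2 * γ ^ 2 ≤ η ^ 2 * L ^ 2 := by gcongr
    nlinarith [sq_nonneg (1 - η * γ)]
  have hηb : η * b < R := by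
    have h3 : (b + γ * R) ^ 2 ≤ (b + L * R) ^ 2 := by gcongr
    have h4 : η * (b + γ * R) ^ 2 ≤ 2 * R * (γ * R - b) :=
      (mul_le_mul_of_nonneg_left h3 hη.le).trans hη'
    have h5 : η * b * (b + γ * R) ^ 2 < R * (b + γ * R) ^ 2 := by
      have h6 : η * (b + γ * R) ^ 2 * b ≤ 2 * R * (γ * R - b) * b := by gcongr
      have h7 : 0 < R * (3 * b ^ 2 + (γ * R) ^ 2) := by positivity
      linarith
    exact lt_of_mul_lt_mul_right h5 (by positivity)
  have h0 : (η * b) ^ 2 < R ^ 2 := by gcongr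
  have hRR : η * (η * (b + L * R) ^ 2) ≤ η * (2 * R * (γ * R - b)) := by gcongr
  have h3 : ‖x - η • g‖ ^ 2 ≤ r ^ 2 - 2 * η * (γ * r ^ 2 - b * r) + η ^ 2 * (b + L * r) ^ 2 := by
    rw [norm_sub_sq_real, norm_smul, inner_smul_right, real_inner_comm, mul_pow, Real.norm_eq_abs,
      sq_abs]
    have h4 : η * (γ * r ^ 2 - b * r) ≤ η * ⟪g, x⟫_ℝ := by gcongr
    have h5 : η ^ 2 * ‖g‖ ^ 2 ≤ η ^ 2 * (b + L * r) ^ 2 := by gcongr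
    linarith
  have h4 : (1 - 2 * η * γ + η ^ 2 * L ^ 2) * (r * (R - r)) ≥ 0 :=
    mul_nonneg hA (mul_nonneg hr (sub_nonneg.2 hx.le))
  -- Convexity in the form `R p(r) ≤ (R - r) p(0) + r p(R)`; the result is strict since `r < R`.
  have h5 : R * ‖x - η • g‖ ^ 2 < R * R ^ 2 := by
    have h6 : R * ‖x - η • g‖ ^ 2 ≤
        R * (r ^ 2 - 2 * η * (γ * r ^ 2 - b * r) + η ^ 2 * (b + L * r) ^ 2) := by gcongr
    have h7 : (R - r) * (η * b) ^ 2 < (R - r) * R ^ 2 :=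
      mul_lt_mul_of_pos_left h0 (sub_pos.2 hx)
    have h8 := mul_le_mul_of_nonneg_left hRR hr
    have h9 := mul_nonneg hR.le h4
    nlinarith
  exact lt_of_pow_lt_pow_left₀ 2 hR.le (lt_of_mul_lt_mul_left h5 hR.le)

end InvariantBall

/-! ### Consequences of the standing assumption -/

namespace SGD

variable {d : ℕ} {Ξ : Type*} [MeasurableSpace Ξ] {μ : Measure Ξ} {F : Ξ → E d → ℝ}
  {f φ : E d → ℝ} {γ b R₁ R L : ℝ}

theorem IsCkBall.exists_ckBound {I : Type*} [Nonempty I] {k : ℕ} {G : I → E d → ℝ} (hR : 0 < R)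
    (hG : IsCkBall k R G) : ∃ M, 0 ≤ M ∧ ∀ i, CkBound (ball (0 : E d) R) k M (G i) := by
  obtain ⟨h1, M, hM⟩ := hG
  exact ⟨M, (norm_nonneg _).trans (hM (Classical.arbitrary I) 0 (Nat.zero_le _) 0
    (mem_ball_self hR)), fun i => ⟨h1 i, hM i⟩⟩

namespace Assumption

theorem radius_pos_of_lt (hA : Assumption μ F f γ b R₁) (hR₀ : 16 * b / (3 * γ) < R) : 0 < R := by
  have := hA.gamma_pos
  have := hA.b_pos
  exact lt_of_le_of_lt (by positivity) hR₀

theorem differentiable (hA : Assumption μ F f γ b R₁) (ξ : Ξ) : Differentiable ℝ (F ξ) :=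
  (hA.contDiff ξ).differentiable (by norm_num)

theorem contDiff_gradient (hA : Assumption μ F f γ b R₁) (ξ : Ξ) :
    ContDiff ℝ 2 (gradient (F ξ)) :=
  ContDiff.gradient (n := 2) (hA.contDiff ξ)

theorem integral_gradient (hA : Assumption μ F f γ b R₁) (x : E d) :
    ∫ ξ, gradient (F ξ) x ∂μ = gradient f x := (hA.unbiased x).gradient.symm

theorem gradient_zero (hA : Assumption μ F f γ b R₁) : gradient f 0 = 0 := by
  rw [← dualToVector_fderiv, hA.isLocalMin.fderiv_eq_zero, map_zero]

theorem inner_gradient_sub (hA : Assumption μ F f γ b R₁) (ξ : Ξ) {x y : E d}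
    (hx : x ∈ ball (0 : E d) R₁) (hy : y ∈ ball (0 : E d) R₁) :
    γ * ‖x - y‖ ^ 2 ≤ ⟪gradient (F ξ) x - gradient (F ξ) y, x - y⟫_ℝ :=
  (hA.strongConvex ξ).inner_gradient_sub (hA.differentiable ξ) hx hy

/-- Bounds and monotonicity hold for each sample with constants independent of `ξ`, so they pass to
the expectation `∇f`. The constant `max M γ` also ensures `γ ≤ K`. -/
theorem exists_isUnbiasedField [IsProbabilityMeasure μ] (hA : Assumption μ F f γ b R₁)
    (hR : 0 < R) (hR₁ : R ≤ R₁) (hF : IsCkBall 7 R F) :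
    ∃ K, IsUnbiasedField μ R γ K (fun ξ => gradient (F ξ)) (gradient f) := by
  have : Nonempty Ξ := nonempty_of_isProbabilityMeasure μ
  obtain ⟨M, hM, hFM⟩ := hF.exists_ckBound hR
  have hG : ∀ ξ, CkBound (ball (0 : E d) R) 6 (max M γ) (gradient (F ξ)) := fun ξ =>
    ((hFM ξ).gradient isOpen_ball hM).mono le_rfl (le_max_left _ _)
  refine ⟨max M γ, ⟨hA.gamma_pos, le_max_right _ _, ?_, hA.gradient_zero, fun x hx y hy => ?_⟩,
    hG, hA.measurable_gradient, fun x _ => hA.integral_gradient x⟩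
  · refine ((CkBound.integral (ν := μ) isOpen_ball hG fun x _ =>
      (hA.measurable_gradient x).aestronglyMeasurable).congr isOpen_ball
      fun x _ => (hA.integral_gradient x).symm).mono le_rfl (by simp)
  · have hi : Integrable (fun ξ => gradient (F ξ) x - gradient (F ξ) y) μ :=
      (hA.integrable_gradient x).sub (hA.integrable_gradient y)
    rw [← hA.integral_gradient x, ← hA.integral_gradient y,
      ← integral_sub (hA.integrable_gradient x) (hA.integrable_gradient y), real_inner_comm,
      ← integral_inner hi]
    have h1 : ∫ _ξ, γ * ‖x - y‖ ^ 2 ∂μ = γ * ‖x - y‖ ^ 2 := by simp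
    rw [← h1]
    refine integral_mono (integrable_const _) (hi.const_inner _) fun ξ => ?_
    rw [real_inner_comm]
    exact hA.inner_gradient_sub ξ (ball_subset_ball hR₁ hx) (ball_subset_ball hR₁ hy)

/-- Stochastic gradient descent with a step size below the threshold stays in the ball. -/
theorem step_mem_ball (hA : Assumption μ F f γ b R₁) (hR₁ : R ≤ R₁)
    (hL : ∀ ξ, ∀ x ∈ ball (0 : E d) R, ‖fderiv ℝ (gradient (F ξ)) x‖ ≤ L) {η : ℝ} (hη : 0 < η)
    (hη' : η ≤ eta0 γ b L R) {x : E d} (hx : x ∈ ball (0 : E d) R) (ξ : Ξ) :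
    x - η • gradient (F ξ) x ∈ ball (0 : E d) R := by
  have hR : 0 < R := (dist_nonneg).trans_lt hx
  rcases subsingleton_or_nontrivial (E d) with h | h
  · rw [Subsingleton.elim (x - _) x]; exact hx
  have h0 := mem_ball_self (x := (0 : E d)) hR
  have hlip : ∀ y ∈ ball (0 : E d) R, ‖gradient (F ξ) y - gradient (F ξ) 0‖ ≤ L * ‖y‖ :=
    fun y hy => by
      have := (convex_ball (0 : E d) R).norm_image_sub_le_of_norm_fderiv_le
        (fun z _ => ((hA.contDiff_gradient ξ).differentiable (by norm_num)) z) (hL ξ) h0 hy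
      simpa using this
  have hmono : ∀ y ∈ ball (0 : E d) R,
      γ * ‖y‖ ^ 2 ≤ ⟪gradient (F ξ) y - gradient (F ξ) 0, y⟫_ℝ := fun y hy => by
    simpa using hA.inner_gradient_sub ξ (ball_subset_ball hR₁ hy) (ball_subset_ball hR₁ h0)
  have hγL : γ ≤ L := by
    -- Any nonzero point of the ball compares the monotonicity constant with the Lipschitz constant;
    -- in dimension zero there is none, which is why that case was removed above.
    obtain ⟨y, hy⟩ := exists_norm_eq (E d) (half_pos hR).le
    have hy' : y ∈ ball (0 : E d) R := by rw [mem_ball_zero_iff, hy]; linarith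
    have h1 := (hmono y hy').trans (real_inner_le_norm _ _)
    have h2 := mul_le_mul_of_nonneg_right (hlip y hy') (norm_nonneg y)
    have h3 : γ * ‖y‖ ^ 2 ≤ L * ‖y‖ ^ 2 := by linarith
    exact le_of_mul_le_mul_right h3 (by rw [hy]; positivity)
  have hb := hA.gradient_zero_le ξ
  rw [mem_ball_zero_iff] at hx ⊢
  refine norm_sub_smul_lt hA.gamma_pos hA.b_pos hγL hη ?_ hx ?_ ?_
  · have : 0 < b + L * R := by
      have := hA.gamma_pos.trans_le hγL
      have := hA.b_pos
      positivity
    rwa [eta0, le_div_iff₀ (by positivity)] at hη'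
  · have h1 := hmono x (mem_ball_zero_iff.2 hx)
    rw [inner_sub_left] at h1
    have h2 := (neg_le_of_abs_le (abs_real_inner_le_norm (gradient (F ξ) 0) x))
    have h3 := mul_le_mul_of_nonneg_right hb (norm_nonneg x)
    linarith
  · have h1 := norm_le_norm_add_norm_sub' (gradient (F ξ) x) (gradient (F ξ) 0)
    linarith [hlip x (mem_ball_zero_iff.2 hx)]

end Assumption

variable [IsProbabilityMeasure μ] {K M C : ℝ} {Φ : E d → ℝ → E d}

theorem L2_eq_of_isUnbiasedField (hA : Assumption μ F f γ b R₁)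
    (hG : IsUnbiasedField μ R γ K (fun ξ => gradient (F ξ)) (gradient f)) (v : E d → ℝ) {x : E d}
    (hx : x ∈ ball (0 : E d) R) :
    L2 μ F f v x = secondOrderOp (driftCoeff (gradient f))
      (diffusionCoeff μ (fun ξ => gradient (F ξ)) (gradient f)) v x :=
  L2_eq_secondOrderOp isOpen_ball
    (fun y _ => (hA.unbiased y).differentiableAt.differentiableWithinAt)
    (hG.dissipative.ckBound.1.differentiableOn (by simp)) hx (hG.measurable x)
    fun ξ => (hG.ckBound ξ).norm_le hx

theorem isExpansion_duhamel (hA : Assumption μ F f γ b R₁)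
    (hG : IsUnbiasedField μ R γ K (fun ξ => gradient (F ξ)) (gradient f))
    (hΦ : IsSemiflow (ball (0 : E d) R) (gradient f) Φ) (hM : 0 ≤ M)
    (hφ : CkBound (ball (0 : E d) R) 6 M φ)
    (hC : ExpansionBounds μ R γ K (fun ξ => gradient (F ξ)) (gradient f) Φ φ C) :
    IsExpansion μ F f R φ (fun x t => φ (Φ x t))
      (duhamel Φ (expansionSource μ (fun ξ => gradient (F ξ)) (gradient f) Φ φ)) := by
  have h0 := hG.dissipative.solvesTransport_leading hΦ hM (hφ.derivBound isOpen_ball)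
  have h1 := hC.correction_solves
  refine ⟨⟨h0.contDiffOn, fun x hx => by rw [hΦ.zero x hx], fun x hx t ht => ?_⟩, fun t ht =>
    ((hC.leading t ht).contDiffOn isOpen_ball).of_le (by norm_cast),
    ⟨h1.contDiffOn, fun x _ => by simp [duhamel], fun x hx t ht => ?_⟩⟩
  · rw [L1_eq_transportOp]; exact h0.equation x hx t ht
  · rw [L1_eq_transportOp, L2_eq_of_isUnbiasedField hA hG _ hx]; exact h1.equation x hx t ht

/-- The first two coefficients of the expansion are uniquely determined. -/
theorem IsExpansion.eq_duhamel (hA : Assumption μ F f γ b R₁)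
    (hG : IsUnbiasedField μ R γ K (fun ξ => gradient (F ξ)) (gradient f))
    (hΦ : IsSemiflow (ball (0 : E d) R) (gradient f) Φ) (hM : 0 ≤ M)
    (hφ : CkBound (ball (0 : E d) R) 6 M φ)
    (hC : ExpansionBounds μ R γ K (fun ξ => gradient (F ξ)) (gradient f) Φ φ C)
    {u₀ u₁ : E d → ℝ → ℝ} (hu : IsExpansion μ F f R φ u₀ u₁) {x : E d}
    (hx : x ∈ ball (0 : E d) R) {t : ℝ} (ht : 0 ≤ t) :
    u₀ x t = φ (Φ x t) ∧
    u₁ x t = duhamel Φ (expansionSource μ (fun ξ => gradient (F ξ)) (gradient f) Φ φ) x t := by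
  have h0 := hG.dissipative.solvesTransport_leading hΦ hM (hφ.derivBound isOpen_ball)
  have e0 : ∀ y ∈ ball (0 : E d) R, ∀ s, 0 ≤ s → u₀ y s = φ (Φ y s) :=
    SolvesTransport.unique isOpen_ball hΦ ⟨hu.solution_zero.contDiffOn, fun y hy s hs => by
      rw [← L1_eq_transportOp]; exact hu.solution_zero.equation y hy s hs⟩ h0
      fun y hy => by rw [hu.solution_zero.initial y hy, hΦ.zero y hy]
  refine ⟨e0 x hx t ht, ?_⟩
  refine SolvesTransport.unique isOpen_ball hΦ ⟨hu.solution_one.contDiffOn, fun y hy s hs => ?_⟩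
    hC.correction_solves (fun y hy => ?_) x hx t ht
  · have h1 := hu.solution_one.equation y hy s hs
    rw [L1_eq_transportOp, L2_eq_of_isUnbiasedField hA hG _ hy] at h1
    rwa [expansionSource, ← secondOrderOp_congr isOpen_ball (fun z hz => e0 z hz s hs) hy]
  · rw [hu.solution_one.initial y hy]; simp [duhamel]

end SGD

/-! ### Summing local errors by the Markov property -/

/-- Half of the exponent absorbs the factor `1 + jη`; the other half gives a geometric series. With
`x = cη/2`, the inequality `1 + x ≤ e^x` yields `x / (1 - e^{-x}) ≤ 1 + x`, which stays bounded as
`η → 0`. -/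
theorem mul_sum_exp_mul_one_add_le {c η : ℝ} (hc : 0 < c) (hη : 0 < η) (n : ℕ) :
    η * ∑ j ∈ Finset.range n, Real.exp (-c * (j * η)) * (1 + j * η) ≤
      (1 + 2 / c) * (2 / c) * (1 + c / 2 * η) := by
  have hq : Real.exp (-(c / 2) * η) < 1 := by
    rw [Real.exp_lt_one_iff]; nlinarith [mul_pos hc hη]
  have h1 : ∀ j : ℕ, Real.exp (-c * (j * η)) * (1 + j * η) ≤
      (1 + 2 / c) * Real.exp (-(c / 2) * η) ^ j := fun j => by
    have h2 := mul_exp_neg_le (c := c / 2) (t := j * η) (by positivity)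
    have h3 := exp_neg_mul_le_one (c := c / 2) (t := j * η) (by positivity) (by positivity)
    have h4 : Real.exp (-(c / 2) * η) ^ j = Real.exp (-(c / 2) * (j * η)) := by
      rw [← Real.exp_nat_mul]; ring_nf
    have h5 : Real.exp (-c * (j * η)) =
        Real.exp (-(c / 2) * (j * η)) * Real.exp (-(c / 2) * (j * η)) := by
      rw [← Real.exp_add]; ring_nf
    rw [one_div_div] at h2
    rw [h4, h5, mul_assoc, mul_comm]
    gcongr
    linarith
  have h2 : ∑ j ∈ Finset.range n, Real.exp (-(c / 2) * η) ^ j ≤ (1 - Real.exp (-(c / 2) * η))⁻¹ := by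
    rw [← tsum_geometric_of_lt_one (Real.exp_pos _).le hq]
    exact (summable_geometric_of_lt_one (Real.exp_pos _).le hq).sum_le_tsum _
      fun _ _ => (pow_pos (Real.exp_pos _) _).le
  have h3 : η * (1 - Real.exp (-(c / 2) * η))⁻¹ ≤ 2 / c * (1 + c / 2 * η) := by
    have h4 := Real.add_one_le_exp (c / 2 * η)
    have h5 : Real.exp (-(c / 2) * η) * Real.exp (c / 2 * η) = 1 := by
      rw [← Real.exp_add]; simp
    have h6 : c / 2 * η ≤ (1 + c / 2 * η) * (1 - Real.exp (-(c / 2) * η)) := by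
      nlinarith [Real.exp_pos (-(c / 2) * η)]
    rw [← div_eq_mul_inv, div_le_iff₀ (sub_pos.2 hq), mul_assoc, div_mul_eq_mul_div,
      le_div_iff₀ hc]
    linarith
  calc η * ∑ j ∈ Finset.range n, Real.exp (-c * (j * η)) * (1 + j * η)
      ≤ η * ∑ j ∈ Finset.range n, (1 + 2 / c) * Real.exp (-(c / 2) * η) ^ j := by
        exact mul_le_mul_of_nonneg_left (Finset.sum_le_sum fun j _ => h1 j) hη.le
    _ = (1 + 2 / c) * (η * ∑ j ∈ Finset.range n, Real.exp (-(c / 2) * η) ^ j) := by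
        rw [← Finset.mul_sum]; ring
    _ ≤ (1 + 2 / c) * (η * (1 - Real.exp (-(c / 2) * η))⁻¹) := by gcongr
    _ ≤ (1 + 2 / c) * (2 / c * (1 + c / 2 * η)) := by gcongr
    _ = _ := by ring

namespace SGD

variable {d : ℕ} {Ξ : Type*} [MeasurableSpace Ξ] {F : Ξ → E d → ℝ} {η : ℝ}
  {Ω : Type*} [MeasurableSpace Ω] {P : Measure Ω} {ξ : ℕ → Ω → Ξ} {U : Set (E d)}

omit [MeasurableSpace Ξ] [MeasurableSpace Ω] in
theorem iterate_mem (hstep : ∀ y ∈ U, ∀ ζ, y - η • gradient (F ζ) y ∈ U) {x : E d} (hx : x ∈ U)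
    (n : ℕ) (ω : Ω) : iterate F η ξ x n ω ∈ U := by
  induction n with
  | zero => exact hx
  | succ n ih => exact hstep _ ih _

omit [MeasurableSpace Ω] in
/-- The `n`-th iterate is a measurable function of the first `n` samples. -/
theorem exists_iterate_eq_comp
    (hm : Measurable fun p : E d × Ξ => gradient (F p.2) p.1) (x : E d) (n : ℕ) :
    ∃ g : (Finset.range n → Ξ) → E d, Measurable g ∧
      ∀ ω, iterate F η ξ x n ω = g fun i => ξ i ω := by
  induction n with
  | zero => exact ⟨fun _ => x, measurable_const, fun _ => rfl⟩
  | succ n ih =>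
    obtain ⟨g, hg, h⟩ := ih
    let r : (Finset.range (n + 1) → Ξ) → Finset.range n → Ξ := fun z i =>
      z ⟨i, Finset.mem_range.2 ((Finset.mem_range.1 i.2).trans n.lt_succ_self)⟩
    have hr : Measurable r := measurable_pi_lambda _ fun i => measurable_pi_apply _
    refine ⟨fun z => g (r z) - η • gradient (F (z ⟨n, Finset.self_mem_range_succ n⟩)) (g (r z)),
      (hg.comp hr).sub ((hm.comp ((hg.comp hr).prodMk (measurable_pi_apply _))).const_smul η),
      fun ω => ?_⟩
    rw [iterate, h ω]

theorem measurable_iterate (hm : Measurable fun p : E d × Ξ => gradient (F p.2) p.1)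
    (hξ : ∀ n, Measurable (ξ n)) (x : E d) (n : ℕ) : Measurable (iterate F η ξ x n) := by
  obtain ⟨g, hg, h⟩ := exists_iterate_eq_comp (η := η) (ξ := ξ) hm x n
  rw [funext h]
  exact hg.comp (measurable_pi_lambda _ fun i => hξ i)

theorem indepFun_iterate (hm : Measurable fun p : E d × Ξ => gradient (F p.2) p.1)
    (hξ : ∀ n, Measurable (ξ n)) (hi : iIndepFun ξ P) (x : E d) (n : ℕ) :
    IndepFun (iterate F η ξ x n) (ξ n) P := by
  obtain ⟨g, hg, h⟩ := exists_iterate_eq_comp (η := η) (ξ := ξ) hm x n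
  have h1 := hi.indepFun_finset (Finset.range n) {n} (by simp) hξ
  have h2 := h1.comp hg (measurable_pi_apply (⟨n, Finset.mem_singleton_self n⟩ : ({n} : Finset ℕ)))
  rw [funext h]
  exact h2

variable {μ : Measure Ξ} [IsProbabilityMeasure μ] [IsProbabilityMeasure P]

/-- The Markov property of stochastic gradient descent. -/
theorem integral_iterate_succ (hm : Measurable fun p : E d × Ξ => gradient (F p.2) p.1)
    (hξ : ∀ n, Measurable (ξ n)) (hi : iIndepFun ξ P) (hμ : ∀ n, P.map (ξ n) = μ)
    (hU : MeasurableSet U) (hstep : ∀ y ∈ U, ∀ ζ, y - η • gradient (F ζ) y ∈ U) {x : E d}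
    (hx : x ∈ U) {w : E d → ℝ} {B : ℝ} (hw : ContinuousOn w U) (hB : ∀ y ∈ U, ‖w y‖ ≤ B) (n : ℕ) :
    Integrable (fun ω => ∫ ζ, w (iterate F η ξ x n ω -
      η • gradient (F ζ) (iterate F η ξ x n ω)) ∂μ) P ∧
    ∫ ω, w (iterate F η ξ x (n + 1) ω) ∂P =
      ∫ ω, ∫ ζ, w (iterate F η ξ x n ω - η • gradient (F ζ) (iterate F η ξ x n ω)) ∂μ ∂P := by
  have hX := measurable_iterate (η := η) hm hξ x n
  have hXU := iterate_mem (ξ := ξ) hstep hx n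
  let T : E d × Ξ → E d := fun p => p.1 - η • gradient (F p.2) p.1
  have hT : Measurable T := measurable_fst.sub (hm.const_smul η)
  -- Fubini takes place on the whole product space, so `w` is replaced by a function that is
  -- measurable and bounded everywhere; the iterates never leave `U`.
  let w' : E d → ℝ := U.indicator w
  have hw' : Measurable (U.indicator w) := by
    classical
    rw [← piecewise_eq_indicator]
    exact hw.measurable_piecewise continuousOn_const hU
  have hB' : ∀ y, ‖w' y‖ ≤ |B| := fun y => by
    by_cases hy : y ∈ U
    · simpa [w', hy] using (hB y hy).trans (le_abs_self B)
    · simp [w', hy]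
  have e : ∀ ω ζ, w (iterate F η ξ x n ω - η • gradient (F ζ) (iterate F η ξ x n ω)) =
      w' (T (iterate F η ξ x n ω, ζ)) := fun ω ζ =>
    (indicator_of_mem (hstep _ (hXU ω) ζ) w).symm
  have hlaw := (indepFun_iff_map_prod_eq_prod_map_map hX.aemeasurable (hξ n).aemeasurable).1
    (indepFun_iterate (η := η) hm hξ hi x n)
  rw [hμ n] at hlaw
  have : IsProbabilityMeasure (P.map (iterate F η ξ x n)) :=
    Measure.isProbabilityMeasure_map hX.aemeasurable
  have hint : Integrable (fun p => w' (T p)) ((P.map (iterate F η ξ x n)).prod μ) :=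
    Integrable.of_bound (hw'.comp hT).aestronglyMeasurable |B| (ae_of_all _ fun p => hB' _)
  simp_rw [e]
  refine ⟨hint.integral_prod_left.comp_measurable hX, ?_⟩
  have h1 : ∀ ω, w (iterate F η ξ x (n + 1) ω) = w' (T (iterate F η ξ x n ω, ξ n ω)) :=
    fun ω => e ω (ξ n ω)
  simp_rw [h1]
  rw [← integral_map (φ := fun ω => (iterate F η ξ x n ω, ξ n ω)) (f := fun p => w' (T p))
    (hX.prodMk (hξ n)).aemeasurable (hw'.comp hT).aestronglyMeasurable, hlaw,
    integral_prod _ hint, integral_map (f := fun y => ∫ ζ, w' (T (y, ζ)) ∂μ) hX.aemeasurable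
      hint.integral_prod_left.aestronglyMeasurable]

theorem integrable_comp_iterate (hm : Measurable fun p : E d × Ξ => gradient (F p.2) p.1)
    (hξ : ∀ n, Measurable (ξ n)) (hstep : ∀ y ∈ U, ∀ ζ, y - η • gradient (F ζ) y ∈ U) {x : E d}
    (hx : x ∈ U) {w : E d → ℝ} {B : ℝ} (hw : ContinuousOn w U) (hB : ∀ y ∈ U, ‖w y‖ ≤ B) (n : ℕ) :
    Integrable (fun ω => w (iterate F η ξ x n ω)) P :=
  Integrable.of_bound (hw.measurable_comp_of_mem (measurable_iterate hm hξ x n)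
    (iterate_mem hstep hx n)).aestronglyMeasurable B
    (ae_of_all _ fun ω => hB _ (iterate_mem hstep hx n ω))

/-- Local errors of an approximation of the semigroup of stochastic gradient descent add up. -/
theorem abs_integral_iterate_sub_le (hm : Measurable fun p : E d × Ξ => gradient (F p.2) p.1)
    (hξ : ∀ n, Measurable (ξ n)) (hi : iIndepFun ξ P) (hμ : ∀ n, P.map (ξ n) = μ)
    (hU : MeasurableSet U) (hstep : ∀ y ∈ U, ∀ ζ, y - η • gradient (F ζ) y ∈ U) {x : E d}
    (hx : x ∈ U) {w : ℕ → E d → ℝ} {B δ : ℕ → ℝ} (hw : ∀ m, ContinuousOn (w m) U)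
    (hB : ∀ m, ∀ y ∈ U, ‖w m y‖ ≤ B m)
    (hδ : ∀ m, ∀ y ∈ U, |∫ ζ, w m (y - η • gradient (F ζ) y) ∂μ - w (m + 1) y| ≤ δ m) (n m : ℕ) :
    |∫ ω, w m (iterate F η ξ x n ω) ∂P - w (m + n) x| ≤ ∑ j ∈ Finset.range n, δ (m + j) := by
  induction n generalizing m with
  | zero => simp [iterate]
  | succ n ih =>
    obtain ⟨h1, h2⟩ := integral_iterate_succ hm hξ hi hμ hU hstep hx (hw m) (hB m) n
    have h3 := integrable_comp_iterate (P := P) hm hξ hstep hx (hw (m + 1)) (hB (m + 1)) n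
    have h4 : |∫ ω, w m (iterate F η ξ x (n + 1) ω) ∂P -
        ∫ ω, w (m + 1) (iterate F η ξ x n ω) ∂P| ≤ δ m := by
      have hd : ∀ ω, ‖(∫ ζ, w m (iterate F η ξ x n ω - η • gradient (F ζ) (iterate F η ξ x n ω)) ∂μ)
          - w (m + 1) (iterate F η ξ x n ω)‖ ≤ δ m := fun ω => hδ m _ (iterate_mem hstep hx n ω)
      rw [h2, ← integral_sub h1 h3]
      simpa using norm_integral_le_of_norm_le_const (μ := P) (ae_of_all _ hd)
    -- The index `m` counts the time already evolved in `w`. The last random step is traded for one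
    -- step of `w`, leaving `n` random steps started from `w (m + 1)`.
    have h5 := ih (m + 1)
    rw [Finset.sum_range_succ', Finset.sum_congr rfl fun j _ =>
      congrArg δ (show m + (j + 1) = m + 1 + j by omega), show m + (n + 1) = m + 1 + n by omega,
      add_zero]
    exact (abs_sub_le _ _ _).trans (by linarith)

omit [IsProbabilityMeasure μ] in
theorem Assumption.measurable_gradient_uncurry {f : E d → ℝ} {γ b R₁ : ℝ}
    (hA : Assumption μ F f γ b R₁) : Measurable fun p : E d × Ξ => gradient (F p.2) p.1 :=
  measurable_uncurry_of_continuous_of_measurable (u := fun x ζ => gradient (F ζ) x)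
    (fun ζ => (hA.contDiff_gradient ζ).continuous) hA.measurable_gradient

end SGD

/-! ### The theorem -/

theorem theorem2 {d : ℕ} {Ξ : Type*} [MeasurableSpace Ξ] (μ : Measure Ξ) [IsProbabilityMeasure μ]
    (F : Ξ → SGD.E d → ℝ) (f : SGD.E d → ℝ) (γ b R₁ R L : ℝ)
    (hA : SGD.Assumption μ F f γ b R₁)
    (hR₀ : 16 * b / (3 * γ) < R) (hR₁ : R ≤ R₁)
    (hL : ∀ ξ, ∀ x ∈ ball (0 : SGD.E d) R, ‖fderiv ℝ (gradient (F ξ)) x‖ ≤ L)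
    (hF : SGD.IsCkBall 7 R F)
    (φ : SGD.E d → ℝ) (hφ : SGD.IsCkBall 6 R (fun _ : Unit => φ)) :
    (∃ u₀ u₁ : SGD.E d → ℝ → ℝ, SGD.IsExpansion μ F f R φ u₀ u₁) ∧
    ∃ C : ℝ, 0 < C ∧
      ∀ u₀ u₁ : SGD.E d → ℝ → ℝ, SGD.IsExpansion μ F f R φ u₀ u₁ →
      ∀ η : ℝ, 0 < η → η ≤ SGD.eta0 γ b L R →
      ∀ (Ω : Type*) [MeasurableSpace Ω] (P : Measure Ω) [IsProbabilityMeasure P]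
        (ξ : ℕ → Ω → Ξ), (∀ n, Measurable (ξ n)) → iIndepFun ξ P → (∀ n, P.map (ξ n) = μ) →
      ∀ n : ℕ, ∀ x ∈ ball (0 : SGD.E d) R,
        Integrable (fun ω => φ (SGD.iterate F η ξ x n ω)) P ∧
        |(∫ ω, φ (SGD.iterate F η ξ x n ω) ∂P) - (u₀ x (n * η) + η * u₁ x (n * η))|
          ≤ C * η ^ 2 := by
  have hR := hA.radius_pos_of_lt hR₀
  obtain ⟨K, hG⟩ := hA.exists_isUnbiasedField hR hR₁ hF
  obtain ⟨Φ, hΦ⟩ := hG.dissipative.exists_semiflow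
  obtain ⟨M, hM, hφM⟩ := hφ.exists_ckBound hR
  obtain ⟨C, hC⟩ := hG.exists_expansionBounds hΦ hM (hφM ())
  refine ⟨⟨_, _, SGD.isExpansion_duhamel hA hG hΦ hM (hφM ()) hC⟩, ?_⟩
  have hγ := hA.gamma_pos
  have hK := hG.dissipative.K_pos
  have hC0 := hC.nonneg
  set c := γ / 4 with hc
  have hc0 : 0 < c := by positivity
  set D := C * (9 * K ^ 3 + 3 * K ^ 2 + 1 + K) with hD
  have hD0 : 0 ≤ D := by positivity
  -- The sum of the local errors still depends on `η`; the threshold makes it uniform. The absolute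
  -- value and the added `1` in the constant give positivity without further case distinctions.
  set S := (1 + 2 / c) * (2 / c) * (1 + c / 2 * |SGD.eta0 γ b L R|) with hS
  refine ⟨D * S + 1, by positivity, ?_⟩
  intro u₀ u₁ hu η hη hη' Ω _ P _ ξ hξ hi hμ n x hx
  have hstep : ∀ y ∈ ball (0 : SGD.E d) R, ∀ ζ, y - η • gradient (F ζ) y ∈ ball (0 : SGD.E d) R :=
    fun y hy ζ => hA.step_mem_ball hR₁ hL hη hη' hy ζ
  have hm := hA.measurable_gradient_uncurry
  have hint := SGD.integrable_comp_iterate (P := P) hm hξ hstep hx (hφM ()).continuousOn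
    (fun y hy => (hφM ()).norm_le hy) n
  refine ⟨hint, ?_⟩
  obtain ⟨e0, e1⟩ := hu.eq_duhamel hA hG hΦ hM (hφM ()) hC hx (t := n * η) (by positivity)
  have ht : ∀ m : ℕ, 0 ≤ m * η := fun m => by positivity
  -- The functions `w m` are `u¹(·, mη)`: `w 0` is `φ` on the ball, and `w n` is the claimed
  -- approximation.
  have key := SGD.abs_integral_iterate_sub_le (P := P) (μ := μ) hm hξ hi hμ measurableSet_ball
    hstep hx
    (w := fun m y => φ (Φ y (m * η)) +
      η * duhamel Φ (expansionSource μ (fun ζ => gradient (F ζ)) (gradient f) Φ φ) y (m * η))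
    (B := fun m => C + η * (C * (m * η)))
    (δ := fun m => D * η ^ 3 * (Real.exp (-c * (m * η)) * (1 + m * η)))
    (fun m => (hC.leading _ (ht m)).1.continuousOn.add
      (continuousOn_const.mul (hC.correction _ (ht m)).1.continuousOn))
    (fun m y hy => by
      refine (norm_add_le _ _).trans (add_le_add (hC.leading_le _ (hΦ.mem y hy _ (ht m))) ?_)
      rw [norm_mul, Real.norm_of_nonneg hη.le]
      exact mul_le_mul_of_nonneg_left (hC.norm_correction_le hγ.le hΦ hy (ht m)) hη.le)
    (fun m y hy => by
      have := hC.norm_local_error_le hG hΦ hy (ht m) hη.le (hstep y hy)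
      rw [← add_one_mul] at this
      simpa using this) n 0
  have h0 : ∀ ω, φ (Φ (SGD.iterate F η ξ x n ω) 0) = φ (SGD.iterate F η ξ x n ω) := fun ω => by
    rw [hΦ.zero _ (SGD.iterate_mem hstep hx n ω)]
  simp only [zero_add, Nat.cast_zero, zero_mul, h0, duhamel, intervalIntegral.integral_same,
    mul_zero, add_zero] at key
  rw [e0, e1]
  refine key.trans ?_
  have h1 := mul_sum_exp_mul_one_add_le hc0 hη n
  have h2 : (1 + 2 / c) * (2 / c) * (1 + c / 2 * η) ≤ S := by
    rw [hS]; gcongr; exact hη'.trans (le_abs_self _)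
  rw [← Finset.mul_sum]
  calc D * η ^ 3 * ∑ j ∈ Finset.range n, Real.exp (-c * (j * η)) * (1 + j * η)
      = D * η ^ 2 * (η * ∑ j ∈ Finset.range n, Real.exp (-c * (j * η)) * (1 + j * η)) := by ring
    _ ≤ D * η ^ 2 * S := by gcongr; exact h1.trans h2
    _ ≤ (D * S + 1) * η ^ 2 := by nlinarith [sq_nonneg η]
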